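/- Let $\frac12<\alpha<\frac32$. There is a constant $C_\alpha$, depending only on $\alpha$, such that the following holds. Let $n\ge 2$ and $1\le p\le \frac{2n+2}{n+1+4\alpha}$. Then there is a constant $K=K(n,\alpha,p)$ such that for all $f\in L^p(\mathbb{R}^n)$ and all $\varepsilon>0$, $$\bigg|\int_{\frac12<|\xi|<\frac32}\frac{|\hat f(\xi)|^2}{\big((1-|\xi|^2)^2+\varepsilon^2\big)^{\alpha}}\,d\xi-\frac{C_\alpha}{\varepsilon^{2\alpha-1}}\,\|\hat f\|_{L^2(S^{n-1})}^2\bigg|\le K\,\|f\|_{L^p(\mathbb{R}^n)}^2 ,$$ where the integral is finite. Here $\hat f(\xi)=\int_{\mathbb{R}^n}e^{-i\xi\cdot x}f(x)\,dx$ for Schwartz $f$; for general $f\in L^p(\mathbb{R}^n)$, $\hat f$ is the function that represents the Fourier transform of $f$ as a tempered distribution. $S^{n-1}$ is the unit sphere with its surface measure, and the restriction $\hat f|_{S^{n-1}}\in L^2(S^{n-1})$ is obtained by continuous extension from Schwartz functions: it is the limit in $L^2(S^{n-1})$ of $\hat\varphi_k|_{S^{n-1}}$ for Schwartz functions $\varphi_k\to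 f$ in $L^p(\mathbb{R}^n)$. Both $\hat f$ and $\hat f|_{S^{n-1}}$ exist for every $f \in L^p(\mathbb{R}^n)$ with $p$ in the stated range. -/

import Mathlib

open MeasureTheory Filter Topology

noncomputable section

/-- The Fourier integral with the convention `∫ e^{-i ξ·x} f(x) dx` (no `2π` in the exponent). -/
def fourierHat {n : ℕ} (f : EuclideanSpace ℝ (Fin n) → ℂ) (ξ : EuclideanSpace ℝ (Fin n)) : ℂ :=
  ∫ x, Complex.exp (-(Complex.I * ((inner ℝ ξ x : ℝ) : ℂ))) * f x

/-- The function `g` is the Fourier transform of `f` in the sense of tempered distributions: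
`⟨g, φ⟩ = ⟨f, φ̂⟩` for every Schwartz function `φ`. This determines `g` almost everywhere. -/
def IsFourierTransform {n : ℕ} (f g : EuclideanSpace ℝ (Fin n) → ℂ) : Prop :=
  ∀ φ : SchwartzMap (EuclideanSpace ℝ (Fin n)) ℂ,
    Integrable (fun ξ => g ξ * φ ξ) ∧ ∫ ξ, g ξ * φ ξ = ∫ x, f x * fourierHat (⇑φ) x

/-- Surface measure on the unit sphere of `ℝⁿ` (total mass `n · vol(B)`). -/
def surfaceMeasure (n : ℕ) : Measure (Metric.sphere (0 : EuclideanSpace ℝ (Fin n)) 1) :=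
  (volume : Measure (EuclideanSpace ℝ (Fin n))).toSphere

/-- The function `h ∈ L²(S^{n-1})` is the restriction of `f̂` to the unit sphere, for `f ∈ L^p`:
the restriction map `φ ↦ φ̂|_{S^{n-1}}` on Schwartz functions is extended by continuity
from the `L^p` norm to the `L²(S^{n-1})` norm. -/
def IsSphereRestriction {n : ℕ} (p : ℝ) (f : EuclideanSpace ℝ (Fin n) → ℂ)
    (h : Metric.sphere (0 : EuclideanSpace ℝ (Fin n)) 1 → ℂ) : Prop :=
  MemLp h 2 (surfaceMeasure n) ∧
  ∃ φ : ℕ → SchwartzMap (EuclideanSpace ℝ (Fin n)) ℂ,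
    Tendsto (fun k => eLpNorm (fun x => φ k x - f x) (ENNReal.ofReal p) volume) atTop (𝓝 0) ∧
    Tendsto (fun k => eLpNorm (fun ω : Metric.sphere (0 : EuclideanSpace ℝ (Fin n)) 1 =>
      fourierHat (⇑(φ k)) ω - h ω) 2 (surfaceMeasure n)) atTop (𝓝 0)

/-- The annulus `1/2 < |ξ| < 3/2`. -/
def annulus (n : ℕ) : Set (EuclideanSpace ℝ (Fin n)) :=
  {ξ | 1 / 2 < ‖ξ‖ ∧ ‖ξ‖ < 3 / 2}

end

/-! Write w(u) = (ε² + u²)^(-α). The weight is w(1 - |ξ|²), and ∫ w = ε^(1-2α) ∫ (1 + u²)^(-α). For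
small ε the mass of w sits near u = 0, and u = 1 - r² has |du/dr| = 2 at r = 1, so the main term is
(∫ w)/2 times the squared norm on the sphere; hence C_α = (1/2) ∫ (1 + u²)^(-α). What must be shown
is that w minus (∫ w) times the point mass at 0, taken at 1 - |ξ|² and paired with the squared
modulus of the Fourier transform, is bounded uniformly in ε.

Up to sign, the cosine transform of this difference is D(s) = ∫ (1 - cos su) w(u) du = s^(2α-1)
`cosDefect α (ε s)`. The second factor decreases in s and is bounded by its value at ε = 0, which is
finite because α < 3/2. Inverting the transform with a damping e^(-δs)
(`integral_exp_mul_defect_mul_cos`, `abs_integral_sub_sphere_le`) bounds the error, up to constants,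
by ∫₀^∞ e^(-δs) D(s) Re⟨e^{is(1+Δ)}F, F⟩ ds, uniformly in δ. Here F is f cut off to bounded
frequencies. The range s ≤ 1 costs only the L² norm of F.

For s ≥ 1 the factor e^(-δs) `cosDefect α (ε s)`, normalised, is a decreasing amplitude a ≤ 1. Stein
interpolation is applied to ∫₁^∞ a(s) s^(ζ(n+1)/2 - 1) ⟨e^{is(1+Δ)}F, G⟩ ds. On Re ζ = 0 this is a
Fourier multiplier of the form ∫ a(s) s^(-1+iτ) e^(ils) ds, bounded after multiplication by τ. On Re
ζ = 1 the dispersive factor s^(-n/2) leaves ∫ a(s) s^(-1/2+iτ) e^(i(s+ρ²/s)) ds, bounded uniformly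
in ρ by stationary phase. In both cases Bonnet's mean value theorem
(`norm_integral_antitone_mul_le`) removes a, so that nothing depends on ε or δ. The exponent 2α - 1
occurs at ζ = θ = 4α/(n+1), and 1/p₀ = (1+θ)/2 is the endpoint p₀ = (2n+2)/(n+1+4α).

For p ≤ p₀, Young's inequality for the frequency cutoff bounds F in L² and in L^(p₀) by f in L^p;
outside the annulus the weight is bounded, so Plancherel handles that region. Taking ε = 1 in the
resulting estimate also yields the restriction estimate. The passage from Schwartz functions to L^p
is then by density. -/

open scoped FourierTransform

/-! ### Removal of monotone amplitudes -/

/-- The Bonnet form of the second mean value theorem, as an inequality: integrating against a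
decreasing amplitude bounded by `1` does not exceed the bound for the partial integrals. -/
theorem norm_integral_antitone_mul_le {a : ℝ → ℝ} {k : ℝ → ℂ} {M : ℝ}
    (ham : Measurable a) (ha : AntitoneOn a (Set.Ici 1)) (ha0 : ∀ s ∈ Set.Ici (1 : ℝ), 0 ≤ a s)
    (ha1 : ∀ s ∈ Set.Ici (1 : ℝ), a s ≤ 1) (hlim : Tendsto a atTop (𝓝 0))
    (hk : ContinuousOn k (Set.Ici 1)) (h_integ : IntegrableOn (fun s => (a s : ℂ) * k s) (Set.Ioi 1))
    (hM : ∀ R, 1 ≤ R → ‖∫ s in (1 : ℝ)..R, k s‖ ≤ M) :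
    ‖∫ s in Set.Ioi 1, (a s : ℂ) * k s‖ ≤ M := by
  have hkm : AEStronglyMeasurable k (volume.restrict (Set.Ioi 1)) :=
    (hk.mono Set.Ioi_subset_Ici_self).aestronglyMeasurable measurableSet_Ioi
  -- the slice bound
  have hslice : ∀ t ∈ Set.Ioc (0 : ℝ) 1,
      ‖∫ s in Set.Ioi 1, (if t < a s then k s else 0)‖ ≤ M := by
    intro t ht
    have hset : MeasurableSet {s | t < a s} := measurableSet_lt measurable_const ham
    have e1 : ∫ s in Set.Ioi 1, (if t < a s then k s else 0)
        = ∫ s in Set.Ioi 1 ∩ {s | t < a s}, k s := by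
      rw [← setIntegral_indicator hset]
      rfl
    rw [e1]
    set S := Set.Ioi 1 ∩ {s | t < a s} with hS
    have hM0 : 0 ≤ M := by simpa using hM 1 le_rfl
    rcases S.eq_empty_or_nonempty with hemp | hne
    · simp [hemp, hM0]
    have hbdd : BddAbove S := by
      obtain ⟨N, hN⟩ := eventually_atTop.1 (hlim.eventually (gt_mem_nhds ht.1))
      refine ⟨N, fun s hs => ?_⟩
      by_contra hcon
      exact lt_asymm hs.2 (hN s (not_le.1 hcon).le)
    -- Since a decreases, the superlevel set is an interval starting at 1, known up to its right
    -- endpoint; the slice is therefore one of the partial integrals bounded by M.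
    have h1 : Set.Ioo 1 (sSup S) ⊆ S := by
      intro s hs
      obtain ⟨s', hs', hlt⟩ := exists_lt_of_lt_csSup hne hs.2
      exact ⟨hs.1, lt_of_lt_of_le hs'.2 (ha (Set.mem_Ici.2 hs.1.le) (Set.mem_Ici.2 hs'.1.le) hlt.le)⟩
    have h2 : S ⊆ Set.Ioc 1 (sSup S) := fun s hs => ⟨hs.1, le_csSup hbdd hs⟩
    have hae : S =ᵐ[volume] Set.Ioc 1 (sSup S) := by
      refine (LE.le.eventuallyLE h2).antisymm ?_
      exact (Ioo_ae_eq_Ioc (μ := volume)).symm.le.trans (LE.le.eventuallyLE h1)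
    rw [setIntegral_congr_set hae]
    have hle : 1 ≤ sSup S := by
      obtain ⟨s, hs⟩ := hne
      exact (le_of_lt hs.1).trans (le_csSup hbdd hs)
    rw [← intervalIntegral.integral_of_le hle]
    exact hM _ hle
  -- Layer cake: a(s) is the length of {t ∈ (0,1] : t < a(s)}. After Fubini the integral is an
  -- average over t of the slices above.
  have hrep : ∀ s ∈ Set.Ioi (1 : ℝ), (a s : ℂ) * k s
      = ∫ t in Set.Ioc (0 : ℝ) 1, (if t < a s then k s else 0) := by
    intro s hs
    have h0 := ha0 s (Set.mem_Ici.2 (le_of_lt hs))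
    have h1 := ha1 s (Set.mem_Ici.2 (le_of_lt hs))
    have : (fun t => if t < a s then k s else 0) = Set.indicator (Set.Iio (a s)) (fun _ => k s) := by
      ext t; simp [Set.indicator]
    rw [this, setIntegral_indicator measurableSet_Iio]
    have h3 : Set.Ioc (0 : ℝ) 1 ∩ Set.Iio (a s) = Set.Ioo 0 (a s) := by
      ext t; simp only [Set.mem_inter_iff, Set.mem_Ioc, Set.mem_Iio, Set.mem_Ioo]
      constructor
      · rintro ⟨⟨h, _⟩, h'⟩; exact ⟨h, h'⟩
      · rintro ⟨h, h'⟩; exact ⟨⟨h, h'.le.trans h1⟩, h'⟩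
    rw [h3]
    simp [h0]
  rw [setIntegral_congr_fun measurableSet_Ioi hrep]
  have hmeas : AEStronglyMeasurable (fun q : ℝ × ℝ => if q.2 < a q.1 then k q.1 else 0)
      ((volume.restrict (Set.Ioi 1)).prod (volume.restrict (Set.Ioc 0 1))) := by
    have : (fun q : ℝ × ℝ => if q.2 < a q.1 then k q.1 else 0)
        = Set.indicator {q : ℝ × ℝ | q.2 < a q.1} (fun q => k q.1) := by
      ext q; simp [Set.indicator]
    rw [this]
    exact (hkm.comp_fst).indicator (measurableSet_lt measurable_snd (ham.comp measurable_fst))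
  rw [integral_integral_swap]
  · have := norm_setIntegral_le_of_norm_le_const (μ := volume) (s := Set.Ioc (0 : ℝ) 1)
      (f := fun t => ∫ s in Set.Ioi 1, (if t < a s then k s else 0)) (C := M) (by simp) hslice
    simpa using this
  · change Integrable (fun q : ℝ × ℝ => if q.2 < a q.1 then k q.1 else 0) _
    rw [integrable_prod_iff hmeas]
    constructor
    · refine Eventually.of_forall fun s => ?_
      have : (fun t => if t < a s then k s else 0)
          = Set.indicator (Set.Iio (a s)) (fun _ => k s) := by
        ext t; simp [Set.indicator]
      change Integrable (fun t => if t < a s then k s else 0) _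
      rw [this]
      exact (integrable_const _).indicator measurableSet_Iio
    · refine h_integ.norm.congr ?_
      filter_upwards [ae_restrict_mem measurableSet_Ioi] with s hs
      have h0 := ha0 s (Set.mem_Ici.2 (le_of_lt hs))
      have h1 := ha1 s (Set.mem_Ici.2 (le_of_lt hs))
      have : (fun t => ‖if t < a s then k s else 0‖)
          = Set.indicator (Set.Iio (a s)) (fun _ => ‖k s‖) := by
        ext t; by_cases h : t < a s <;> simp [Set.indicator, h]
      change _ = ∫ t in Set.Ioc (0 : ℝ) 1, ‖if t < a s then k s else 0‖
      rw [this, setIntegral_indicator measurableSet_Iio]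
      have h3 : Set.Ioc (0 : ℝ) 1 ∩ Set.Iio (a s) = Set.Ioo 0 (a s) := by
        ext t; simp only [Set.mem_inter_iff, Set.mem_Ioc, Set.mem_Iio, Set.mem_Ioo]
        constructor
        · rintro ⟨⟨h, _⟩, h'⟩; exact ⟨h, h'⟩
        · rintro ⟨h, h'⟩; exact ⟨⟨h, h'.le.trans h1⟩, h'⟩
      rw [h3]
      simp [h0, abs_of_nonneg h0]
-- Oscillatory integrals with linear phase
theorem hasDerivAt_ofReal_cpow {s : ℝ} (hs : 0 < s) (c : ℂ) :
    HasDerivAt (fun x : ℝ => (x : ℂ) ^ c) (c * (s : ℂ) ^ (c - 1)) s := by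
  have h := ((hasDerivAt_id (s : ℂ)).cpow_const (c := c) (Or.inl (by simpa using hs)))
  simpa using h.comp_ofReal

/-- Used to bound remainders of integrations by parts through an explicit primitive of a majorant.
-/
theorem norm_integral_le_sub_of_hasDerivAt {f : ℝ → ℂ} {g g' : ℝ → ℝ} {a b : ℝ} (hab : a ≤ b)
    (hg : ∀ x ∈ Set.Icc a b, HasDerivAt g (g' x) x) (hg' : ContinuousOn g' (Set.Icc a b))
    (hf : ∀ x ∈ Set.Icc a b, ‖f x‖ ≤ g' x) : ‖∫ x in a..b, f x‖ ≤ g b - g a := by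
  rw [← intervalIntegral.integral_eq_sub_of_hasDerivAt (f := g) (f' := g')
    (by rwa [Set.uIcc_of_le hab]) ((by rwa [Set.uIcc_of_le hab] : ContinuousOn g' (Set.uIcc a b)).intervalIntegrable)]
  refine intervalIntegral.norm_integral_le_of_norm_le hab ?_
    ((by rwa [Set.uIcc_of_le hab] : ContinuousOn g' (Set.uIcc a b)).intervalIntegrable)
  exact Eventually.of_forall fun x hx => hf x ⟨hx.1.le, hx.2⟩

theorem continuousOn_ofReal_cpow {a b : ℝ} (ha : 0 < a) (c : ℂ) :
    ContinuousOn (fun x : ℝ => (x : ℂ) ^ c) (Set.Icc a b) := fun _ hx =>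
  (hasDerivAt_ofReal_cpow (ha.trans_le hx.1) c).continuousAt.continuousWithinAt

theorem norm_ofReal_cpow_mul_I {s : ℝ} (hs : 0 < s) (x τ : ℝ) :
    ‖(s : ℂ) ^ ((x : ℂ) + τ * Complex.I)‖ = s ^ x := by
  rw [Complex.norm_cpow_eq_rpow_re_of_pos hs]; simp

theorem hasDerivAt_cexp_I_mul (l s : ℝ) :
    HasDerivAt (fun x : ℝ => Complex.exp (Complex.I * l * x))
      (Complex.I * l * Complex.exp (Complex.I * l * s)) s := by
  have h := (((hasDerivAt_id (s : ℂ)).const_mul (Complex.I * l)).cexp).comp_ofReal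
  simpa [mul_comm] using h

theorem norm_cexp_I_mul (l s : ℝ) : ‖Complex.exp (Complex.I * l * s)‖ = 1 := by
  rw [Complex.norm_exp]; simp

/-- The factor τ is absorbed by τ s^(-1+iτ) = -i (s^(iτ))'. Integrating this by parts leaves two
unimodular boundary terms and a remainder of size |l|(b - a). It is effective while |l| b ≤ 1. -/
theorem norm_mul_integral_cpow_mul_cexp_le_of_small {a b : ℝ} (ha : 0 < a) (hab : a ≤ b) (τ l : ℝ) :
    ‖(τ : ℂ) * ∫ s in a..b, (s : ℂ) ^ (-1 + τ * Complex.I) * Complex.exp (Complex.I * l * s)‖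
      ≤ 2 + |l| * (b - a) := by
  have hpos : ∀ x ∈ Set.Icc a b, 0 < x := fun x hx => ha.trans_le hx.1
  have hI := Set.uIcc_of_le hab
  have hnv : ∀ x ∈ Set.Icc a b, ‖(x : ℂ) ^ (τ * Complex.I)‖ = 1 := fun x hx => by
    simpa using norm_ofReal_cpow_mul_I (hpos x hx) 0 τ
  have key := intervalIntegral.integral_mul_deriv_eq_deriv_mul (a := a) (b := b)
    (u := fun s : ℝ => Complex.exp (Complex.I * l * s))
    (u' := fun s : ℝ => Complex.I * l * Complex.exp (Complex.I * l * s))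
    (v := fun s : ℝ => (s : ℂ) ^ (τ * Complex.I))
    (v' := fun s : ℝ => (τ * Complex.I) * (s : ℂ) ^ (τ * Complex.I - 1))
    (fun x _ => hasDerivAt_cexp_I_mul l x)
    (fun x hx => hasDerivAt_ofReal_cpow (hpos x (hI ▸ hx)) _)
    ((by fun_prop : Continuous _).intervalIntegrable _ _)
    (ContinuousOn.intervalIntegrable (by
      rw [hI]; exact continuousOn_const.mul (continuousOn_ofReal_cpow ha _)))
  have e : ∫ s in a..b, Complex.exp (Complex.I * l * s) *
      ((τ * Complex.I) * (s : ℂ) ^ (τ * Complex.I - 1))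
      = Complex.I * (τ * ∫ s in a..b, (s : ℂ) ^ (-1 + τ * Complex.I)
        * Complex.exp (Complex.I * l * s)) := by
    rw [← mul_assoc, ← intervalIntegral.integral_const_mul]
    congr 1; ext s
    rw [show (-1 + τ * Complex.I : ℂ) = τ * Complex.I - 1 by ring]; ring
  rw [e] at key
  have hn := congrArg norm key
  rw [norm_mul, Complex.norm_I, one_mul] at hn
  rw [hn]
  have h3 : ‖∫ s in a..b, Complex.I * l * Complex.exp (Complex.I * l * s) *
      (s : ℂ) ^ (τ * Complex.I)‖ ≤ |l| * (b - a) := by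
    have := norm_integral_le_sub_of_hasDerivAt (g := fun x => |l| * x) (g' := fun _ => |l|) hab
      (f := fun s : ℝ => Complex.I * l * Complex.exp (Complex.I * l * s) *
      (s : ℂ) ^ (τ * Complex.I))
      (fun x _ => by simpa using (hasDerivAt_id x).const_mul |l|) continuousOn_const
      (fun x hx => by
        rw [norm_mul, norm_mul, norm_mul, norm_cexp_I_mul, hnv x hx]; simp)
    simpa [mul_sub] using this
  refine (norm_sub_le _ _).trans (add_le_add ((norm_sub_le _ _).trans ?_) h3)
  rw [norm_mul, norm_mul, norm_cexp_I_mul, norm_cexp_I_mul, hnv a ⟨le_rfl, hab⟩,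
    hnv b ⟨hab, le_rfl⟩]
  norm_num

/-- Here the exponential is integrated instead, gaining 1/|l|, while the derivative of s^(-1+iτ) is
O((1+|τ|)/s²). It is effective once |l| a ≥ 1. -/
theorem norm_integral_cpow_mul_cexp_le_of_large {a b : ℝ} (ha : 0 < a) (hab : a ≤ b) (τ l : ℝ)
    (hl : l ≠ 0) :
    ‖∫ s in a..b, (s : ℂ) ^ (-1 + τ * Complex.I) * Complex.exp (Complex.I * l * s)‖
      ≤ (3 + |τ|) / (|l| * a) := by
  have hpos : ∀ x ∈ Set.Icc a b, 0 < x := fun x hx => ha.trans_le hx.1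
  have hI := Set.uIcc_of_le hab
  have hl' : (Complex.I * l : ℂ) ≠ 0 := mul_ne_zero Complex.I_ne_zero (by exact_mod_cast hl)
  have hl0 : 0 < |l| := abs_pos.2 hl
  have hnu : ∀ x ∈ Set.Icc a b, ‖(x : ℂ) ^ (-1 + τ * Complex.I)‖ = x⁻¹ := fun x hx => by
    have := norm_ofReal_cpow_mul_I (hpos x hx) (-1) τ
    rw [Real.rpow_neg_one] at this
    rw [← this]; push_cast; rfl
  have hnu' : ∀ x ∈ Set.Icc a b, ‖(x : ℂ) ^ (-1 + τ * Complex.I - 1)‖ = (x ^ 2)⁻¹ := fun x hx => by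
    have := norm_ofReal_cpow_mul_I (hpos x hx) (-2) τ
    rw [show (-2 : ℝ) = -(2 : ℕ) by norm_num, Real.rpow_neg (hpos x hx).le,
      Real.rpow_natCast] at this
    rw [← this]; congr 2; push_cast; ring
  have key := intervalIntegral.integral_mul_deriv_eq_deriv_mul (a := a) (b := b)
    (v := fun s : ℝ => Complex.exp (Complex.I * l * s) / (Complex.I * l))
    (v' := fun s : ℝ => Complex.exp (Complex.I * l * s))
    (u := fun s : ℝ => (s : ℂ) ^ (-1 + τ * Complex.I))
    (u' := fun s : ℝ => (-1 + τ * Complex.I) * (s : ℂ) ^ (-1 + τ * Complex.I - 1))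
    (fun x hx => hasDerivAt_ofReal_cpow (hpos x (hI ▸ hx)) _)
    (fun x _ => by
      have := (hasDerivAt_cexp_I_mul l x).div_const (Complex.I * l)
      rwa [mul_div_cancel_left₀ _ hl'] at this)
    (ContinuousOn.intervalIntegrable (by
      rw [hI]; exact continuousOn_const.mul (continuousOn_ofReal_cpow ha _)))
    ((by fun_prop : Continuous _).intervalIntegrable _ _)
  rw [key]
  have hnv : ∀ x : ℝ, ‖Complex.exp (Complex.I * l * x) / (Complex.I * l)‖ = |l|⁻¹ := fun x => by
    rw [norm_div, norm_cexp_I_mul]; simp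
  have hτ : ‖(-1 + τ * Complex.I : ℂ)‖ ≤ 1 + |τ| := by
    refine (norm_add_le _ _).trans ?_
    simp
  have h3 : ‖∫ s in a..b, (-1 + τ * Complex.I) * (s : ℂ) ^ (-1 + τ * Complex.I - 1) *
      (Complex.exp (Complex.I * l * s) / (Complex.I * l))‖ ≤ (1 + |τ|) * |l|⁻¹ * (a⁻¹ - b⁻¹) := by
    have := norm_integral_le_sub_of_hasDerivAt (g := fun x => (1 + |τ|) * |l|⁻¹ * (-x⁻¹))
      (g' := fun x => (1 + |τ|) * |l|⁻¹ * (x ^ 2)⁻¹) hab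
      (f := fun s : ℝ => (-1 + τ * Complex.I) * (s : ℂ) ^ (-1 + τ * Complex.I - 1) *
      (Complex.exp (Complex.I * l * s) / (Complex.I * l)))
      (fun x hx => by
        have := ((hasDerivAt_inv (hpos x hx).ne').neg).const_mul ((1 + |τ|) * |l|⁻¹)
        simpa using this)
      (continuousOn_const.mul ((by fun_prop : Continuous fun x : ℝ => x ^ 2).continuousOn.inv₀
        fun x hx => pow_ne_zero _ (hpos x hx).ne'))
      (fun x hx => by
        rw [norm_mul, norm_mul, hnv, hnu' x hx]
        have : 0 ≤ (x ^ 2)⁻¹ := by positivity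
        calc _ = ‖(-1 + τ * Complex.I : ℂ)‖ * (|l|⁻¹ * (x ^ 2)⁻¹) := by ring
          _ ≤ (1 + |τ|) * (|l|⁻¹ * (x ^ 2)⁻¹) := by gcongr
          _ = _ := by ring)
    refine this.trans (le_of_eq ?_); ring
  have hb := hpos b ⟨hab, le_rfl⟩
  have hb' : b⁻¹ ≤ a⁻¹ := by gcongr
  calc _ ≤ b⁻¹ * |l|⁻¹ + a⁻¹ * |l|⁻¹ + (1 + |τ|) * |l|⁻¹ * (a⁻¹ - b⁻¹) := by
        refine (norm_sub_le _ _).trans (add_le_add ((norm_sub_le _ _).trans ?_) h3)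
        rw [norm_mul, norm_mul, hnv, hnv, hnu a ⟨le_rfl, hab⟩, hnu b ⟨hab, le_rfl⟩]
    _ ≤ a⁻¹ * |l|⁻¹ + a⁻¹ * |l|⁻¹ + (1 + |τ|) * |l|⁻¹ * a⁻¹ := by
        have : 0 ≤ b⁻¹ := by positivity
        gcongr
        linarith
    _ = (3 + |τ|) / (|l| * a) := by field_simp; ring

/-- The two integrations by parts meet at s = 1/|l|, which makes the bound uniform in l. The factor
τ cannot be dropped: at l = 0 the integral is (R^(iτ) - 1)/(iτ), which is unbounded in R as τ → 0.
-/
theorem norm_mul_integral_cpow_mul_cexp_le (τ l : ℝ) {R : ℝ} (hR : 1 ≤ R) :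
    ‖(τ : ℂ) * ∫ s in (1 : ℝ)..R, (s : ℂ) ^ (-1 + τ * Complex.I) * Complex.exp (Complex.I * l * s)‖
      ≤ 3 + |τ| * (3 + |τ|) := by
  have hτ : 0 ≤ |τ| * (3 + |τ|) := by positivity
  rcases eq_or_ne l 0 with rfl | hl
  · refine (norm_mul_integral_cpow_mul_cexp_le_of_small one_pos hR τ 0).trans ?_
    simp; linarith
  have hl0 : 0 < |l| := abs_pos.2 hl
  have hT : |l| * |l|⁻¹ = 1 := mul_inv_cancel₀ hl0.ne'
  have large : ∀ a, 0 < a → a ≤ R → 1 ≤ |l| * a →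
      ‖(τ : ℂ) * ∫ s in a..R, (s : ℂ) ^ (-1 + τ * Complex.I) * Complex.exp (Complex.I * l * s)‖
        ≤ |τ| * (3 + |τ|) := by
    intro a ha haR hla
    rw [norm_mul, Complex.norm_real, Real.norm_eq_abs]
    gcongr
    refine (norm_integral_cpow_mul_cexp_le_of_large ha haR τ l hl).trans ?_
    exact div_le_self (by positivity) hla
  rcases le_total R |l|⁻¹ with h | h
  · refine (norm_mul_integral_cpow_mul_cexp_le_of_small one_pos hR τ l).trans ?_
    have : |l| * R ≤ 1 := by rw [← hT]; gcongr
    nlinarith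
  rcases le_total |l|⁻¹ 1 with h1 | h1
  · have := large 1 one_pos hR (by rw [mul_one, ← hT]; nlinarith)
    linarith
  · have hc : ∀ a b : ℝ, 0 < a → 0 < b → IntervalIntegrable (fun s : ℝ => (s : ℂ) ^ (-1 + τ * Complex.I) *
        Complex.exp (Complex.I * l * s)) volume a b := fun a b ha hb =>
      ContinuousOn.intervalIntegrable
        ((continuousOn_ofReal_cpow (lt_min ha hb) _).mul (by fun_prop))
    rw [← intervalIntegral.integral_add_adjacent_intervals (hc 1 |l|⁻¹ one_pos (by positivity))
      (hc |l|⁻¹ R (by positivity) (by positivity)), mul_add]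
    refine (norm_add_le _ _).trans (add_le_add ?_ (large _ (by positivity) h hT.ge))
    refine (norm_mul_integral_cpow_mul_cexp_le_of_small one_pos h1 τ l).trans ?_
    rw [mul_sub, hT]; linarith
-- Stationary phase for the Schrödinger kernel
/-- The derivative of the phase `u² + c⁴/u²` controls the distance to the critical point. -/
theorem two_mul_abs_sub_le_abs_phase_deriv {c u : ℝ} (hc : 0 ≤ c) (hu : 0 < u) :
    2 * |u - c| ≤ |2 * u - 2 * c ^ 4 / u ^ 3| := by
  have e : 2 * u - 2 * c ^ 4 / u ^ 3 = (2 * (u - c)) * ((u + c) * (u ^ 2 + c ^ 2) / u ^ 3) := by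
    field_simp; ring
  rw [e, abs_mul, abs_mul, abs_two]
  refine le_mul_of_one_le_right (by positivity) ?_
  rw [abs_of_nonneg (by positivity), le_div_iff₀ (by positivity)]
  nlinarith [mul_nonneg hc (sq_nonneg u), mul_nonneg hu.le (sq_nonneg c), mul_nonneg hc (sq_nonneg c)]

/-- Non-stationary phase: at distance at least 1 from the critical point c the phase derivative D
satisfies |D| ≥ 2|u - c| ≥ 2, so one integration by parts against e^(iφ) D suffices. The bound does
not see c. -/
theorem norm_integral_phase_le_of_far {a b c : ℝ} (hc : 0 ≤ c) (ha : 1 ≤ a) (hab : a ≤ b)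
    (hfar : b ≤ c - 1 ∨ c + 1 ≤ a) (τ : ℝ) :
    ‖∫ u in a..b, (u : ℂ) ^ (τ * Complex.I) *
      Complex.exp (Complex.I * ((u ^ 2 + c ^ 4 / u ^ 2 : ℝ) : ℂ))‖ ≤ 2 + |τ| := by
  have hpos : ∀ x ∈ Set.Icc a b, 0 < x := fun x hx => by linarith [hx.1]
  have hI := Set.uIcc_of_le hab
  have hdist : ∀ x ∈ Set.Icc a b, 1 ≤ |x - c| := fun x hx => by
    rcases hfar with h | h
    · rw [abs_of_nonpos] <;> linarith [hx.2]
    · rw [abs_of_nonneg] <;> linarith [hx.1]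
  set D : ℝ → ℝ := fun u => 2 * u - 2 * c ^ 4 / u ^ 3 with hD
  set D' : ℝ → ℝ := fun u => 2 + 6 * c ^ 4 / u ^ 4 with hD'
  have hDlow : ∀ x ∈ Set.Icc a b, 2 * |x - c| ≤ |D x| := fun x hx =>
    two_mul_abs_sub_le_abs_phase_deriv hc (hpos x hx)
  have hD2 : ∀ x ∈ Set.Icc a b, 2 ≤ |D x| := fun x hx => by
    linarith [hDlow x hx, hdist x hx]
  have hD0 : ∀ x ∈ Set.Icc a b, D x ≠ 0 := fun x hx h => by
    have := hD2 x hx; rw [h] at this; norm_num at this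
  have hφ : ∀ x ∈ Set.Icc a b, HasDerivAt (fun u : ℝ => u ^ 2 + c ^ 4 / u ^ 2) (D x) x := by
    intro x hx
    have hx0 := (hpos x hx).ne'
    have h := (hasDerivAt_pow 2 x).add ((hasDerivAt_const x (c ^ 4)).div (hasDerivAt_pow 2 x)
      (pow_ne_zero 2 hx0))
    refine h.congr_deriv ?_
    simp only [hD]; field_simp; push_cast; ring
  have hDd : ∀ x ∈ Set.Icc a b, HasDerivAt D (D' x) x := by
    intro x hx
    have hx0 := (hpos x hx).ne'
    have h := ((hasDerivAt_id x).const_mul 2).sub ((hasDerivAt_const x (2 * c ^ 4)).div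
      (hasDerivAt_pow 3 x) (pow_ne_zero 3 hx0))
    refine h.congr_deriv ?_
    simp only [hD']; field_simp; push_cast; ring
  have hDc : ContinuousOn D (Set.Icc a b) := fun x hx => (hDd x hx).continuousAt.continuousWithinAt
  have hD'c : ContinuousOn D' (Set.Icc a b) := continuousOn_const.add
    (continuousOn_const.div (by fun_prop) fun x hx => pow_ne_zero _ (hpos x hx).ne')
  have hD'0 : ∀ x ∈ Set.Icc a b, 0 ≤ D' x := fun x hx => by
    have := hpos x hx; simp only [hD']; positivity
  have hφc : ContinuousOn (fun u : ℝ => u ^ 2 + c ^ 4 / u ^ 2) (Set.Icc a b) :=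
    fun x hx => (hφ x hx).continuousAt.continuousWithinAt
  have hDc' : ContinuousOn (fun x => (D x : ℂ)) (Set.Icc a b) :=
    Complex.continuous_ofReal.comp_continuousOn hDc
  have hD'c' : ContinuousOn (fun x => (D' x : ℂ)) (Set.Icc a b) :=
    Complex.continuous_ofReal.comp_continuousOn hD'c
  have hexpc : ContinuousOn (fun u : ℝ => Complex.exp (Complex.I * ((u ^ 2 + c ^ 4 / u ^ 2 : ℝ) : ℂ)))
      (Set.Icc a b) :=
    (continuousOn_const.mul (Complex.continuous_ofReal.comp_continuousOn hφc)).cexp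
  have hD0' : ∀ x ∈ Set.Icc a b, (Complex.I * D x : ℂ) ≠ 0 := fun x hx =>
    mul_ne_zero Complex.I_ne_zero (by exact_mod_cast hD0 x hx)
  set U' : ℝ → ℂ := fun u => ((τ * Complex.I) * (u : ℂ) ^ (τ * Complex.I - 1) * (Complex.I * D u) -
      (u : ℂ) ^ (τ * Complex.I) * (Complex.I * D' u)) / (Complex.I * D u) ^ 2 with hU'
  have key := intervalIntegral.integral_mul_deriv_eq_deriv_mul (a := a) (b := b)
    (u := fun u : ℝ => (u : ℂ) ^ (τ * Complex.I) / (Complex.I * D u))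
    (u' := U')
    (v := fun u : ℝ => Complex.exp (Complex.I * ((u ^ 2 + c ^ 4 / u ^ 2 : ℝ) : ℂ)))
    (v' := fun u : ℝ => Complex.exp (Complex.I * ((u ^ 2 + c ^ 4 / u ^ 2 : ℝ) : ℂ)) *
      (Complex.I * D u))
    (fun x hx => by
      rw [hI] at hx
      exact (hasDerivAt_ofReal_cpow (hpos x hx) _).div (((hDd x hx).ofReal_comp).const_mul Complex.I)
        (hD0' x hx))
    (fun x hx => by
      rw [hI] at hx
      exact (((hφ x hx).ofReal_comp).const_mul Complex.I).cexp)
    (ContinuousOn.intervalIntegrable (by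
      rw [hI]
      have hpa : 0 < a := by linarith
      exact (((continuousOn_const.mul (continuousOn_ofReal_cpow hpa _)).mul
        (continuousOn_const.mul hDc')).sub ((continuousOn_ofReal_cpow hpa _).mul
        (continuousOn_const.mul hD'c'))).div ((continuousOn_const.mul hDc').pow 2)
        fun x hx => pow_ne_zero 2 (hD0' x hx)))
    (ContinuousOn.intervalIntegrable (by
      rw [hI]; exact hexpc.mul (continuousOn_const.mul hDc')))
  have e : ∫ u in a..b, (u : ℂ) ^ (τ * Complex.I) *
      Complex.exp (Complex.I * ((u ^ 2 + c ^ 4 / u ^ 2 : ℝ) : ℂ)) =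
      ∫ u in a..b, (u : ℂ) ^ (τ * Complex.I) / (Complex.I * D u) *
      (Complex.exp (Complex.I * ((u ^ 2 + c ^ 4 / u ^ 2 : ℝ) : ℂ)) * (Complex.I * D u)) := by
    refine intervalIntegral.integral_congr fun x hx => ?_
    rw [hI] at hx
    have hDx : (D x : ℂ) ≠ 0 := by exact_mod_cast hD0 x hx
    field_simp
  rw [e, key]
  have hnv : ∀ x ∈ Set.Icc a b, ‖(x : ℂ) ^ (τ * Complex.I)‖ = 1 := fun x hx => by
    simpa using norm_ofReal_cpow_mul_I (hpos x hx) 0 τ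
  have hnv' : ∀ x ∈ Set.Icc a b, ‖(x : ℂ) ^ (τ * Complex.I - 1)‖ = x⁻¹ := fun x hx => by
    have := norm_ofReal_cpow_mul_I (hpos x hx) (-1) τ
    rw [Real.rpow_neg_one] at this
    rw [← this]; congr 2; push_cast; ring
  have hne : ∀ x : ℝ, ‖Complex.exp (Complex.I * (x : ℂ))‖ = 1 := fun x => by
    rw [Complex.norm_exp]; simp
  have hca : ∀ x ∈ Set.Icc a b, x - c ≠ 0 := fun x hx h => by
    have := hdist x hx; rw [h] at this; norm_num at this
  -- The derivative of the amplitude u^(iτ)/D has two parts. Since D' ≥ 0, the term D'/D² has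
  -- primitive -1/D. The other term, |τ|/(u|D|), is at most |τ|/(2u|u - c|), which AM–GM splits into
  -- u⁻² and (u - c)⁻² with explicit primitives.
  have h3 := norm_integral_le_sub_of_hasDerivAt hab
    (g := fun x => |τ| / 4 * (-x⁻¹ + -(x - c)⁻¹) + -(D x)⁻¹)
    (g' := fun x => |τ| / 4 * ((x ^ 2)⁻¹ + ((x - c) ^ 2)⁻¹) + D' x / D x ^ 2)
    (f := fun u : ℝ => U' u * Complex.exp (Complex.I * ((u ^ 2 + c ^ 4 / u ^ 2 : ℝ) : ℂ)))
    (fun x hx => by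
      have h1 := (hasDerivAt_inv (hpos x hx).ne').neg
      have h2 := ((((hasDerivAt_id x).sub_const c).inv (hca x hx))).neg
      have h3 := ((hDd x hx).inv (hD0 x hx)).neg
      have := ((h1.add h2).const_mul (|τ| / 4)).add h3
      refine this.congr_deriv ?_
      simp [neg_div])
    ((continuousOn_const.mul (((by fun_prop : Continuous fun x : ℝ => x ^ 2).continuousOn.inv₀
        fun x hx => pow_ne_zero _ (hpos x hx).ne').add
        ((by fun_prop : Continuous fun x : ℝ => (x - c) ^ 2).continuousOn.inv₀
        fun x hx => pow_ne_zero _ (hca x hx)))).add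
        (hD'c.div (hDc.pow 2) fun x hx => pow_ne_zero 2 (hD0 x hx)))
    (fun x hx => by
      rw [norm_mul, hne, mul_one]
      have hx0 := hpos x hx
      have hDp : 0 < |D x| := by linarith [hD2 x hx]
      have hdp : 0 < |x - c| := by linarith [hdist x hx]
      simp only [hU']
      have e1 : ‖((τ * Complex.I) * (x : ℂ) ^ (τ * Complex.I - 1) * (Complex.I * D x) -
          (x : ℂ) ^ (τ * Complex.I) * (Complex.I * D' x)) / (Complex.I * D x) ^ 2‖
          ≤ (|τ| * x⁻¹ * |D x| + D' x) / D x ^ 2 := by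
        rw [norm_div, norm_pow, norm_mul Complex.I, Complex.norm_I, one_mul, Complex.norm_real,
          Real.norm_eq_abs, sq_abs]
        gcongr
        refine (norm_sub_le _ _).trans (le_of_eq ?_)
        simp only [norm_mul, hnv x hx, hnv' x hx, Complex.norm_I, Complex.norm_real,
          Real.norm_eq_abs, abs_of_nonneg (hD'0 x hx)]
        ring
      refine e1.trans ?_
      rw [add_div]
      gcongr
      have e2 : |τ| * x⁻¹ * |D x| / D x ^ 2 = |τ| * (x⁻¹ * |D x|⁻¹) := by
        rw [← sq_abs (D x)]; field_simp
      rw [e2, div_mul_eq_mul_div, mul_div_assoc]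
      gcongr
      have e3 : |D x|⁻¹ ≤ |x - c|⁻¹ / 2 := by
        rw [div_eq_mul_inv, ← mul_inv, mul_comm]
        exact inv_anti₀ (by positivity) (hDlow x hx)
      calc x⁻¹ * |D x|⁻¹ ≤ x⁻¹ * (|x - c|⁻¹ / 2) := by gcongr
        _ ≤ ((x ^ 2)⁻¹ + ((x - c) ^ 2)⁻¹) / 4 := by
          rw [← sq_abs (x - c), ← inv_pow, ← inv_pow]
          nlinarith [sq_nonneg (x⁻¹ - |x - c|⁻¹)])
  have haI : a ∈ Set.Icc a b := ⟨le_rfl, hab⟩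
  have hbI : b ∈ Set.Icc a b := ⟨hab, le_rfl⟩
  have hinv : ∀ x ∈ Set.Icc a b, |(D x)⁻¹| ≤ 1 / 2 := fun x hx => by
    rw [abs_inv, one_div]; exact inv_anti₀ two_pos (hD2 x hx)
  have hinv' : ∀ x ∈ Set.Icc a b, |(x - c)⁻¹| ≤ 1 := fun x hx => by
    rw [abs_inv]; exact inv_le_one_of_one_le₀ (hdist x hx)
  have hbd : ∀ x ∈ Set.Icc a b, ‖(x : ℂ) ^ (τ * Complex.I) / (Complex.I * D x) *
      Complex.exp (Complex.I * ((x ^ 2 + c ^ 4 / x ^ 2 : ℝ) : ℂ))‖ ≤ 1 / 2 := fun x hx => by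
    rw [norm_mul, hne, norm_div, hnv x hx, norm_mul, Complex.norm_I, Complex.norm_real,
      Real.norm_eq_abs, one_mul, mul_one, one_div, ← abs_inv]
    exact hinv x hx
  refine (norm_sub_le _ _).trans ((add_le_add ((norm_sub_le _ _).trans
    (add_le_add (hbd b hbI) (hbd a haI))) h3).trans ?_)
  have i1 := abs_le.1 (hinv a haI)
  have i2 := abs_le.1 (hinv b hbI)
  have i3 := abs_le.1 (hinv' a haI)
  have i4 := abs_le.1 (hinv' b hbI)
  have i5 : a⁻¹ ≤ 1 := inv_le_one_of_one_le₀ ha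
  have i6 : 0 ≤ b⁻¹ := inv_nonneg.2 (hpos b hbI).le
  have : |τ| / 4 * (-b⁻¹ + -(b - c)⁻¹) - |τ| / 4 * (-a⁻¹ + -(a - c)⁻¹) ≤ |τ| := by
    rw [← mul_sub]
    have : |τ| / 4 * (-b⁻¹ + -(b - c)⁻¹ - (-a⁻¹ + -(a - c)⁻¹)) ≤ |τ| / 4 * 4 := by
      gcongr; linarith
    linarith
  linarith

/-- Van der Corput: the window [c - 1, c + 1] costs at most its length 2, and each of the two outer
pieces is non-stationary and costs 2 + |τ|. -/
theorem norm_integral_phase_le {c R : ℝ} (hc : 0 ≤ c) (hR : 1 ≤ R) (τ : ℝ) :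
    ‖∫ u in (1 : ℝ)..R, (u : ℂ) ^ (τ * Complex.I) *
      Complex.exp (Complex.I * ((u ^ 2 + c ^ 4 / u ^ 2 : ℝ) : ℂ))‖ ≤ 6 + 2 * |τ| := by
  -- A and B are c - 1 and c + 1 clamped to [1, R]; an outer piece that lies outside the range
  -- collapses to an empty interval.
  set A := max 1 (min R (c - 1)) with hA
  set B := max 1 (min R (c + 1)) with hB
  have h1A : 1 ≤ A := le_max_left _ _
  have hAB : A ≤ B := max_le_max le_rfl (min_le_min le_rfl (by linarith))
  have hBR : B ≤ R := max_le hR (min_le_left _ _)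
  have hBA : B - A ≤ 2 := by
    simp only [hA, hB, max_def, min_def]; split_ifs <;> linarith
  have h_integ : ∀ a b : ℝ, 0 < a → 0 < b → IntervalIntegrable (fun u : ℝ => (u : ℂ) ^ (τ * Complex.I) *
      Complex.exp (Complex.I * ((u ^ 2 + c ^ 4 / u ^ 2 : ℝ) : ℂ))) volume a b := fun a b ha hb =>
    ContinuousOn.intervalIntegrable ((continuousOn_ofReal_cpow (lt_min ha hb) _).mul
      (continuousOn_const.mul (Complex.continuous_ofReal.comp_continuousOn
        ((by fun_prop : Continuous fun x : ℝ => x ^ 2).continuousOn.add (continuousOn_const.div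
          (by fun_prop) fun x hx => pow_ne_zero _ ((lt_min ha hb).trans_le hx.1).ne')))).cexp)
  rw [← intervalIntegral.integral_add_adjacent_intervals (h_integ 1 B one_pos (by linarith))
      (h_integ B R (by linarith) (by linarith)),
    ← intervalIntegral.integral_add_adjacent_intervals (h_integ 1 A one_pos (by linarith))
      (h_integ A B (by linarith) (by linarith))]
  have n1 : ‖∫ u in (1 : ℝ)..A, (u : ℂ) ^ (τ * Complex.I) *
      Complex.exp (Complex.I * ((u ^ 2 + c ^ 4 / u ^ 2 : ℝ) : ℂ))‖ ≤ 2 + |τ| := by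
    rcases h1A.eq_or_lt with h | h
    · rw [← h]; simp; positivity
    · refine norm_integral_phase_le_of_far hc le_rfl h1A (Or.inl ?_) τ
      rcases max_cases 1 (min R (c - 1)) with h' | h'
      · exact absurd h'.1 (by rw [← hA]; exact h.ne')
      · rw [hA, h'.1]; exact min_le_right _ _
  have n3 : ‖∫ u in B..R, (u : ℂ) ^ (τ * Complex.I) *
      Complex.exp (Complex.I * ((u ^ 2 + c ^ 4 / u ^ 2 : ℝ) : ℂ))‖ ≤ 2 + |τ| := by
    rcases hBR.eq_or_lt with h | h
    · rw [h]; simp; positivity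
    · refine norm_integral_phase_le_of_far hc (h1A.trans hAB) hBR (Or.inr ?_) τ
      rcases le_total R (c + 1) with h' | h'
      · have : B = R := by rw [hB, min_eq_left h', max_eq_right hR]
        exact absurd this h.ne
      · rw [hB, min_eq_right h']; exact le_max_right _ _
  have n2 : ‖∫ u in A..B, (u : ℂ) ^ (τ * Complex.I) *
      Complex.exp (Complex.I * ((u ^ 2 + c ^ 4 / u ^ 2 : ℝ) : ℂ))‖ ≤ 2 := by
    have := intervalIntegral.norm_integral_le_of_norm_le_const (a := A) (b := B) (C := 1)
      (f := fun u : ℝ => (u : ℂ) ^ (τ * Complex.I) *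
      Complex.exp (Complex.I * ((u ^ 2 + c ^ 4 / u ^ 2 : ℝ) : ℂ))) (fun x hx => by
        rw [Set.uIoc_of_le hAB] at hx
        have hx0 : 0 < x := by linarith [hx.1]
        have := norm_ofReal_cpow_mul_I hx0 0 τ
        simp only [Complex.ofReal_zero, zero_add, Real.rpow_zero] at this
        rw [norm_mul, this, Complex.norm_exp_I_mul_ofReal, one_mul])
    rw [abs_of_nonneg (by linarith)] at this
    linarith
  refine (norm_add_le _ _).trans ((add_le_add ((norm_add_le _ _).trans (add_le_add n1 n2)) n3).trans ?_)
  linarith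

/-- The substitution s = u² absorbs s^(-1/2) into the measure and turns the phase into u² + ρ²/u²,
whose second derivative is at least 2 for every ρ; its critical point is c = √ρ. The exponent τ
becomes 2τ and ds brings a factor 2, whence 2(6 + 4|τ|). -/
theorem norm_integral_cpow_mul_cexp_phase_le (τ : ℝ) {ρ R : ℝ} (hρ : 0 ≤ ρ) (hR : 1 ≤ R) :
    ‖∫ s in (1 : ℝ)..R, (s : ℂ) ^ (((-1 / 2 : ℝ) : ℂ) + τ * Complex.I) *
      Complex.exp (Complex.I * ((s + ρ ^ 2 / s : ℝ) : ℂ))‖ ≤ 12 + 8 * |τ| := by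
  have hsR : 1 ≤ √R := Real.one_le_sqrt.2 hR
  have hpos : ∀ x ∈ Set.uIcc 1 (√R), 0 < x := fun x hx => by
    rw [Set.uIcc_of_le hsR] at hx; linarith [hx.1]
  have key := intervalIntegral.integral_deriv_smul_comp'' (a := 1) (b := √R)
    (f := fun u : ℝ => u ^ 2) (f' := fun u : ℝ => 2 * u)
    (g := fun s : ℝ => (s : ℂ) ^ (((-1 / 2 : ℝ) : ℂ) + τ * Complex.I) *
      Complex.exp (Complex.I * ((s + ρ ^ 2 / s : ℝ) : ℂ)))
    (by fun_prop) (fun x _ => by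
      have := (hasDerivAt_pow 2 x).hasDerivWithinAt (s := Set.Ioi x)
      simpa using this) (by fun_prop)
    (by
      have himg : ∀ s ∈ (fun u : ℝ => u ^ 2) '' Set.uIcc 1 √R, 0 < s := by
        rintro _ ⟨x, hx, rfl⟩; have := hpos x hx; positivity
      refine ContinuousOn.mul (fun s hs =>
        (hasDerivAt_ofReal_cpow (himg s hs) _).continuousAt.continuousWithinAt) ?_
      exact (continuousOn_const.mul (Complex.continuous_ofReal.comp_continuousOn
        (continuousOn_id.add (continuousOn_const.div continuousOn_id fun x hx => (himg x hx).ne')))).cexp)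
  simp only [one_pow, Real.sq_sqrt (zero_le_one.trans hR)] at key
  rw [← key]
  have e : ∫ x in (1 : ℝ)..√R, (2 * x) • ((fun s : ℝ => (s : ℂ) ^ (((-1 / 2 : ℝ) : ℂ) + τ * Complex.I) *
      Complex.exp (Complex.I * ((s + ρ ^ 2 / s : ℝ) : ℂ))) ∘ fun u : ℝ => u ^ 2) x
      = 2 * ∫ u in (1 : ℝ)..√R, (u : ℂ) ^ (((2 * τ : ℝ) : ℂ) * Complex.I) *
      Complex.exp (Complex.I * ((u ^ 2 + (√ρ) ^ 4 / u ^ 2 : ℝ) : ℂ)) := by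
    rw [← intervalIntegral.integral_const_mul]
    refine intervalIntegral.integral_congr fun x hx => ?_
    have hx0 := hpos x hx
    have hx0' : (x : ℂ) ≠ 0 := by exact_mod_cast hx0.ne'
    have hρ4 : (√ρ) ^ 4 = ρ ^ 2 := by
      rw [show 4 = 2 * 2 by norm_num, pow_mul, Real.sq_sqrt hρ]
    have hp : ((x ^ 2 : ℝ) : ℂ) ^ (((-1 / 2 : ℝ) : ℂ) + τ * Complex.I)
        = (x : ℂ)⁻¹ * (x : ℂ) ^ (((2 * τ : ℝ) : ℂ) * Complex.I) := by
      rw [← Complex.cpow_neg_one, ← Complex.cpow_add _ _ hx0', sq, Complex.ofReal_mul,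
        Complex.mul_cpow_ofReal_nonneg hx0.le hx0.le, ← Complex.cpow_add _ _ hx0']
      congr 1; push_cast; ring
    simp only [Function.comp, hρ4, hp, Complex.real_smul]
    push_cast
    field_simp
  rw [e, norm_mul]
  have := norm_integral_phase_le (Real.sqrt_nonneg ρ) hsR (2 * τ)
  rw [abs_mul, abs_two] at this
  simp only [Complex.norm_ofNat]
  linarith

/-! ### Plancherel and Gaussian multipliers -/

section FourierL2

variable {V : Type*} [NormedAddCommGroup V] [InnerProductSpace ℝ V] [FiniteDimensional ℝ V]
  [MeasurableSpace V] [BorelSpace V]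

theorem continuous_fourier_of_integrable {f : V → ℂ} (hf : Integrable f) : Continuous (𝓕 f) :=
  VectorFourier.fourierIntegral_continuous Real.continuous_fourierChar
    (by exact continuous_inner) hf

theorem norm_fourier_le_integral_norm (f : V → ℂ) (v : V) : ‖𝓕 f v‖ ≤ ∫ x, ‖f x‖ :=
  VectorFourier.norm_fourierIntegral_le_integral_norm _ _ _ _ _

theorem integral_fourier_mul_eq_of_integrable {f g : V → ℂ} (hf : Integrable f)
    (hg : Integrable g) : ∫ v, 𝓕 f v * g v = ∫ x, f x * 𝓕 g x := by
  simpa using! VectorFourier.integral_bilin_fourierIntegral_eq_flip (ContinuousLinearMap.mul ℂ ℂ)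
    (L := innerₗ V) Real.continuous_fourierChar continuous_inner hf hg

/-- The pointwise Fourier integral represents the `L²` Fourier transform. -/
theorem fourier_ae_eq_fourier_toLp {f : V → ℂ} (h1 : Integrable f) (h2 : MemLp f 2) :
    𝓕 f =ᵐ[volume] (𝓕 (h2.toLp f) : Lp ℂ 2 (volume : Measure V)) := by
  refine ae_eq_of_integral_contDiff_smul_eq
    (continuous_fourier_of_integrable h1).locallyIntegrable
    ((Lp.memLp _).locallyIntegrable (by norm_num)) fun g hg hgc => ?_
  have hgc' : HasCompactSupport (fun x => (g x : ℂ)) := hgc.comp_left (g := fun x : ℝ => (x : ℂ)) rfl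
  have hgs : ContDiff ℝ (⊤ : ℕ∞) (fun x => (g x : ℂ)) := Complex.ofRealCLM.contDiff.comp hg
  set φ : SchwartzMap V ℂ := hgc'.toSchwartzMap hgs
  have hφ : ∀ x, φ x = (g x : ℂ) := fun x => rfl
  have e1 := congrArg (fun T => T φ) (Lp.fourier_toTemperedDistribution_eq (h2.toLp f))
  simp only [TemperedDistribution.fourier_apply, Lp.toTemperedDistribution_apply, hφ,
    smul_eq_mul] at e1
  have e2 := integral_fourier_mul_eq_of_integrable h1 φ.integrable
  simp only [Complex.real_smul]
  rw [← e1]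
  calc ∫ x, (g x : ℂ) * 𝓕 f x = ∫ v, 𝓕 f v * φ v := by simp [hφ, mul_comm]
    _ = ∫ x, f x * 𝓕 (φ : V → ℂ) x := e2
    _ = _ := by
      refine integral_congr_ae ?_
      filter_upwards [h2.coeFn_toLp] with x hx
      rw [hx, mul_comm]; rfl

theorem memLp_fourier {f : V → ℂ} (h1 : Integrable f) (h2 : MemLp f 2) : MemLp (𝓕 f) 2 :=
  (memLp_congr_ae (fourier_ae_eq_fourier_toLp h1 h2)).2 (Lp.memLp _)

theorem eLpNorm_fourier {f : V → ℂ} (h1 : Integrable f) (h2 : MemLp f 2) :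
    eLpNorm (𝓕 f) 2 volume = eLpNorm f 2 volume := by
  rw [eLpNorm_congr_ae (fourier_ae_eq_fourier_toLp h1 h2), ← Lp.enorm_def]
  rw [← ofReal_norm, Lp.norm_fourier_eq, ofReal_norm, Lp.enorm_def]
  exact eLpNorm_congr_ae h2.coeFn_toLp

theorem integral_norm_sq_fourier_of_integrable {f : V → ℂ} (h1 : Integrable f) (h2 : MemLp f 2) :
    ∫ v, ‖𝓕 f v‖ ^ 2 = ∫ x, ‖f x‖ ^ 2 := by
  have hh := eLpNorm_fourier h1 h2
  rw [(memLp_fourier h1 h2).eLpNorm_eq_integral_rpow_norm (by norm_num) (by norm_num),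
    h2.eLpNorm_eq_integral_rpow_norm (by norm_num) (by norm_num)] at hh
  have h3 := congrArg ENNReal.toReal hh
  have p1 : 0 ≤ ∫ v, ‖𝓕 f v‖ ^ (2 : ℝ) := integral_nonneg fun _ => by positivity
  have p2 : 0 ≤ ∫ x, ‖f x‖ ^ (2 : ℝ) := integral_nonneg fun _ => by positivity
  simp only [ENNReal.toReal_ofNat] at h3
  rw [ENNReal.toReal_ofReal (by positivity), ENNReal.toReal_ofReal (by positivity)] at h3
  have := (Real.rpow_left_injOn (x := (2 : ℝ)⁻¹) (by norm_num)) p1 p2 h3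
  simpa using this

/-- A Gaussian multiplier acts as convolution with a Gaussian. Complex b is the point: letting b
approach the imaginary axis from Re b > 0 gives the Schrödinger kernel. -/
theorem integral_fourier_mul_conj_gaussian {f g : V → ℂ} (hf : Integrable f) (hg : Integrable g)
    {b : ℂ} (hb : 0 < b.re) :
    ∫ v, 𝓕 f v * (starRingEnd ℂ) (𝓕 g v) * Complex.exp (-b * ‖v‖ ^ 2) =
      (Real.pi / b) ^ (Module.finrank ℝ V / 2 : ℂ) * ∫ q : V × V, f q.1 * (starRingEnd ℂ) (g q.2) *
        Complex.exp (-Real.pi ^ 2 * ‖q.2 - q.1‖ ^ 2 / b) := by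
  have hγ : Integrable (fun v : V => Complex.exp (-b * ‖v‖ ^ 2)) := by
    simpa using GaussianFourier.integrable_cexp_neg_mul_sq_norm_add hb 0 (0 : V)
  have hm : Integrable (fun v => 𝓕 f v * Complex.exp (-b * ‖v‖ ^ 2)) :=
    hγ.bdd_mul (continuous_fourier_of_integrable hf).aestronglyMeasurable
      (Eventually.of_forall (norm_fourier_le_integral_norm f))
  have s1 := VectorFourier.integral_sesq_fourierIntegral_eq_neg_flip (innerSL ℂ (E := ℂ))
    (L := innerₗ V) Real.continuous_fourierChar continuous_inner hg hm
  have s2 : ∀ x : V, VectorFourier.fourierIntegral Real.fourierChar volume (-(innerₗ V).flip)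
      (fun v => 𝓕 f v * Complex.exp (-b * ‖v‖ ^ 2)) x
      = (Real.pi / b) ^ (Module.finrank ℝ V / 2 : ℂ) *
        ∫ y, f y * Complex.exp (-Real.pi ^ 2 * ‖x - y‖ ^ 2 / b) := by
    intro x
    have hγx : Integrable (fun v : V => Complex.exp (-b * ‖v‖ ^ 2 +
        2 * Real.pi * Complex.I * (inner ℝ x v : ℝ))) :=
      GaussianFourier.integrable_cexp_neg_mul_sq_norm_add hb _ x
    have s3 := integral_fourier_mul_eq_of_integrable hf hγx
    simp only [fourier_gaussian_innerProductSpace' hb] at s3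
    rw [VectorFourier.fourierIntegral, ← integral_const_mul]
    calc _ = ∫ v, 𝓕 f v * Complex.exp (-b * ‖v‖ ^ 2 +
        2 * Real.pi * Complex.I * (inner ℝ x v : ℝ)) := by
          refine integral_congr_ae (Eventually.of_forall fun v => ?_)
          simp only [LinearMap.neg_apply, LinearMap.flip_apply, innerₗ_apply_apply, neg_neg,
            Circle.smul_def, Real.fourierChar_apply, smul_eq_mul, Complex.exp_add]
          push_cast
          ring_nf
      _ = _ := by
          rw [s3]; congr 1; ext y; ring
  have hprod : Integrable (fun q : V × V => f q.1 * (starRingEnd ℂ) (g q.2) *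
        Complex.exp (-Real.pi ^ 2 * ‖q.2 - q.1‖ ^ 2 / b)) (volume.prod volume) := by
    have hg' : Integrable (fun x => (starRingEnd ℂ) (g x)) :=
      (LinearIsometryEquiv.integrable_comp_iff (Complex.conjLIE : ℂ ≃ₗᵢ[ℝ] ℂ)).2 hg
    refine (hf.mul_prod hg').mul_bdd (c := 1) (by fun_prop) (Eventually.of_forall fun q => ?_)
    rw [Complex.norm_exp, Real.exp_le_one_iff]
    have : (-Real.pi ^ 2 * ‖q.2 - q.1‖ ^ 2 / b : ℂ)
        = ((-Real.pi ^ 2 * ‖q.2 - q.1‖ ^ 2 : ℝ) : ℂ) / b := by push_cast; ring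
    rw [this, Complex.div_re]
    simp only [Complex.ofReal_re, Complex.ofReal_im, zero_mul, zero_div, add_zero]
    exact div_nonpos_of_nonpos_of_nonneg (mul_nonpos_of_nonpos_of_nonneg
      (by nlinarith [sq_nonneg (Real.pi), sq_nonneg ‖q.2 - q.1‖, mul_nonneg (sq_nonneg (Real.pi)) (sq_nonneg ‖q.2 - q.1‖)]) hb.le) (Complex.normSq_nonneg b)
  have s4 : ∫ v, 𝓕 f v * (starRingEnd ℂ) (𝓕 g v) * Complex.exp (-b * ‖v‖ ^ 2) =
      ∫ x, (starRingEnd ℂ) (g x) * ((Real.pi / b) ^ (Module.finrank ℝ V / 2 : ℂ) *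
        ∫ y, f y * Complex.exp (-Real.pi ^ 2 * ‖x - y‖ ^ 2 / b)) := by
    calc _ = _ := ?_
      _ = _ := s1
      _ = _ := ?_
    · refine integral_congr_ae (Eventually.of_forall fun v => ?_)
      change _ = inner ℂ (𝓕 g v) (𝓕 f v * Complex.exp (-b * ‖v‖ ^ 2))
      rw [RCLike.inner_apply]; ring
    · refine integral_congr_ae (Eventually.of_forall fun x => ?_)
      simp only [s2]
      rw [innerSL_apply_apply, RCLike.inner_apply]; ring
  rw [s4]
  change _ = _ * ∫ q : V × V, _ ∂(volume.prod volume)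
  rw [integral_prod_symm _ hprod, ← integral_const_mul]
  refine integral_congr_ae (Eventually.of_forall fun x => ?_)
  simp only
  rw [mul_left_comm, ← integral_const_mul]
  congr 2; ext y; ring

end FourierL2

/-! ### The Schrödinger form and its two endpoint estimates -/

section SchrodingerForm

variable {V : Type*} [NormedAddCommGroup V] [InnerProductSpace ℝ V] [FiniteDimensional ℝ V]
  [MeasurableSpace V] [BorelSpace V]

/-- The sesquilinear form `⟨e^{is(1+Δ)} f, g⟩` of the Schrödinger propagator. -/
noncomputable def schrodingerForm (s : ℝ) (f g : V → ℂ) : ℂ :=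
  ∫ v, 𝓕 f v * (starRingEnd ℂ) (𝓕 g v) *
    Complex.exp (Complex.I * (1 - 4 * Real.pi ^ 2 * ‖v‖ ^ 2 : ℝ) * s)

theorem integrable_fourier_mul_conj {f g : V → ℂ} (hf : Integrable f) (hf2 : MemLp f 2)
    (hg : Integrable g) (hg2 : MemLp g 2) :
    Integrable (fun v => 𝓕 f v * (starRingEnd ℂ) (𝓕 g v)) :=
  (memLp_fourier hf hf2).integrable_mul (memLp_fourier hg hg2).star

theorem cpow_inv_mul {s : ℝ} (hs : 0 < s) {z : ℂ} (hz : z ≠ 0) (c : ℂ) :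
    ((s⁻¹ : ℝ) * z) ^ c = (s : ℂ) ^ (-c) * z ^ c := by
  have hs' : (s : ℂ) ≠ 0 := by exact_mod_cast hs.ne'
  have h0 : ((s⁻¹ : ℝ) : ℂ) ≠ 0 := by exact_mod_cast (inv_pos.2 hs).ne'
  rw [Complex.cpow_def_of_ne_zero (mul_ne_zero h0 hz), Complex.cpow_def_of_ne_zero hs',
    Complex.cpow_def_of_ne_zero hz, ← Complex.exp_add, Complex.log_ofReal_mul (inv_pos.2 hs) hz,
    Real.log_inv, ← Complex.ofReal_log hs.le]
  congr 1; push_cast; ring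

/-- The dispersive constant `(4πi)^{-N/2}` of the free Schrödinger kernel. -/
noncomputable def dispersiveConst (N : ℕ) : ℂ :=
  (1 / (4 * Real.pi * Complex.I)) ^ (N / 2 : ℂ)

theorem norm_dispersiveConst_le (N : ℕ) : ‖dispersiveConst N‖ ≤ 1 := by
  have : (N / 2 : ℂ) = ((N / 2 : ℝ) : ℂ) := by push_cast; rfl
  rw [dispersiveConst, this, Complex.norm_cpow_real]
  refine Real.rpow_le_one (norm_nonneg _) ?_ (by positivity)
  rw [norm_div, norm_one, norm_mul, norm_mul, Complex.norm_I, Complex.norm_real, Real.norm_eq_abs,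
    abs_of_pos Real.pi_pos, Complex.norm_ofNat, mul_one]
  rw [div_le_one (by positivity)]
  linarith [Real.pi_gt_three]

/-- The kernel of the free Schrödinger propagator. -/
theorem schrodingerForm_eq_kernel {f g : V → ℂ} (hf : Integrable f) (hf2 : MemLp f 2)
    (hg : Integrable g) (hg2 : MemLp g 2) {s : ℝ} (hs : 0 < s) :
    schrodingerForm s f g = dispersiveConst (Module.finrank ℝ V) *
      (s : ℂ) ^ (-(Module.finrank ℝ V / 2 : ℂ)) * ∫ q : V × V, f q.1 * (starRingEnd ℂ) (g q.2) *
        Complex.exp (Complex.I * ((s + (‖q.2 - q.1‖ / 2) ^ 2 / s : ℝ) : ℂ)) := by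
  have hfg := integrable_fourier_mul_conj hf hf2 hg hg2
  -- Regularisation by η > 0: the Gaussian identity holds for b(η), and both sides converge as η →
  -- 0+ by dominated convergence.
  set b : ℝ → ℂ := fun η => 4 * Real.pi ^ 2 * (η + s * Complex.I) with hb
  have hbre : ∀ η, 0 < η → 0 < (b η).re := fun η hη => by
    have : b η = ((4 * Real.pi ^ 2 : ℝ) : ℂ) * (η + s * Complex.I) := by simp only [hb]; push_cast; ring
    rw [this, Complex.re_ofReal_mul]
    have := Real.pi_pos
    simp; positivity
  have hb0 : b 0 ≠ 0 := by
    simp only [hb, Complex.ofReal_zero, zero_add]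
    exact mul_ne_zero (mul_ne_zero (by norm_num) (pow_ne_zero _ (by exact_mod_cast Real.pi_ne_zero)))
      (mul_ne_zero (by exact_mod_cast hs.ne') Complex.I_ne_zero)
  have hbc : Tendsto b (𝓝[>] 0) (𝓝 (b 0)) := by
    have : Continuous b := by fun_prop
    exact (this.tendsto 0).mono_left nhdsWithin_le_nhds
  have hπb : (Real.pi / b 0 : ℂ) = ((s⁻¹ : ℝ) : ℂ) * (1 / (4 * Real.pi * Complex.I)) := by
    have : (Real.pi : ℂ) ≠ 0 := by exact_mod_cast Real.pi_ne_zero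
    have : (s : ℂ) ≠ 0 := by exact_mod_cast hs.ne'
    simp only [hb]; push_cast; field_simp; ring
  have hne : (1 / (4 * Real.pi * Complex.I) : ℂ) ≠ 0 := by
    have : (Real.pi : ℂ) ≠ 0 := by exact_mod_cast Real.pi_ne_zero
    exact one_div_ne_zero (mul_ne_zero (mul_ne_zero (by norm_num) this) Complex.I_ne_zero)
  -- π/b(0) = 1/(4πis) lies on the negative imaginary axis, away from the branch cut, so the power
  -- N/2 is continuous there.
  have hslit : (Real.pi / b 0 : ℂ) ∈ Complex.slitPlane := by
    rw [hπb]
    refine Or.inr ?_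
    have e : (((s⁻¹ : ℝ) : ℂ) * (1 / (4 * Real.pi * Complex.I)))
        = ((-(s⁻¹ / (4 * Real.pi)) : ℝ) : ℂ) * Complex.I := by
      have : (Real.pi : ℂ) ≠ 0 := by exact_mod_cast Real.pi_ne_zero
      have : (s : ℂ) ≠ 0 := by exact_mod_cast hs.ne'
      push_cast; field_simp; simp
    rw [e]
    have := Real.pi_pos
    simp only [Complex.mul_im, Complex.ofReal_re, Complex.I_im, Complex.ofReal_im, Complex.I_re]
    have : 0 < s⁻¹ / (4 * Real.pi) := by positivity
    intro h; linarith
  have L : Tendsto (fun η => ∫ v, 𝓕 f v * (starRingEnd ℂ) (𝓕 g v) * Complex.exp (-b η * ‖v‖ ^ 2))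
      (𝓝[>] 0) (𝓝 (∫ v, 𝓕 f v * (starRingEnd ℂ) (𝓕 g v) * Complex.exp (-b 0 * ‖v‖ ^ 2))) := by
    refine tendsto_integral_filter_of_dominated_convergence
      (fun v => ‖𝓕 f v * (starRingEnd ℂ) (𝓕 g v)‖) ?_ ?_ hfg.norm ?_
    · exact Eventually.of_forall fun η => hfg.aestronglyMeasurable.mul (by fun_prop)
    · filter_upwards [self_mem_nhdsWithin] with η hη
      refine Eventually.of_forall fun v => ?_
      rw [norm_mul _ (Complex.exp _)]
      refine mul_le_of_le_one_right (norm_nonneg _) ?_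
      rw [Complex.norm_exp, Real.exp_le_one_iff]
      have : (-b η * ‖v‖ ^ 2 : ℂ) = ((-(‖v‖ ^ 2) : ℝ) : ℂ) * b η := by push_cast; ring
      rw [this, Complex.re_ofReal_mul]
      nlinarith [hbre η hη, sq_nonneg ‖v‖]
    · exact Eventually.of_forall fun v =>
        ((hbc.neg.mul_const _).cexp).const_mul _
  have hprod : Integrable (fun q : V × V => f q.1 * (starRingEnd ℂ) (g q.2)) :=
    hf.mul_prod (ν := volume) ((LinearIsometryEquiv.integrable_comp_iff
      (Complex.conjLIE : ℂ ≃ₗᵢ[ℝ] ℂ)).2 hg)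
  have Rr : Tendsto (fun η => (Real.pi / b η) ^ (Module.finrank ℝ V / 2 : ℂ) *
      ∫ q : V × V, f q.1 * (starRingEnd ℂ) (g q.2) *
        Complex.exp (-Real.pi ^ 2 * ‖q.2 - q.1‖ ^ 2 / b η))
      (𝓝[>] 0) (𝓝 ((Real.pi / b 0) ^ (Module.finrank ℝ V / 2 : ℂ) *
      ∫ q : V × V, f q.1 * (starRingEnd ℂ) (g q.2) *
        Complex.exp (-Real.pi ^ 2 * ‖q.2 - q.1‖ ^ 2 / b 0))) := by
    refine Tendsto.mul ?_ ?_
    · exact (continuousAt_cpow_const hslit).tendsto.comp (tendsto_const_nhds.div hbc hb0)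
    · refine tendsto_integral_filter_of_dominated_convergence
        (fun q => ‖f q.1 * (starRingEnd ℂ) (g q.2)‖) ?_ ?_ hprod.norm ?_
      · exact Eventually.of_forall fun η => hprod.aestronglyMeasurable.mul (by fun_prop)
      · filter_upwards [self_mem_nhdsWithin] with η hη
        refine Eventually.of_forall fun q => ?_
        rw [norm_mul _ (Complex.exp _)]
        refine mul_le_of_le_one_right (norm_nonneg _) ?_
        rw [Complex.norm_exp, Real.exp_le_one_iff]
        have : (-Real.pi ^ 2 * ‖q.2 - q.1‖ ^ 2 / b η : ℂ)
            = ((-(Real.pi * ‖q.2 - q.1‖) ^ 2 : ℝ) : ℂ) / b η := by push_cast; ring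
        rw [this, Complex.div_re]
        simp only [Complex.ofReal_re, Complex.ofReal_im, zero_mul, zero_div, add_zero]
        exact div_nonpos_of_nonpos_of_nonneg (mul_nonpos_of_nonpos_of_nonneg
          (neg_nonpos.2 (sq_nonneg _)) (hbre η hη).le) (Complex.normSq_nonneg _)
      · exact Eventually.of_forall fun q =>
          ((tendsto_const_nhds.div hbc hb0).cexp).const_mul _
  have heq := tendsto_nhds_unique (L.congr' (by
    filter_upwards [self_mem_nhdsWithin] with η hη
    exact integral_fourier_mul_conj_gaussian hf hg (hbre η hη))) Rr
  rw [hπb, cpow_inv_mul hs hne, mul_comm ((s : ℂ) ^ _)] at heq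
  have e1 : schrodingerForm s f g = Complex.exp (Complex.I * s) *
      ∫ v, 𝓕 f v * (starRingEnd ℂ) (𝓕 g v) * Complex.exp (-b 0 * ‖v‖ ^ 2) := by
    rw [schrodingerForm, ← integral_const_mul]
    congr 1; ext v
    rw [mul_left_comm, ← Complex.exp_add]
    congr 2; simp only [hb]; push_cast; ring
  rw [e1, heq, mul_left_comm, ← integral_const_mul]
  simp only [dispersiveConst]
  congr 2; ext q
  rw [mul_left_comm, ← Complex.exp_add]
  congr 2
  have h1 : (Real.pi : ℂ) ≠ 0 := by exact_mod_cast Real.pi_ne_zero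
  have h2 : (s : ℂ) ≠ 0 := by exact_mod_cast hs.ne'
  simp only [hb]; push_cast; field_simp
  linear_combination (-4 * s * ‖q.2 - q.1‖ ^ 2 : ℂ) * Complex.I_sq

/-- Amplitudes on `[1, ∞)`: decreasing from at most `1`, with exponential decay. -/
structure IsAmplitude (a : ℝ → ℝ) : Prop where
  measurable : Measurable a
  antitoneOn : AntitoneOn a (Set.Ici 1)
  nonneg : ∀ s ∈ Set.Ici (1 : ℝ), 0 ≤ a s
  le_one : ∀ s ∈ Set.Ici (1 : ℝ), a s ≤ 1
  decay : ∃ δ > 0, a =O[atTop] fun s => Real.exp (-δ * s)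

namespace IsAmplitude

theorem tendsto_zero {a : ℝ → ℝ} (ha : IsAmplitude a) : Tendsto a atTop (𝓝 0) := by
  obtain ⟨δ, hδ, h⟩ := ha.decay
  refine h.trans_tendsto (Real.tendsto_exp_atBot.comp ?_)
  exact tendsto_id.const_mul_atTop_of_neg (by linarith)

theorem norm_le_one {a : ℝ → ℝ} (ha : IsAmplitude a) {s : ℝ} (hs : s ∈ Set.Ici (1 : ℝ)) : ‖(a s : ℂ)‖ ≤ 1 := by
  rw [Complex.norm_real, Real.norm_of_nonneg (ha.nonneg s hs)]; exact ha.le_one s hs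

/-- The function vanishes on (0, 1] and decays exponentially, so its Mellin transform is entire.
This supplies the holomorphy for Stein interpolation, and is the reason for keeping the damping
e^(-δs). -/
theorem differentiable_mellin_and_convergent {a : ℝ → ℝ} (ha : IsAmplitude a) {b : ℝ → ℂ} (hb : Continuous b) {C : ℝ}
    (hC : ∀ s, ‖b s‖ ≤ C) (z : ℂ) :
    MellinConvergent (Set.indicator (Set.Ioi 1) fun s => (a s : ℂ) * b s) z ∧
    DifferentiableAt ℂ (mellin (Set.indicator (Set.Ioi 1) fun s => (a s : ℂ) * b s)) z := by
  obtain ⟨δ, hδ, h⟩ := ha.decay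
  have hm : Measurable (fun s => (a s : ℂ) * b s) :=
    (Complex.measurable_ofReal.comp ha.measurable).mul hb.measurable
  have hC0 : 0 ≤ C := (norm_nonneg _).trans (hC 0)
  have h1 : LocallyIntegrableOn (Set.indicator (Set.Ioi 1) fun s => (a s : ℂ) * b s)
      (Set.Ioi 0) := by
    refine LocallyIntegrable.locallyIntegrableOn ?_ _
    refine (locallyIntegrable_const C).mono
      (hm.indicator measurableSet_Ioi).aestronglyMeasurable (Eventually.of_forall fun s => ?_)
    rw [Real.norm_of_nonneg hC0]
    by_cases hs : s ∈ Set.Ioi (1 : ℝ)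
    · rw [Set.indicator_of_mem hs, norm_mul]
      calc _ ≤ 1 * C := mul_le_mul (ha.norm_le_one (Set.mem_Ici.2 (le_of_lt hs))) (hC s) (norm_nonneg _) zero_le_one
        _ = C := one_mul C
    · rw [Set.indicator_of_notMem hs]; simpa using hC0
  have h2 : (Set.indicator (Set.Ioi 1) fun s => (a s : ℂ) * b s) =O[atTop]
      fun s => Real.exp (-δ * s) := by
    have hbO : b =O[atTop] fun _ : ℝ => (1 : ℝ) :=
      Asymptotics.IsBigO.of_bound C (Eventually.of_forall fun s => by simpa using hC s)
    have haO : (fun s => (a s : ℂ)) =O[atTop] fun s => Real.exp (-δ * s) := by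
      refine (Asymptotics.isBigO_norm_left.1 ?_)
      simpa using h.norm_left
    have := haO.mul hbO
    simp only [mul_one] at this
    refine this.congr' ?_ EventuallyEq.rfl
    filter_upwards [Ioi_mem_atTop (1 : ℝ)] with s hs
    rw [Set.indicator_of_mem hs]
  -- The function is zero near 0, so any exponent is allowed; Re z - 1 is one strictly below Re z.
  have h3 : (Set.indicator (Set.Ioi 1) fun s => (a s : ℂ) * b s) =O[𝓝[>] 0]
      (fun s : ℝ => s ^ (-(z.re - 1))) := by
    refine Asymptotics.IsBigO.of_bound 0 ?_
    filter_upwards [mem_nhdsWithin_of_mem_nhds (Iio_mem_nhds (zero_lt_one' ℝ))] with s hs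
    rw [Set.indicator_of_notMem (by simpa using le_of_lt hs)]; simp
  exact ⟨mellinConvergent_of_isBigO_rpow_exp hδ h1 h2 h3 (by linarith),
    mellin_differentiableAt_of_isBigO_rpow_exp hδ h1 h2 h3 (by linarith)⟩

theorem integrableOn_mul_cpow_mul {a : ℝ → ℝ} (ha : IsAmplitude a) {b : ℝ → ℂ} (hb : Continuous b) {C : ℝ}
    (hC : ∀ s, ‖b s‖ ≤ C) (z : ℂ) :
    IntegrableOn (fun s : ℝ => (a s : ℂ) * ((s : ℂ) ^ z * b s)) (Set.Ioi 1) := by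
  have h := (ha.differentiable_mellin_and_convergent hb hC (z + 1)).1
  rw [MellinConvergent] at h
  refine ((h.mono_set (Set.Ioi_subset_Ioi zero_le_one))).congr_fun (fun s hs => ?_) measurableSet_Ioi
  simp only [Set.indicator_of_mem hs, smul_eq_mul, add_sub_cancel_right]
  ring

end IsAmplitude

theorem mellin_indicator_Ioi_one_eq (a : ℝ → ℝ) {b : ℝ → ℂ} (z : ℂ) :
    mellin (Set.indicator (Set.Ioi 1) fun s => (a s : ℂ) * b s) z =
      ∫ s in Set.Ioi 1, (a s : ℂ) * ((s : ℂ) ^ (z - 1) * b s) := by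
  rw [mellin]
  have : ∀ s : ℝ, (s : ℂ) ^ (z - 1) • (Set.indicator (Set.Ioi 1) fun s => (a s : ℂ) * b s) s
      = (Set.indicator (Set.Ioi 1) fun s : ℝ => (a s : ℂ) * ((s : ℂ) ^ (z - 1) * b s)) s := by
    intro s
    by_cases hs : s ∈ Set.Ioi (1 : ℝ)
    · simp only [Set.indicator_of_mem hs, smul_eq_mul]; ring
    · simp only [Set.indicator_of_notMem hs, smul_zero]
  simp only [this]
  rw [setIntegral_indicator measurableSet_Ioi,
    Set.inter_eq_right.2 (Set.Ioi_subset_Ioi zero_le_one)]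

theorem continuous_schrodingerForm {f g : V → ℂ} (hf : Integrable f) (hf2 : MemLp f 2)
    (hg : Integrable g) (hg2 : MemLp g 2) : Continuous fun s => schrodingerForm s f g := by
  have hfg := integrable_fourier_mul_conj hf hf2 hg hg2
  refine continuous_of_dominated (bound := fun v => ‖𝓕 f v * (starRingEnd ℂ) (𝓕 g v)‖)
    (fun s => hfg.aestronglyMeasurable.mul (by fun_prop)) (fun s => Eventually.of_forall fun v => ?_)
    hfg.norm (Eventually.of_forall fun v => by fun_prop)
  rw [norm_mul _ (Complex.exp _), norm_cexp_I_mul, mul_one]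

/-- AM–GM replaces Cauchy–Schwarz. Nothing is lost where the constant matters, since there f and g
have equal L² norms. -/
theorem integral_norm_fourier_mul_conj_le {f g : V → ℂ} (hf : Integrable f) (hf2 : MemLp f 2)
    (hg : Integrable g) (hg2 : MemLp g 2) :
    ∫ v, ‖𝓕 f v * (starRingEnd ℂ) (𝓕 g v)‖ ≤ ((∫ x, ‖f x‖ ^ 2) + ∫ x, ‖g x‖ ^ 2) / 2 := by
  have i1 : Integrable (fun v => ‖𝓕 f v‖ ^ 2) := (memLp_fourier hf hf2).integrable_norm_pow (by norm_num)
  have i2 : Integrable (fun v => ‖𝓕 g v‖ ^ 2) := (memLp_fourier hg hg2).integrable_norm_pow (by norm_num)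
  rw [← integral_norm_sq_fourier_of_integrable hf hf2, ← integral_norm_sq_fourier_of_integrable hg hg2,
    ← integral_add i1 i2, ← integral_div]
  refine integral_mono (integrable_fourier_mul_conj hf hf2 hg hg2).norm ((i1.add i2).div_const 2)
    fun v => ?_
  simp only [norm_mul, RCLike.norm_conj]
  nlinarith [sq_nonneg (‖𝓕 f v‖ - ‖𝓕 g v‖)]

theorem norm_schrodingerForm_le {f g : V → ℂ} (hf : Integrable f) (hf2 : MemLp f 2)
    (hg : Integrable g) (hg2 : MemLp g 2) (s : ℝ) :
    ‖schrodingerForm s f g‖ ≤ ((∫ x, ‖f x‖ ^ 2) + ∫ x, ‖g x‖ ^ 2) / 2 := by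
  refine le_trans ?_ (integral_norm_fourier_mul_conj_le hf hf2 hg hg2)
  refine (norm_integral_le_integral_norm _).trans (le_of_eq ?_)
  congr 1; ext v
  rw [norm_mul _ (Complex.exp _), norm_cexp_I_mul, mul_one]

/-- The `L²` endpoint of the interpolation. -/
theorem norm_mul_integral_schrodingerForm_le {a : ℝ → ℝ} (ha : IsAmplitude a) {f g : V → ℂ}
    (hf : Integrable f) (hf2 : MemLp f 2) (hg : Integrable g) (hg2 : MemLp g 2) (τ : ℝ) :
    ‖(τ : ℂ) * ∫ s in Set.Ioi 1, (a s : ℂ) * ((s : ℂ) ^ (-1 + τ * Complex.I) *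
      schrodingerForm s f g)‖ ≤
      (3 + |τ| * (3 + |τ|)) * (((∫ x, ‖f x‖ ^ 2) + ∫ x, ‖g x‖ ^ 2) / 2) := by
  have hfg := integrable_fourier_mul_conj hf hf2 hg hg2
  have has : IntegrableOn (fun s : ℝ => (a s : ℂ) * ((s : ℂ) ^ (-1 + τ * Complex.I) * 1)) (Set.Ioi 1) :=
    ha.integrableOn_mul_cpow_mul continuous_const (C := 1) (fun _ => by simp) _
  have hprod : Integrable (fun q : ℝ × V => (a q.1 : ℂ) * ((q.1 : ℂ) ^ (-1 + τ * Complex.I) * 1) *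
      (𝓕 f q.2 * (starRingEnd ℂ) (𝓕 g q.2)) *
      Complex.exp (Complex.I * (1 - 4 * Real.pi ^ 2 * ‖q.2‖ ^ 2 : ℝ) * q.1))
      ((volume.restrict (Set.Ioi 1)).prod volume) :=
    (Integrable.mul_prod has hfg).mul_bdd (c := 1) (by fun_prop)
      (Eventually.of_forall fun q => (norm_cexp_I_mul _ _).le)
  -- After Fubini the operator is a Fourier multiplier, so a bound on the s-integral uniform in l =
  -- 1 - 4π²|v|² is all that is needed.
  have e : ∫ s in Set.Ioi 1, (a s : ℂ) * ((s : ℂ) ^ (-1 + τ * Complex.I) * schrodingerForm s f g)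
      = ∫ v, 𝓕 f v * (starRingEnd ℂ) (𝓕 g v) * ∫ s in Set.Ioi 1, (a s : ℂ) *
        ((s : ℂ) ^ (-1 + τ * Complex.I) *
          Complex.exp (Complex.I * (1 - 4 * Real.pi ^ 2 * ‖v‖ ^ 2 : ℝ) * s)) := by
    calc _ = ∫ s in Set.Ioi 1, ∫ v, (a s : ℂ) * ((s : ℂ) ^ (-1 + τ * Complex.I) * 1) *
          (𝓕 f v * (starRingEnd ℂ) (𝓕 g v)) *
          Complex.exp (Complex.I * (1 - 4 * Real.pi ^ 2 * ‖v‖ ^ 2 : ℝ) * s) := by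
            congr 1; ext s
            rw [schrodingerForm, ← integral_const_mul, ← integral_const_mul]
            congr 1; ext v; ring
      _ = _ := by
            rw [integral_integral_swap hprod]
            congr 1; ext v
            rw [← integral_const_mul]
            congr 1; ext s; ring
  rw [e, ← integral_const_mul]
  have hin : ∀ v : V, ‖(τ : ℂ) * ∫ s in Set.Ioi 1, (a s : ℂ) * ((s : ℂ) ^ (-1 + τ * Complex.I) *
          Complex.exp (Complex.I * (1 - 4 * Real.pi ^ 2 * ‖v‖ ^ 2 : ℝ) * s))‖ ≤ 3 + |τ| * (3 + |τ|) := by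
    intro v
    set l : ℝ := 1 - 4 * Real.pi ^ 2 * ‖v‖ ^ 2
    have hcont : ContinuousOn (fun s : ℝ => (τ : ℂ) * ((s : ℂ) ^ (-1 + τ * Complex.I) *
        Complex.exp (Complex.I * l * s))) (Set.Ici 1) := by
      refine continuousOn_const.mul (ContinuousOn.mul (fun s hs => ?_) (by fun_prop))
      exact (hasDerivAt_ofReal_cpow (zero_lt_one.trans_le hs) _).continuousAt.continuousWithinAt
    have hi := ha.integrableOn_mul_cpow_mul (b := fun s => Complex.exp (Complex.I * l * s))
      (by fun_prop) (C := 1) (fun s => (norm_cexp_I_mul _ _).le) (-1 + τ * Complex.I)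
    have := norm_integral_antitone_mul_le ha.measurable ha.antitoneOn ha.nonneg ha.le_one
      ha.tendsto_zero hcont ((hi.const_mul (τ : ℂ)).congr
        (Eventually.of_forall fun s => by simp only; ring)) (M := 3 + |τ| * (3 + |τ|))
      (fun R hR => by
        rw [intervalIntegral.integral_const_mul]
        exact norm_mul_integral_cpow_mul_cexp_le τ l hR)
    rw [← integral_const_mul]
    refine le_trans (le_of_eq ?_) this
    congr 2; ext s; ring
  calc _ ≤ ∫ v, ‖𝓕 f v * (starRingEnd ℂ) (𝓕 g v)‖ * (3 + |τ| * (3 + |τ|)) := by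
        refine norm_integral_le_of_norm_le (hfg.norm.mul_const _) (Eventually.of_forall fun v => ?_)
        rw [mul_left_comm, norm_mul]
        gcongr
        exact hin v
    _ ≤ _ := by
        rw [integral_mul_const, mul_comm]
        gcongr
        exact integral_norm_fourier_mul_conj_le hf hf2 hg hg2

/-- The `L¹ → L^∞` endpoint of the interpolation. -/
theorem norm_integral_schrodingerForm_le {a : ℝ → ℝ} (ha : IsAmplitude a) {f g : V → ℂ}
    (hf : Integrable f) (hf2 : MemLp f 2) (hg : Integrable g) (hg2 : MemLp g 2) (τ : ℝ) :
    ‖∫ s in Set.Ioi 1, (a s : ℂ) * ((s : ℂ) ^ ((Module.finrank ℝ V / 2 : ℂ) +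
      (((-1 / 2 : ℝ) : ℂ) + τ * Complex.I)) * schrodingerForm s f g)‖ ≤
      (12 + 8 * |τ|) * ((∫ x, ‖f x‖) * ∫ x, ‖g x‖) := by
  set N := Module.finrank ℝ V
  have hg' : Integrable (fun x => (starRingEnd ℂ) (g x)) :=
    (LinearIsometryEquiv.integrable_comp_iff (Complex.conjLIE : ℂ ≃ₗᵢ[ℝ] ℂ)).2 hg
  have hfg : Integrable (fun q : V × V => f q.1 * (starRingEnd ℂ) (g q.2)) :=
    hf.mul_prod (ν := volume) hg'
  set w : ℂ := ((-1 / 2 : ℝ) : ℂ) + τ * Complex.I with hw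
  have has : IntegrableOn (fun s : ℝ => (a s : ℂ) * ((s : ℂ) ^ w * 1)) (Set.Ioi 1) :=
    ha.integrableOn_mul_cpow_mul continuous_const (C := 1) (fun _ => by simp) _
  have hph : ∀ x : ℝ, ‖Complex.exp (Complex.I * (x : ℂ))‖ = 1 := Complex.norm_exp_I_mul_ofReal
  have hprod : Integrable (fun q : ℝ × (V × V) => (a q.1 : ℂ) * ((q.1 : ℂ) ^ w * 1) *
      (f q.2.1 * (starRingEnd ℂ) (g q.2.2)) *
      Complex.exp (Complex.I * ((q.1 + (‖q.2.2 - q.2.1‖ / 2) ^ 2 / q.1 : ℝ) : ℂ)))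
      ((volume.restrict (Set.Ioi 1)).prod volume) := by
    refine (Integrable.mul_prod has hfg).mul_bdd (c := 1) ?_
      (Eventually.of_forall fun q => (hph _).le)
    refine Measurable.aestronglyMeasurable ?_
    fun_prop
  -- The kernel contributes s^(-N/2), which cancels the N/2 in the exponent and leaves w = -1/2 +
  -- iτ, the power for which the s-integral is bounded uniformly in the distance |x - y|.
  have e : ∫ s in Set.Ioi 1, (a s : ℂ) * ((s : ℂ) ^ ((N / 2 : ℂ) + w) * schrodingerForm s f g)
      = dispersiveConst N * ∫ q : V × V, f q.1 * (starRingEnd ℂ) (g q.2) *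
        ∫ s in Set.Ioi 1, (a s : ℂ) * ((s : ℂ) ^ w *
          Complex.exp (Complex.I * ((s + (‖q.2 - q.1‖ / 2) ^ 2 / s : ℝ) : ℂ))) := by
    calc _ = ∫ s in Set.Ioi 1, dispersiveConst N * ∫ q : V × V, (a s : ℂ) * ((s : ℂ) ^ w * 1) *
          (f q.1 * (starRingEnd ℂ) (g q.2)) *
          Complex.exp (Complex.I * ((s + (‖q.2 - q.1‖ / 2) ^ 2 / s : ℝ) : ℂ)) := by
            refine setIntegral_congr_fun measurableSet_Ioi fun s hs => ?_
            have hs0 : 0 < s := zero_lt_one.trans hs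
            have hs' : (s : ℂ) ≠ 0 := by exact_mod_cast hs0.ne'
            rw [schrodingerForm_eq_kernel hf hf2 hg hg2 hs0, ← integral_const_mul,
              ← integral_const_mul, ← integral_const_mul, ← integral_const_mul]
            congr 1; ext q
            have : (s : ℂ) ^ w = (s : ℂ) ^ ((N / 2 : ℂ) + w) * (s : ℂ) ^ (-(N / 2 : ℂ)) := by
              rw [← Complex.cpow_add _ _ hs']; congr 1; ring
            rw [this]; ring
      _ = _ := by
            rw [integral_const_mul, integral_integral_swap hprod]
            congr 2; ext q
            rw [← integral_const_mul]
            congr 1; ext s; ring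
  have hin : ∀ q : V × V, ‖∫ s in Set.Ioi 1, (a s : ℂ) * ((s : ℂ) ^ w *
          Complex.exp (Complex.I * ((s + (‖q.2 - q.1‖ / 2) ^ 2 / s : ℝ) : ℂ)))‖ ≤ 12 + 8 * |τ| := by
    intro q
    have hρ : 0 ≤ ‖q.2 - q.1‖ / 2 := by positivity
    set ρ : ℝ := ‖q.2 - q.1‖ / 2
    have hpc : ContinuousOn (fun s : ℝ => Complex.exp (Complex.I * ((s + ρ ^ 2 / s : ℝ) : ℂ)))
        (Set.Ici 1) :=
      (continuousOn_const.mul (Complex.continuous_ofReal.comp_continuousOn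
        (continuousOn_id.add (continuousOn_const.div continuousOn_id fun x hx =>
          (zero_lt_one.trans_le hx).ne')))).cexp
    have hcont : ContinuousOn (fun s : ℝ => ((s : ℂ) ^ w *
        Complex.exp (Complex.I * ((s + ρ ^ 2 / s : ℝ) : ℂ)))) (Set.Ici 1) := by
      refine ContinuousOn.mul (fun s hs => ?_) hpc
      exact (hasDerivAt_ofReal_cpow (zero_lt_one.trans_le hs) _).continuousAt.continuousWithinAt
    refine norm_integral_antitone_mul_le ha.measurable ha.antitoneOn ha.nonneg ha.le_one
      ha.tendsto_zero hcont ?_ (fun R hR => norm_integral_cpow_mul_cexp_phase_le τ hρ hR)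
    have := Integrable.mul_bdd (c := 1) has (g := fun s : ℝ => Complex.exp (Complex.I * ((s + ρ ^ 2 / s : ℝ) : ℂ)))
      (hpc.mono Set.Ioi_subset_Ici_self |>.aestronglyMeasurable measurableSet_Ioi)
      (Eventually.of_forall fun s => (hph _).le)
    exact this.congr (Eventually.of_forall fun s => by simp only; ring)
  rw [e, norm_mul]
  refine (mul_le_of_le_one_left (norm_nonneg _) (norm_dispersiveConst_le N)).trans ?_
  calc _ ≤ ∫ q : V × V, ‖f q.1 * (starRingEnd ℂ) (g q.2)‖ * (12 + 8 * |τ|) := by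
        refine norm_integral_le_of_norm_le (hfg.norm.mul_const _) (Eventually.of_forall fun v => ?_)
        rw [norm_mul]
        gcongr
        exact hin v
    _ = _ := by
        rw [integral_mul_const, mul_comm]
        simp only [norm_mul, RCLike.norm_conj]
        congr 1
        exact integral_prod_mul (fun x => ‖f x‖) (fun x => ‖g x‖)

end SchrodingerForm

/-! ### Stein interpolation -/

/-- Only nonzero values enter the sum, so for integrable f every level set involved has finite
measure, and all dependence on K sits in finitely many scalar coefficients. -/
theorem simpleFunc_comp_eq_sum_indicator {X : Type*} [MeasurableSpace X] (f : SimpleFunc X ℂ) {K : ℂ → ℂ} (hK : K 0 = 0) (x : X) :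
    K (f x) = ∑ c ∈ f.range.filter (· ≠ 0), K c * (f ⁻¹' {c}).indicator (fun _ => (1 : ℂ)) x := by
  by_cases h : f x = 0
  · rw [h, hK, Finset.sum_eq_zero]
    intro c hc
    rw [Set.indicator_of_notMem, mul_zero]
    rw [Set.mem_preimage, h]
    exact fun h' => (Finset.mem_filter.1 hc).2 h'.symm
  · rw [Finset.sum_eq_single (f x)]
    · rw [Set.indicator_of_mem (by simp), mul_one]
    · intro c _ hne
      rw [Set.indicator_of_notMem, mul_zero]
      exact fun h' => hne h'.symm
    · intro h'
      exact absurd (Finset.mem_filter.2 ⟨f.mem_range_self x, h⟩) h'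

section Interpolation

variable {V : Type*} [NormedAddCommGroup V] [InnerProductSpace ℝ V] [FiniteDimensional ℝ V]
  [MeasurableSpace V] [BorelSpace V]

theorem fourier_finset_sum {ι : Type*} (S : Finset ι) (c : ι → ℂ) {u : ι → V → ℂ}
    (hu : ∀ i ∈ S, Integrable (u i)) (v : V) :
    𝓕 (fun x => ∑ i ∈ S, c i * u i x) v = ∑ i ∈ S, c i * 𝓕 (u i) v := by
  simp only [Real.fourier_eq, Finset.smul_sum]
  rw [integral_finsetSum]
  · refine Finset.sum_congr rfl fun i _ => ?_
    rw [← integral_const_mul]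
    congr 1; ext x
    simp only [Circle.smul_def, smul_eq_mul]; ring
  · intro i hi
    exact (Real.fourierIntegral_convergent_iff v).2 ((hu i hi).const_mul _)

theorem schrodingerForm_finset_sum {ι : Type*} (S : Finset ι) (c d : ι → ℂ) {u : ι → V → ℂ}
    (hu : ∀ i ∈ S, Integrable (u i)) (hu2 : ∀ i ∈ S, MemLp (u i) 2) (s : ℝ) :
    schrodingerForm s (fun x => ∑ i ∈ S, c i * u i x) (fun x => ∑ i ∈ S, d i * u i x) =
      ∑ i ∈ S, ∑ j ∈ S, c i * (starRingEnd ℂ) (d j) * schrodingerForm s (u i) (u j) := by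
  simp only [schrodingerForm, fourier_finset_sum S _ hu, ← integral_const_mul]
  have h_integ : ∀ i ∈ S, ∀ j ∈ S, Integrable (fun v => c i * (starRingEnd ℂ) (d j) *
      (𝓕 (u i) v * (starRingEnd ℂ) (𝓕 (u j) v) *
        Complex.exp (Complex.I * (1 - 4 * Real.pi ^ 2 * ‖v‖ ^ 2 : ℝ) * s))) := fun i hi j hj =>
    ((integrable_fourier_mul_conj (hu i hi) (hu2 i hi) (hu j hj) (hu2 j hj)).mul_bdd (c := 1)
      (by fun_prop) (Eventually.of_forall fun v => (norm_cexp_I_mul _ _).le)).const_mul _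
  rw [show (∑ i ∈ S, ∑ j ∈ S, ∫ v, c i * (starRingEnd ℂ) (d j) *
      (𝓕 (u i) v * (starRingEnd ℂ) (𝓕 (u j) v) *
        Complex.exp (Complex.I * (1 - 4 * Real.pi ^ 2 * ‖v‖ ^ 2 : ℝ) * s))) =
      ∫ v, ∑ i ∈ S, ∑ j ∈ S, c i * (starRingEnd ℂ) (d j) *
      (𝓕 (u i) v * (starRingEnd ℂ) (𝓕 (u j) v) *
        Complex.exp (Complex.I * (1 - 4 * Real.pi ^ 2 * ‖v‖ ^ 2 : ℝ) * s)) by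
    rw [integral_finsetSum _ fun i hi => integrable_finsetSum _ (h_integ i hi)]
    exact Finset.sum_congr rfl fun i hi => (integral_finsetSum _ (h_integ i hi)).symm]
  congr 1; ext v
  rw [map_sum, Finset.sum_mul_sum, Finset.sum_mul]
  refine Finset.sum_congr rfl fun i _ => ?_
  rw [Finset.sum_mul]
  refine Finset.sum_congr rfl fun j _ => ?_
  rw [map_mul]; ring

/-- The unimodular part of `c` times the complex power `‖c‖ ^ w`. -/
noncomputable def phasePow (w c : ℂ) : ℂ := c / ‖c‖ * (‖c‖ : ℂ) ^ w

theorem phasePow_zero (w : ℂ) : phasePow w 0 = 0 := by simp [phasePow]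

theorem phasePow_one (c : ℂ) : phasePow 1 c = c := by
  rcases eq_or_ne c 0 with rfl | h
  · exact phasePow_zero 1
  · have : (‖c‖ : ℂ) ≠ 0 := by exact_mod_cast norm_ne_zero_iff.2 h
    rw [phasePow, Complex.cpow_one]; field_simp

theorem norm_phasePow {w : ℂ} (hw : 0 < w.re) (c : ℂ) : ‖phasePow w c‖ = ‖c‖ ^ w.re := by
  rcases eq_or_ne c 0 with rfl | h
  · rw [phasePow_zero, norm_zero, Real.zero_rpow hw.ne']
  · have h0 : 0 < ‖c‖ := norm_pos_iff.2 h
    rw [phasePow, norm_mul, Complex.norm_cpow_eq_rpow_re_of_pos h0, norm_div, Complex.norm_real,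
      norm_norm, div_self h0.ne', one_mul]

theorem differentiable_phasePow {c : ℂ} (hc : c ≠ 0) : Differentiable ℂ fun w => phasePow w c := by
  have : (‖c‖ : ℂ) ≠ 0 := by exact_mod_cast norm_ne_zero_iff.2 hc
  intro w
  exact ((differentiableAt_id).const_cpow (Or.inl this)).const_mul _

/-- The form is antilinear in its second slot; with a conjugated exponent there, its coefficients
become holomorphic in w again. -/
theorem conj_phasePow_conj {c : ℂ} (w : ℂ) :
    (starRingEnd ℂ) (phasePow ((starRingEnd ℂ) w) c) = phasePow w ((starRingEnd ℂ) c) := by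
  have hπ : Complex.arg (‖c‖ : ℂ) ≠ Real.pi := by
    rw [Complex.arg_ofReal_of_nonneg (norm_nonneg c)]; exact Real.pi_ne_zero.symm
  rw [phasePow, phasePow, map_mul, map_div₀, Complex.conj_ofReal, RCLike.norm_conj,
    Complex.cpow_conj _ _ hπ, Complex.conj_ofReal, Complex.conj_conj]


/-- Stein interpolation between the two endpoints, for normalized simple functions. -/
theorem norm_integral_schrodingerForm_simpleFunc_le {a : ℝ → ℝ} (ha : IsAmplitude a)
    (f : SimpleFunc V ℂ) (hf : Integrable f) {p θ : ℝ} (hθ0 : 0 < θ) (hθ1 : θ ≤ 1)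
    (hp : p * (1 + θ) / 2 = 1) (hfp : ∫ x, ‖f x‖ ^ p = 1) :
    ‖∫ s in Set.Ioi 1, (a s : ℂ) * ((s : ℂ) ^ ((θ : ℂ) * ((Module.finrank ℝ V + 1) / 2 : ℂ) - 1) *
      schrodingerForm s f f)‖ ≤ 108 * (Module.finrank ℝ V + 1) ^ 2 / θ := by
  set N := Module.finrank ℝ V
  have hp0 : 0 < p := by
    by_contra h
    nlinarith
  set S := f.range.filter (· ≠ 0) with hS
  set χ : ℂ → V → ℂ := fun c => (f ⁻¹' {c}).indicator (fun _ => (1 : ℂ)) with hχ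
  have hχp : ∀ c ∈ S, ∀ q : ENNReal, MemLp (χ c) q volume := fun c hc q =>
    memLp_indicator_const q (f.measurableSet_preimage {c}) 1
      (Or.inr (f.measure_preimage_lt_top_of_integrable hf (Finset.mem_filter.1 hc).2).ne)
  have hχ1 : ∀ c ∈ S, Integrable (χ c) := fun c hc => memLp_one_iff_integrable.1 (hχp c hc 1)
  have hχ2 : ∀ c ∈ S, MemLp (χ c) 2 := fun c hc => hχp c hc 2
  -- the analytic families
  set w : ℂ → ℂ := fun ζ => (p : ℂ) * (1 + ζ) / 2 with hw
  -- The exponent p(1 + ζ)/2 gives |F|² = |f|^p on Re ζ = 0 and |F| = |f|^p on Re ζ = 1, so both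
  -- endpoint norms are 1; at ζ = θ it equals 1 and F = f.
  set F : ℂ → V → ℂ := fun ζ x => phasePow (w ζ) (f x) with hF
  set G : ℂ → V → ℂ := fun ζ x => phasePow ((starRingEnd ℂ) (w ζ)) (f x) with hG
  have hFsum : ∀ ζ, F ζ = fun x => ∑ c ∈ S, phasePow (w ζ) c * χ c x := fun ζ => by
    ext x; exact simpleFunc_comp_eq_sum_indicator f (phasePow_zero _) x
  have hGsum : ∀ ζ, G ζ = fun x => ∑ c ∈ S, phasePow ((starRingEnd ℂ) (w ζ)) c * χ c x := fun ζ => by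
    ext x; exact simpleFunc_comp_eq_sum_indicator f (phasePow_zero _) x
  have hF1 : ∀ ζ, Integrable (F ζ) := fun ζ => by
    rw [hFsum]; exact integrable_finsetSum _ fun c hc => (hχ1 c hc).const_mul _
  have hG1 : ∀ ζ, Integrable (G ζ) := fun ζ => by
    rw [hGsum]; exact integrable_finsetSum _ fun c hc => (hχ1 c hc).const_mul _
  have hF2 : ∀ ζ, MemLp (F ζ) 2 := fun ζ => by
    rw [hFsum]; exact memLp_finsetSum _ fun c hc => (hχ2 c hc).const_mul _
  have hG2 : ∀ ζ, MemLp (G ζ) 2 := fun ζ => by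
    rw [hGsum]; exact memLp_finsetSum _ fun c hc => (hχ2 c hc).const_mul _
  have hwre : ∀ ζ, (w ζ).re = p * (1 + ζ.re) / 2 := fun ζ => by
    have : w ζ = ((p / 2 : ℝ) : ℂ) * (1 + ζ) := by simp only [hw]; push_cast; ring
    rw [this, Complex.re_ofReal_mul]; simp; ring
  have hFn : ∀ ζ : ℂ, 0 ≤ ζ.re → ∀ x, ‖F ζ x‖ = ‖f x‖ ^ (p * (1 + ζ.re) / 2) := fun ζ hζ x => by
    simp only [hF]
    rw [norm_phasePow (by rw [hwre]; positivity), hwre]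
  have hGn : ∀ ζ : ℂ, 0 ≤ ζ.re → ∀ x, ‖G ζ x‖ = ‖f x‖ ^ (p * (1 + ζ.re) / 2) := fun ζ hζ x => by
    simp only [hG]
    rw [norm_phasePow (by rw [Complex.conj_re, hwre]; positivity), Complex.conj_re, hwre]
  -- the analytic function
  set m : ℂ → ℂ → ℂ → ℂ := fun c d => mellin (Set.indicator (Set.Ioi 1) fun s =>
    (a s : ℂ) * schrodingerForm s (χ c) (χ d)) with hm
  set Ψ : ℂ → ℂ := fun ζ => ∑ c ∈ S, ∑ d ∈ S, phasePow (w ζ) c *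
    phasePow (w ζ) ((starRingEnd ℂ) d) * m c d (ζ * ((N + 1) / 2)) with hΨ
  -- The power of s is -1 + iτ on Re ζ = 0 and N/2 - 1/2 + iτ on Re ζ = 1, with τ = Im ζ (N + 1)/2:
  -- exactly the two endpoints.
  have hΨeq : ∀ ζ, Ψ ζ = ∫ s in Set.Ioi 1, (a s : ℂ) * ((s : ℂ) ^ (ζ * ((N + 1) / 2) - 1) *
      schrodingerForm s (F ζ) (G ζ)) := by
    intro ζ
    have hi : ∀ c ∈ S, ∀ d ∈ S, IntegrableOn (fun s : ℝ => phasePow (w ζ) c *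
        phasePow (w ζ) ((starRingEnd ℂ) d) * ((a s : ℂ) * ((s : ℂ) ^ (ζ * ((N + 1) / 2) - 1) *
          schrodingerForm s (χ c) (χ d)))) (Set.Ioi 1) := fun c hc d hd =>
      (ha.integrableOn_mul_cpow_mul (continuous_schrodingerForm (hχ1 c hc) (hχ2 c hc) (hχ1 d hd)
        (hχ2 d hd)) (norm_schrodingerForm_le (hχ1 c hc) (hχ2 c hc) (hχ1 d hd) (hχ2 d hd)) _).const_mul _
    simp only [hΨ, hm, mellin_indicator_Ioi_one_eq, ← integral_const_mul]
    rw [show (∑ c ∈ S, ∑ d ∈ S, ∫ s in Set.Ioi 1, phasePow (w ζ) c *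
        phasePow (w ζ) ((starRingEnd ℂ) d) * ((a s : ℂ) * ((s : ℂ) ^ (ζ * ((N + 1) / 2) - 1) *
          schrodingerForm s (χ c) (χ d)))) = ∫ s in Set.Ioi 1, ∑ c ∈ S, ∑ d ∈ S, phasePow (w ζ) c *
        phasePow (w ζ) ((starRingEnd ℂ) d) * ((a s : ℂ) * ((s : ℂ) ^ (ζ * ((N + 1) / 2) - 1) *
          schrodingerForm s (χ c) (χ d))) by
      rw [integral_finsetSum _ fun i hi' => integrable_finsetSum _ (hi i hi')]
      exact Finset.sum_congr rfl fun i hi' => (integral_finsetSum _ (hi i hi')).symm]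
    congr 1; ext s
    rw [hFsum, hGsum, schrodingerForm_finset_sum S _ _ hχ1 hχ2, Finset.mul_sum, Finset.mul_sum]
    refine Finset.sum_congr rfl fun c _ => ?_
    rw [Finset.mul_sum, Finset.mul_sum]
    refine Finset.sum_congr rfl fun d _ => ?_
    rw [conj_phasePow_conj]; ring
  have hΨd : Differentiable ℂ Ψ := by
    intro ζ
    refine DifferentiableAt.fun_sum fun c hc => DifferentiableAt.fun_sum fun d hd => ?_
    have hc0 : c ≠ 0 := (Finset.mem_filter.1 hc).2
    have hd0 : (starRingEnd ℂ) d ≠ 0 := (map_ne_zero _).2 (Finset.mem_filter.1 hd).2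
    have hwd : DifferentiableAt ℂ w ζ := by simp only [hw]; fun_prop
    refine ((DifferentiableAt.comp ζ (differentiable_phasePow hc0 _) hwd).mul
      (DifferentiableAt.comp ζ (differentiable_phasePow hd0 _) hwd)).mul ?_
    have := (ha.differentiable_mellin_and_convergent
      (continuous_schrodingerForm (hχ1 c hc) (hχ2 c hc) (hχ1 d hd)
        (hχ2 d hd)) (norm_schrodingerForm_le (hχ1 c hc) (hχ2 c hc) (hχ1 d hd) (hχ2 d hd))
        (ζ * ((N + 1) / 2))).2
    exact DifferentiableAt.comp (g := m c d) (f := fun ζ : ℂ => ζ * ((N + 1) / 2)) ζ this (by fun_prop)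
  -- boundedness in the strip
  have hΨb : ∃ B, ∀ ζ : ℂ, 0 ≤ ζ.re → ζ.re ≤ 1 → ‖Ψ ζ‖ ≤ B := by
    have hm_b : ∀ c ∈ S, ∀ d ∈ S, ∃ B, ∀ ζ : ℂ, 0 ≤ ζ.re → ζ.re ≤ 1 →
        ‖m c d (ζ * ((N + 1) / 2))‖ ≤ B := by
      intro c hc d hd
      have hC := norm_schrodingerForm_le (hχ1 c hc) (hχ2 c hc) (hχ1 d hd) (hχ2 d hd)
      have hcont := continuous_schrodingerForm (hχ1 c hc) (hχ2 c hc) (hχ1 d hd) (hχ2 d hd)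
      -- On the strip the real part of the exponent is at most (N + 1)/2 - 1 ≤ N, so for s > 1 the
      -- power s^N dominates. The resulting bound depends on f and a, and serves only as the growth
      -- hypothesis of Phragmén–Lindelöf.
      have hI := (ha.integrableOn_mul_cpow_mul hcont hC (N : ℂ)).norm
      refine ⟨∫ s in Set.Ioi 1, ‖(a s : ℂ) * ((s : ℂ) ^ (N : ℂ) * schrodingerForm s (χ c) (χ d))‖,
        fun ζ h0 h1 => ?_⟩
      simp only [hm, mellin_indicator_Ioi_one_eq]
      refine norm_integral_le_of_norm_le hI ?_
      filter_upwards [ae_restrict_mem measurableSet_Ioi] with s hs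
      have hs0 : 0 < s := zero_lt_one.trans hs
      rw [norm_mul, norm_mul, norm_mul, norm_mul, Complex.norm_cpow_eq_rpow_re_of_pos hs0,
        Complex.norm_cpow_eq_rpow_re_of_pos hs0]
      have hre : (ζ * ((N + 1) / 2) - 1).re ≤ (N : ℂ).re := by
        have : (ζ * ((N + 1) / 2) - 1 : ℂ) = (((N + 1) / 2 : ℝ) : ℂ) * ζ - 1 := by push_cast; ring
        rw [this, Complex.sub_re, Complex.re_ofReal_mul]
        simp only [Complex.one_re, Complex.natCast_re]
        have : (0 : ℝ) ≤ N := Nat.cast_nonneg _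
        nlinarith
      gcongr
      exact le_of_lt hs
    have hp_b : ∀ c : ℂ, ∃ B, ∀ ζ : ℂ, 0 ≤ ζ.re → ζ.re ≤ 1 → ‖phasePow (w ζ) c‖ ≤ B := by
      intro c
      refine ⟨max 1 (‖c‖ ^ p), fun ζ h0 h1 => ?_⟩
      rw [norm_phasePow (by rw [hwre]; positivity), hwre]
      rcases le_total ‖c‖ 1 with hc | hc
      · exact (Real.rpow_le_one (norm_nonneg _) hc (by positivity)).trans (le_max_left _ _)
      · refine le_trans (Real.rpow_le_rpow_of_exponent_le hc ?_) (le_max_right _ _)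
        nlinarith
    choose! B1 hB1 using hm_b
    choose B2 hB2 using hp_b
    refine ⟨∑ c ∈ S, ∑ d ∈ S, B2 c * B2 ((starRingEnd ℂ) d) * B1 c d, fun ζ h0 h1 => ?_⟩
    refine (norm_sum_le _ _).trans (Finset.sum_le_sum fun c hc => (norm_sum_le _ _).trans
      (Finset.sum_le_sum fun d hd => ?_))
    rw [norm_mul, norm_mul]
    have := hB1 c hc d hd ζ h0 h1
    have h2 := hB2 c ζ h0 h1
    have h3 := hB2 ((starRingEnd ℂ) d) ζ h0 h1
    have := (norm_nonneg _).trans h2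
    have := (norm_nonneg _).trans h3
    gcongr
  have hne2 : ∀ ζ : ℂ, 0 ≤ ζ.re → ζ + 2 ≠ 0 := fun ζ h0 h => by
    have := congrArg Complex.re h
    simp at this; linarith
  -- The factor ζ supplies the τ that the L² endpoint requires, and (ζ + 2)⁻² compensates the
  -- polynomial growth of the endpoint bounds in τ; its pole at -2 is outside the strip.
  set H : ℂ → ℂ := fun ζ => ζ / (ζ + 2) ^ 2 * Ψ ζ with hH
  have hHd : DiffContOnCl ℂ H (Complex.re ⁻¹' Set.Ioo 0 1) := by
    refine DifferentiableOn.diffContOnCl ?_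
    have hcl : closure (Complex.re ⁻¹' Set.Ioo 0 1) ⊆ {ζ : ℂ | 0 ≤ ζ.re} :=
      closure_minimal (fun ζ hζ => hζ.1.le) (isClosed_le continuous_const Complex.continuous_re)
    intro ζ hζ
    have h2 := hne2 ζ (hcl hζ)
    refine DifferentiableAt.differentiableWithinAt ?_
    have hq : DifferentiableAt ℂ (fun ζ : ℂ => ζ / (ζ + 2) ^ 2) ζ :=
      DifferentiableAt.fun_div (by fun_prop) (by fun_prop) (pow_ne_zero 2 h2)
    exact hq.mul (hΨd ζ)
  have hn2 : ∀ ζ : ℂ, 0 ≤ ζ.re → 2 ≤ ‖ζ + 2‖ ∧ ‖ζ‖ ≤ ‖ζ + 2‖ ∧ |ζ.im| ≤ ‖ζ + 2‖ := fun ζ h0 => by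
    refine ⟨?_, ?_, ?_⟩
    · have := Complex.re_le_norm (ζ + 2); simp at this; linarith
    · rw [Complex.norm_def, Complex.norm_def]
      refine Real.sqrt_le_sqrt ?_
      simp [Complex.normSq_apply]; nlinarith
    · simpa using Complex.abs_im_le_norm (ζ + 2)
  have hHn : ∀ ζ : ℂ, ‖H ζ‖ = ‖ζ‖ * ‖Ψ ζ‖ / ‖ζ + 2‖ ^ 2 := fun ζ => by
    simp only [hH, norm_mul, norm_div, norm_pow]; ring
  have hNpos : (1 : ℝ) ≤ N + 1 := by have : (0 : ℝ) ≤ N := Nat.cast_nonneg _; linarith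
  have key : ‖H θ‖ ≤ 12 * (N + 1 : ℝ) ^ 2 := by
    refine PhragmenLindelof.vertical_strip hHd ?_ ?_ ?_ (by simpa using hθ0.le) (by simpa using hθ1)
    · obtain ⟨B, hB⟩ := hΨb
      refine ⟨0, by simp [Real.pi_pos], 0, ?_⟩
      refine Asymptotics.IsBigO.of_bound B ?_
      refine eventually_inf_principal.2 (Eventually.of_forall fun ζ hζ => ?_)
      obtain ⟨h2, h3, -⟩ := hn2 ζ hζ.1.le
      have hb := hB ζ hζ.1.le hζ.2.le
      have hb0 := (norm_nonneg _).trans hb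
      rw [hHn]
      simp only [zero_mul, Real.exp_zero, norm_one, mul_one]
      rw [div_le_iff₀ (by positivity)]
      calc ‖ζ‖ * ‖Ψ ζ‖ ≤ ‖ζ + 2‖ * B := by gcongr
        _ ≤ B * ‖ζ + 2‖ ^ 2 := by nlinarith [mul_nonneg hb0 (norm_nonneg (ζ + 2))]
    · intro ζ hζ
      obtain ⟨h2, h3, h4⟩ := hn2 ζ hζ.ge
      set τ : ℝ := ζ.im * ((N + 1) / 2) with hτ
      have hζ' : ζ = (ζ.im : ℂ) * Complex.I := by apply Complex.ext <;> simp [hζ]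
      have hexp : ζ * ((N + 1) / 2) - 1 = -1 + (τ : ℂ) * Complex.I := by
        rw [hζ', hτ]; push_cast; ring
      have hb := norm_mul_integral_schrodingerForm_le ha (hF1 ζ) (hF2 ζ) (hG1 ζ) (hG2 ζ) τ
      rw [← hexp, ← hΨeq] at hb
      have hsq : ∀ x, (‖f x‖ ^ (p * (1 + ζ.re) / 2)) ^ 2 = ‖f x‖ ^ p := fun x => by
        rw [← Real.rpow_natCast, ← Real.rpow_mul (norm_nonneg _), hζ]; congr 1; push_cast; ring
      simp only [hFn ζ hζ.ge, hGn ζ hζ.ge, hsq, hfp] at hb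
      norm_num at hb
      rw [hHn, div_le_iff₀ (by positivity)]
      have hnζ : ‖ζ‖ = |ζ.im| := by
        conv_lhs => rw [hζ']
        simp
      have hτa : |τ| = |ζ.im| * ((N + 1) / 2) := by
        rw [hτ, abs_mul, abs_of_nonneg (by positivity : (0 : ℝ) ≤ (N + 1) / 2)]
      set r := ‖ζ + 2‖
      set y := |ζ.im|
      have hy : 0 ≤ y := abs_nonneg _
      set M : ℝ := N + 1
      have hPn := norm_nonneg (Ψ ζ)
      rw [hnζ]
      have hτy : |τ| ≤ M * r := by rw [hτa]; nlinarith
      have hτ0 := abs_nonneg τ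
      -- The endpoint carries τ while H carries Im ζ; as |τ| = |Im ζ| M/2 with M ≥ 1, the exchange
      -- costs a factor 2.
      have h5 : y * ‖Ψ ζ‖ ≤ 2 * (|τ| * ‖Ψ ζ‖) := by
        rw [hτa]; nlinarith [mul_nonneg hy hPn]
      have hMr : 2 ≤ M * r := by nlinarith
      calc y * ‖Ψ ζ‖ ≤ 2 * (3 + |τ| * (3 + |τ|)) := by linarith
        _ ≤ 2 * (3 + (M * r) * (3 + M * r)) := by gcongr
        _ ≤ 12 * (M * r) ^ 2 := by nlinarith
        _ = 12 * M ^ 2 * r ^ 2 := by ring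
    · intro ζ hζ
      have hζ0 : 0 ≤ ζ.re := by rw [hζ]; exact zero_le_one
      obtain ⟨h2, h3, h4⟩ := hn2 ζ hζ0
      set τ : ℝ := ζ.im * ((N + 1) / 2) with hτ
      have hζ' : ζ = 1 + (ζ.im : ℂ) * Complex.I := by apply Complex.ext <;> simp [hζ]
      have hexp : ζ * ((N + 1) / 2) - 1 = (N / 2 : ℂ) + (((-1 / 2 : ℝ) : ℂ) + (τ : ℂ) * Complex.I) := by
        rw [hζ', hτ]; push_cast; ring
      have hb := norm_integral_schrodingerForm_le ha (hF1 ζ) (hF2 ζ) (hG1 ζ) (hG2 ζ) τ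
      rw [← hexp, ← hΨeq] at hb
      have hsq : p * (1 + ζ.re) / 2 = p := by rw [hζ]; ring
      simp only [hFn ζ hζ0, hGn ζ hζ0, hsq, hfp, mul_one] at hb
      rw [hHn, div_le_iff₀ (by positivity)]
      have hτa : |τ| = |ζ.im| * ((N + 1) / 2) := by
        rw [hτ, abs_mul, abs_of_nonneg (by positivity : (0 : ℝ) ≤ (N + 1) / 2)]
      set r := ‖ζ + 2‖
      set M : ℝ := N + 1
      have hτy : |τ| ≤ M * r / 2 := by rw [hτa]; nlinarith
      have hMr : 2 ≤ M * r := by nlinarith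
      have hPn := norm_nonneg (Ψ ζ)
      calc ‖ζ‖ * ‖Ψ ζ‖ ≤ r * (12 + 8 * (M * r / 2)) := by gcongr; linarith
        _ ≤ r * (12 * (M * r)) := by gcongr; linarith
        _ = 12 * M * r ^ 2 := by ring
        _ ≤ 12 * M ^ 2 * r ^ 2 := by gcongr; nlinarith
  have hFθ : F θ = f := by
    ext x
    simp only [hF, hw]
    rw [show ((p : ℂ) * (1 + θ) / 2) = ((p * (1 + θ) / 2 : ℝ) : ℂ) by push_cast; ring, hp]
    simpa using phasePow_one (f x)
  have hGθ : G θ = f := by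
    ext x
    simp only [hG, hw]
    rw [show ((p : ℂ) * (1 + θ) / 2) = ((p * (1 + θ) / 2 : ℝ) : ℂ) by push_cast; ring, hp]
    simpa using phasePow_one (f x)
  have hΨθ := hΨeq θ
  rw [hFθ, hGθ] at hΨθ
  rw [← hΨθ, le_div_iff₀ hθ0]
  rw [hHn, div_le_iff₀ (pow_pos (two_pos.trans_le (hn2 θ (by simpa using hθ0.le)).1) 2)] at key
  have h3 : ‖(θ : ℂ) + 2‖ = θ + 2 := by
    rw [show (θ : ℂ) + 2 = ((θ + 2 : ℝ) : ℂ) by push_cast; rfl, Complex.norm_real,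
      Real.norm_of_nonneg (by linarith)]
  rw [h3, Complex.norm_real, Real.norm_of_nonneg hθ0.le] at key
  -- Undoing the factor θ/(θ + 2)² gives 12 · 9 = 108 and the division by θ.
  have : (θ + 2) ^ 2 ≤ 9 := by nlinarith
  calc ‖Ψ θ‖ * θ = θ * ‖Ψ θ‖ := mul_comm _ _
    _ ≤ 12 * (N + 1 : ℝ) ^ 2 * (θ + 2) ^ 2 := key
    _ ≤ 12 * (N + 1 : ℝ) ^ 2 * 9 := by gcongr
    _ = 108 * (N + 1 : ℝ) ^ 2 := by ring

theorem schrodingerForm_smul (s : ℝ) (c : ℂ) (f : V → ℂ) :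
    schrodingerForm s (fun x => c * f x) (fun x => c * f x) = (‖c‖ : ℂ) ^ 2 * schrodingerForm s f f := by
  have h : ∀ v, 𝓕 (fun x => c * f x) v = c * 𝓕 f v := fun v => by
    simp only [Real.fourier_eq]
    rw [← integral_const_mul]
    congr 1; ext x; simp only [Circle.smul_def, smul_eq_mul]; ring
  simp only [schrodingerForm, h]
  rw [← integral_const_mul]
  congr 1; ext v
  rw [map_mul, ← Complex.mul_conj']
  ring

/-- The interpolated estimate for simple functions. -/
theorem norm_integral_schrodingerForm_simpleFunc_le' {a : ℝ → ℝ} (ha : IsAmplitude a)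
    (f : SimpleFunc V ℂ) (hf : Integrable f) {p θ : ℝ} (hθ0 : 0 < θ) (hθ1 : θ ≤ 1)
    (hp : p * (1 + θ) / 2 = 1) :
    ‖∫ s in Set.Ioi 1, (a s : ℂ) * ((s : ℂ) ^ ((θ : ℂ) * ((Module.finrank ℝ V + 1) / 2 : ℂ) - 1) *
      schrodingerForm s f f)‖ ≤
      108 * (Module.finrank ℝ V + 1) ^ 2 / θ * (∫ x, ‖f x‖ ^ p) ^ (2 / p) := by
  have hp0 : 0 < p := by
    by_contra h
    nlinarith
  set A := ∫ x, ‖f x‖ ^ p with hA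
  have hA0 : 0 ≤ A := integral_nonneg fun x => by positivity
  have hfpi : Integrable fun x => ‖f x‖ ^ p := by
    have h1 : MemLp f (ENNReal.ofReal p) volume :=
      SimpleFunc.memLp_of_finite_measure_preimage _ fun y hy =>
        f.measure_preimage_lt_top_of_integrable hf hy
    simpa [ENNReal.toReal_ofReal hp0.le] using
      h1.integrable_norm_rpow (by simpa using hp0) ENNReal.ofReal_ne_top
  rcases hA0.eq_or_lt with h0 | hpos
  · have hz : f =ᵐ[volume] 0 := by
      have := (integral_eq_zero_iff_of_nonneg (fun x => by positivity) hfpi).1 h0.symm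
      filter_upwards [this] with x hx
      have := (Real.rpow_eq_zero (norm_nonneg _) hp0.ne').1 hx
      simpa using this
    have hF : ∀ v, 𝓕 (f : V → ℂ) v = 0 := fun v => by
      rw [Real.fourier_congr_ae hz]; simp [Real.fourier_eq]
    have : ∀ s, schrodingerForm s (f : V → ℂ) f = 0 := fun s => by simp [schrodingerForm, hF]
    simp only [this, mul_zero, integral_zero, norm_zero]
    positivity
  -- The scaling that normalises ∫ |tf|^p to 1; the form is quadratic, so undoing it costs t⁻² =
  -- A^(2/p).
  · set t : ℝ := A ^ (-(1 / p)) with ht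
    have ht0 : 0 < t := Real.rpow_pos_of_pos hpos _
    set g : SimpleFunc V ℂ := f.map (fun z => (t : ℂ) * z) with hg
    have hgx : ∀ x, g x = (t : ℂ) * f x := fun x => rfl
    have hgi : Integrable g := (hf.const_mul (t : ℂ)).congr (Eventually.of_forall fun x => by rw [hgx])
    have hgp : ∫ x, ‖g x‖ ^ p = 1 := by
      simp only [hgx, norm_mul, Complex.norm_real, Real.norm_of_nonneg ht0.le,
        Real.mul_rpow ht0.le (norm_nonneg _)]
      rw [integral_const_mul, ← hA, ht, ← Real.rpow_mul hA0,
        show -(1 / p) * p = -1 by field_simp, Real.rpow_neg_one, inv_mul_cancel₀ hpos.ne']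
    have key := norm_integral_schrodingerForm_simpleFunc_le ha g hgi hθ0 hθ1 hp hgp
    have hs : ∀ s, schrodingerForm s (g : V → ℂ) g = (t : ℂ) ^ 2 * schrodingerForm s (f : V → ℂ) f := by
      intro s
      have := schrodingerForm_smul s (t : ℂ) (f : V → ℂ)
      rw [Complex.norm_real, Real.norm_of_nonneg ht0.le] at this
      exact this
    have e : ∀ s : ℝ, (a s : ℂ) * ((s : ℂ) ^ ((θ : ℂ) * ((Module.finrank ℝ V + 1) / 2 : ℂ) - 1) *
      schrodingerForm s (g : V → ℂ) g) = (t : ℂ) ^ 2 * ((a s : ℂ) *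
        ((s : ℂ) ^ ((θ : ℂ) * ((Module.finrank ℝ V + 1) / 2 : ℂ) - 1) *
      schrodingerForm s (f : V → ℂ) f)) := fun s => by rw [hs]; ring
    simp only [e] at key
    rw [integral_const_mul, norm_mul, norm_pow, Complex.norm_real, Real.norm_of_nonneg ht0.le] at key
    have ht2 : A ^ (2 / p) * t ^ 2 = 1 := by
      rw [ht, ← Real.rpow_natCast, ← Real.rpow_mul hA0, ← Real.rpow_add hpos]
      norm_num [div_eq_mul_inv]
      rw [show 2 * p⁻¹ + -(p⁻¹ * 2) = 0 by ring, Real.rpow_zero]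
    have hAp : 0 < A ^ (2 / p) := Real.rpow_pos_of_pos hpos _
    calc _ = A ^ (2 / p) * (t ^ 2 * ‖∫ s in Set.Ioi 1, (a s : ℂ) *
          ((s : ℂ) ^ ((θ : ℂ) * ((Module.finrank ℝ V + 1) / 2 : ℂ) - 1) *
            schrodingerForm s (f : V → ℂ) f)‖) := by rw [← mul_assoc, ht2, one_mul]
      _ ≤ A ^ (2 / p) * (108 * (Module.finrank ℝ V + 1) ^ 2 / θ) := by gcongr
      _ = _ := mul_comm _ _

/-- The interpolated estimate. -/
theorem norm_integral_schrodingerForm_interpolation {a : ℝ → ℝ} (ha : IsAmplitude a)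
    {f : V → ℂ} (hfm : Measurable f) (hf : Integrable f) (hf2 : MemLp f 2) {p θ : ℝ} (hθ0 : 0 < θ)
    (hθ1 : θ ≤ 1) (hp : p * (1 + θ) / 2 = 1) (hfp : Integrable fun x => ‖f x‖ ^ p) :
    ‖∫ s in Set.Ioi 1, (a s : ℂ) * ((s : ℂ) ^ ((θ : ℂ) * ((Module.finrank ℝ V + 1) / 2 : ℂ) - 1) *
      schrodingerForm s f f)‖ ≤
      108 * (Module.finrank ℝ V + 1) ^ 2 / θ * (∫ x, ‖f x‖ ^ p) ^ (2 / p) := by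
  have hp0 : 0 < p := by
    by_contra h
    nlinarith
  set z : ℂ := (θ : ℂ) * ((Module.finrank ℝ V + 1) / 2 : ℂ) - 1 with hz
  -- These simple functions converge pointwise and satisfy |F k| ≤ 2|f|, so a single approximation
  -- serves the L¹, L² and L^p limits by dominated convergence.
  set F : ℕ → SimpleFunc V ℂ := fun k => SimpleFunc.approxOn f hfm Set.univ 0 trivial k with hF
  have hFb : ∀ k x, ‖F k x‖ ≤ 2 * ‖f x‖ := fun k x => by
    have := SimpleFunc.norm_approxOn_zero_le hfm (s := Set.univ) trivial x k
    simp only [hF]; linarith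
  have hFt : ∀ x, Tendsto (fun k => F k x) atTop (𝓝 (f x)) := fun x =>
    SimpleFunc.tendsto_approxOn hfm (Set.mem_univ _) (by simp)
  have hFi : ∀ k, Integrable (F k) := fun k => (hf.norm.const_mul 2).mono'
    (F k).aestronglyMeasurable (Eventually.of_forall (hFb k))
  have hF2 : ∀ k, MemLp (F k) 2 := fun k => (hf2.norm.const_mul 2).of_le
    (F k).aestronglyMeasurable (Eventually.of_forall fun x => by
      simpa using hFb k x)
  have hconj : Integrable (fun x => (starRingEnd ℂ) (f x)) :=
    (LinearIsometryEquiv.integrable_comp_iff (Complex.conjLIE : ℂ ≃ₗᵢ[ℝ] ℂ)).2 hf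
  have hprod : Integrable (fun q : V × V => f q.1 * (starRingEnd ℂ) (f q.2)) :=
    hf.mul_prod (ν := volume) hconj
  -- For fixed s the kernel formula has a unimodular phase, so domination by the product
  -- |f(x)||f(y)| is enough.
  have hlim : ∀ s : ℝ, 0 < s → Tendsto (fun k => schrodingerForm s (F k) (F k)) atTop
      (𝓝 (schrodingerForm s f f)) := by
    intro s hs
    simp only [fun k => schrodingerForm_eq_kernel (hFi k) (hF2 k) (hFi k) (hF2 k) hs,
      schrodingerForm_eq_kernel hf hf2 hf hf2 hs]
    refine Tendsto.const_mul _ ?_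
    refine tendsto_integral_of_dominated_convergence
      (fun q => 4 * ‖f q.1 * (starRingEnd ℂ) (f q.2)‖) ?_ (hprod.norm.const_mul 4) ?_ ?_
    · intro k
      refine Measurable.aestronglyMeasurable ?_
      have := (F k).measurable
      fun_prop
    · intro k
      refine Eventually.of_forall fun q => ?_
      rw [norm_mul, norm_mul, Complex.norm_exp_I_mul_ofReal, mul_one, RCLike.norm_conj, norm_mul,
        RCLike.norm_conj]
      calc ‖F k q.1‖ * ‖F k q.2‖ ≤ (2 * ‖f q.1‖) * (2 * ‖f q.2‖) := by
            gcongr <;> exact hFb k _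
        _ = _ := by ring
    · refine Eventually.of_forall fun q => ?_
      exact ((hFt q.1).mul ((Complex.continuous_conj.tendsto _).comp (hFt q.2))).mul_const _
  have hn2 : ∀ k, ∫ x, ‖F k x‖ ^ 2 ≤ 4 * ∫ x, ‖f x‖ ^ 2 := fun k => by
    rw [← integral_const_mul]
    refine integral_mono ((hF2 k).integrable_norm_pow (by norm_num))
      ((hf2.integrable_norm_pow (by norm_num)).const_mul 4) fun x => ?_
    have := hFb k x
    simp only
    nlinarith [norm_nonneg (F k x), norm_nonneg (f x)]
  have L : Tendsto (fun k => ∫ s in Set.Ioi 1, (a s : ℂ) * ((s : ℂ) ^ z *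
      schrodingerForm s (F k) (F k))) atTop
      (𝓝 (∫ s in Set.Ioi 1, (a s : ℂ) * ((s : ℂ) ^ z * schrodingerForm s f f))) := by
    refine tendsto_integral_of_dominated_convergence
      (fun s => ‖(a s : ℂ) * ((s : ℂ) ^ z * 1)‖ * (4 * ∫ x, ‖f x‖ ^ 2)) ?_ ?_ ?_ ?_
    · exact fun k => (ha.integrableOn_mul_cpow_mul
        (continuous_schrodingerForm (hFi k) (hF2 k) (hFi k) (hF2 k))
        (norm_schrodingerForm_le (hFi k) (hF2 k) (hFi k) (hF2 k)) z).aestronglyMeasurable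
    · exact ((ha.integrableOn_mul_cpow_mul continuous_const (C := 1) (fun _ => by simp) z).norm).mul_const _
    · intro k
      refine Eventually.of_forall fun s => ?_
      have h1 := norm_schrodingerForm_le (hFi k) (hF2 k) (hFi k) (hF2 k) s
      rw [norm_mul, norm_mul, norm_mul, norm_mul, norm_one, mul_one, ← mul_assoc]
      gcongr
      linarith [hn2 k]
    · filter_upwards [ae_restrict_mem measurableSet_Ioi] with s hs
      exact ((hlim s (zero_lt_one.trans hs)).const_mul _).const_mul _
  have Rt : Tendsto (fun k => 108 * (Module.finrank ℝ V + 1 : ℝ) ^ 2 / θ *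
      (∫ x, ‖F k x‖ ^ p) ^ (2 / p)) atTop (𝓝 (108 * (Module.finrank ℝ V + 1 : ℝ) ^ 2 / θ *
      (∫ x, ‖f x‖ ^ p) ^ (2 / p))) := by
    refine Tendsto.const_mul _ (Tendsto.rpow_const ?_ (Or.inr (by positivity)))
    refine tendsto_integral_of_dominated_convergence (fun x => 2 ^ p * ‖f x‖ ^ p) ?_
      (hfp.const_mul _) ?_ ?_
    · exact fun k => ((F k).measurable.norm.pow_const p).aestronglyMeasurable
    · intro k
      refine Eventually.of_forall fun x => ?_
      rw [Real.norm_of_nonneg (by positivity), ← Real.mul_rpow two_pos.le (norm_nonneg _)]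
      exact Real.rpow_le_rpow (norm_nonneg _) (hFb k x) hp0.le
    · exact Eventually.of_forall fun x => (hFt x).norm.rpow_const (Or.inr hp0.le)
  exact le_of_tendsto_of_tendsto L.norm Rt (Eventually.of_forall fun k =>
    norm_integral_schrodingerForm_simpleFunc_le' ha (F k) (hFi k) hθ0 hθ1 hp)

end Interpolation

/-! ### The weight, its cosine defect and the Poisson kernel -/

/-- The weight `(ε² + u²)^{-α}`. -/
noncomputable def resolventWeight (α ε u : ℝ) : ℝ := (ε ^ 2 + u ^ 2) ^ (-α)

/-- The function `∫ (1 - cos u) (s² + u²)^{-α} du`. -/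
noncomputable def cosDefect (α s : ℝ) : ℝ := ∫ u, (1 - Real.cos u) * resolventWeight α s u

theorem resolventWeight_nonneg (α ε u : ℝ) : 0 ≤ resolventWeight α ε u :=
  Real.rpow_nonneg (by positivity) _

theorem resolventWeight_neg (α ε u : ℝ) : resolventWeight α ε (-u) = resolventWeight α ε u := by
  simp [resolventWeight]

theorem resolventWeight_le {α ε : ℝ} (hα : 0 ≤ α) (hε : ε ≠ 0) (u : ℝ) :
    resolventWeight α ε u ≤ (ε ^ 2) ^ (-α) :=
  Real.rpow_le_rpow_of_nonpos (by positivity) (by nlinarith [sq_nonneg u]) (by linarith)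

/-- The point u = 0 is excluded because `0 ^ (-α)` is 0 for α ≠ 0, which breaks monotonicity at s =
0; applications hold almost everywhere. -/
theorem resolventWeight_anti {α s t u : ℝ} (hα : 0 ≤ α) (hs : 0 ≤ s) (hst : s ≤ t) (hu : u ≠ 0) :
    resolventWeight α t u ≤ resolventWeight α s u :=
  Real.rpow_le_rpow_of_nonpos (by positivity) (by gcongr) (by linarith)

theorem continuous_resolventWeight {α ε : ℝ} (hε : ε ≠ 0) : Continuous (resolventWeight α ε) :=
  Continuous.rpow_const (by fun_prop) fun u => Or.inl (by positivity)

theorem resolventWeight_eq_smul {α ε : ℝ} (hε : 0 < ε) (u : ℝ) :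
    resolventWeight α ε u = ε ^ (-(2 * α)) * (1 + (ε⁻¹ * u) ^ 2) ^ (-α) := by
  rw [resolventWeight, show ε ^ 2 + u ^ 2 = ε ^ 2 * (1 + (ε⁻¹ * u) ^ 2) by field_simp,
    Real.mul_rpow (by positivity) (by positivity)]
  congr 1
  rw [← Real.rpow_natCast, ← Real.rpow_mul hε.le]; congr 1; push_cast; ring

theorem integrable_one_add_sq_rpow {α : ℝ} (hα : 1 / 2 < α) :
    Integrable fun u : ℝ => (1 + u ^ 2) ^ (-α) := by
  have := integrable_rpow_neg_one_add_norm_sq (E := ℝ) (μ := volume) (r := 2 * α) (by simp; linarith)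
  refine this.congr (Eventually.of_forall fun u => ?_)
  simp only [Real.norm_eq_abs, sq_abs]; congr 1; ring

theorem integrable_resolventWeight {α ε : ℝ} (hα : 1 / 2 < α) (hε : 0 < ε) :
    Integrable (resolventWeight α ε) := by
  have := ((integrable_one_add_sq_rpow hα).comp_mul_left' (R := ε⁻¹) (by positivity)).const_mul
    (ε ^ (-(2 * α)))
  exact this.congr (Eventually.of_forall fun u => (resolventWeight_eq_smul hε u).symm)

theorem integral_resolventWeight {α ε : ℝ} (hε : 0 < ε) :
    ∫ u, resolventWeight α ε u = (∫ u : ℝ, (1 + u ^ 2) ^ (-α)) / ε ^ (2 * α - 1) := by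
  simp only [resolventWeight_eq_smul hε]
  rw [integral_const_mul, Measure.integral_comp_mul_left (fun u : ℝ => (1 + u ^ 2) ^ (-α)),
    inv_inv, abs_of_pos hε, smul_eq_mul, div_eq_mul_inv, ← Real.rpow_neg hε.le, ← mul_assoc]
  nth_rewrite 2 [← Real.rpow_one ε]
  rw [← Real.rpow_add hε, mul_comm]
  congr 2; ring

theorem measurable_resolventWeight_uncurry (α : ℝ) :
    Measurable fun q : ℝ × ℝ => resolventWeight α q.1 q.2 := by
  unfold resolventWeight; fun_prop

/-- Near 0, 1 - cos u ≤ u²/2 leaves |u|^(2-2α), integrable because α < 3/2; at infinity |u|^(-2α) is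
integrable because α > 1/2. This finiteness at ε = 0 is what makes the final constant independent of
ε. -/
theorem integrable_one_sub_cos_mul_zero {α : ℝ} (hα₁ : 1 / 2 < α) (hα₂ : α < 3 / 2) :
    Integrable fun u => (1 - Real.cos u) * resolventWeight α 0 u := by
  have hm : Measurable fun u => (1 - Real.cos u) * resolventWeight α 0 u := by
    unfold resolventWeight; fun_prop
  have hw : ∀ u : ℝ, 0 < u → resolventWeight α 0 u = u ^ (-(2 * α)) := fun u hu => by
    rw [resolventWeight, zero_pow two_ne_zero, zero_add, ← Real.rpow_natCast,
      ← Real.rpow_mul hu.le]; congr 1; push_cast; ring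
  have hc : ∀ u : ℝ, 0 ≤ 1 - Real.cos u := fun u => by linarith [Real.cos_le_one u]
  have h1 : IntegrableOn (fun u => (1 - Real.cos u) * resolventWeight α 0 u) (Set.Ioc 0 1) := by
    have hi : IntegrableOn (fun u : ℝ => u ^ (2 - 2 * α)) (Set.Ioc 0 1) :=
      (intervalIntegrable_iff_integrableOn_Ioc_of_le zero_le_one).1
        (intervalIntegral.intervalIntegrable_rpow' (by linarith))
    refine Integrable.mono' hi hm.aestronglyMeasurable ?_
    filter_upwards [ae_restrict_mem measurableSet_Ioc] with u hu
    rw [Real.norm_of_nonneg (mul_nonneg (hc u) (resolventWeight_nonneg _ _ _)), hw u hu.1,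
      sub_eq_add_neg 2, Real.rpow_add hu.1]
    refine mul_le_mul_of_nonneg_right ?_ (Real.rpow_nonneg hu.1.le _)
    rw [Real.rpow_two]
    have := Real.one_sub_sq_div_two_le_cos (x := u)
    nlinarith [sq_nonneg u]
  have h2 : IntegrableOn (fun u => (1 - Real.cos u) * resolventWeight α 0 u) (Set.Ioi 1) := by
    have hi : IntegrableOn (fun u : ℝ => 2 * u ^ (-(2 * α))) (Set.Ioi 1) :=
      (integrableOn_Ioi_rpow_of_lt (by linarith) one_pos).const_mul 2
    refine Integrable.mono' hi hm.aestronglyMeasurable ?_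
    filter_upwards [ae_restrict_mem measurableSet_Ioi] with u hu
    have hu0 : 0 < u := zero_lt_one.trans hu
    rw [Real.norm_of_nonneg (mul_nonneg (hc u) (resolventWeight_nonneg _ _ _)), hw u hu0]
    gcongr
    linarith [Real.neg_one_le_cos u]
  have h3 : IntegrableOn (fun u => (1 - Real.cos u) * resolventWeight α 0 u) (Set.Ioi 0) := by
    rw [← Set.Ioc_union_Ioi_eq_Ioi zero_le_one]; exact h1.union h2
  have h4 : IntegrableOn (fun u => (1 - Real.cos u) * resolventWeight α 0 u) (Set.Iic 0) := by
    have h := (Measure.measurePreserving_neg (volume : Measure ℝ)).integrableOn_comp_preimage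
      (Homeomorph.neg ℝ).measurableEmbedding (f := fun u => (1 - Real.cos u) * resolventWeight α 0 u)
      (s := Set.Ioi 0)
    rw [integrableOn_Iic_iff_integrableOn_Iio]
    refine IntegrableOn.congr_fun (f := (fun u => (1 - Real.cos u) * resolventWeight α 0 u) ∘ Neg.neg)
      ?_ (fun u _ => by simp [resolventWeight_neg]) measurableSet_Iio
    simpa using h.2 h3
  rw [← integrableOn_univ, ← Set.Iic_union_Ioi (a := (0 : ℝ))]
  exact h4.union h3

theorem ae_ne_zero_real : ∀ᵐ u : ℝ, u ≠ 0 := by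
  simp [ae_iff]

theorem integrable_one_sub_cos_mul {α : ℝ} (hα₁ : 1 / 2 < α) (hα₂ : α < 3 / 2) {s : ℝ} (hs : 0 ≤ s) :
    Integrable fun u => (1 - Real.cos u) * resolventWeight α s u := by
  refine (integrable_one_sub_cos_mul_zero hα₁ hα₂).mono'
    (Measurable.aestronglyMeasurable (by unfold resolventWeight; fun_prop)) ?_
  filter_upwards [ae_ne_zero_real] with u hu
  have hc : 0 ≤ 1 - Real.cos u := by linarith [Real.cos_le_one u]
  rw [Real.norm_of_nonneg (mul_nonneg hc (resolventWeight_nonneg _ _ _))]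
  gcongr
  exact resolventWeight_anti (by linarith) le_rfl hs hu

theorem cosDefect_nonneg (α s : ℝ) : 0 ≤ cosDefect α s :=
  integral_nonneg fun u => mul_nonneg (by simpa using Real.cos_le_one u)
    (resolventWeight_nonneg _ _ _)

/-- The weight decreases in its parameter and 1 - cos u ≥ 0. This monotonicity lets Bonnet's theorem
discard the dependence on ε. -/
theorem cosDefect_anti {α : ℝ} (hα₁ : 1 / 2 < α) (hα₂ : α < 3 / 2) {s t : ℝ} (hs : 0 ≤ s)
    (hst : s ≤ t) : cosDefect α t ≤ cosDefect α s := by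
  refine integral_mono_ae (integrable_one_sub_cos_mul hα₁ hα₂ (hs.trans hst))
    (integrable_one_sub_cos_mul hα₁ hα₂ hs) ?_
  filter_upwards [ae_ne_zero_real] with u hu
  have hc : 0 ≤ 1 - Real.cos u := by linarith [Real.cos_le_one u]
  gcongr
  exact resolventWeight_anti (by linarith) hs hst hu

theorem measurable_cosDefect (α : ℝ) : Measurable (cosDefect α) := by
  refine (StronglyMeasurable.integral_prod_right' (f := fun q : ℝ × ℝ => (1 - Real.cos q.2) *
    resolventWeight α q.1 q.2) ?_).measurable
  exact (((by fun_prop : Measurable fun q : ℝ × ℝ => 1 - Real.cos q.2)).mul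
    (measurable_resolventWeight_uncurry α)).stronglyMeasurable

/-- Rescaling u by s separates the growth s^(2α-1) from a factor that is bounded and decreasing in
s. -/
theorem integral_one_sub_cos_mul_resolventWeight (α ε : ℝ) {s : ℝ} (hs : 0 < s) :
    ∫ u, (1 - Real.cos (s * u)) * resolventWeight α ε u = s ^ (2 * α - 1) * cosDefect α (ε * s) := by
  have e : ∀ u, (1 - Real.cos (s * u)) * resolventWeight α ε u
      = s ^ (2 * α) * ((1 - Real.cos (s * u)) * resolventWeight α (ε * s) (s * u)) := fun u => by
    have : resolventWeight α ε u = s ^ (2 * α) * resolventWeight α (ε * s) (s * u) := by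
      rw [resolventWeight, resolventWeight, show (ε * s) ^ 2 + (s * u) ^ 2 = s ^ 2 * (ε ^ 2 + u ^ 2)
        by ring, Real.mul_rpow (by positivity) (by positivity), ← Real.rpow_natCast s,
        ← Real.rpow_mul hs.le, ← mul_assoc, ← Real.rpow_add hs]
      simp
    rw [this]; ring
  simp only [e]
  rw [integral_const_mul, Measure.integral_comp_mul_left
    (fun u => (1 - Real.cos u) * resolventWeight α (ε * s) u), abs_of_pos (inv_pos.2 hs),
    smul_eq_mul, ← mul_assoc, Real.rpow_sub_one hs.ne', div_eq_mul_inv]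
  rfl

/-- A product of two nonnegative decreasing factors; the exponential gives the decay and the
division by `cosDefect α 0` the normalisation. -/
theorem isAmplitude_exp_mul_cosDefect {α : ℝ} (hα₁ : 1 / 2 < α) (hα₂ : α < 3 / 2) {ε δ : ℝ}
    (hε : 0 < ε) (hδ : 0 < δ) :
    IsAmplitude fun s => Real.exp (-δ * s) * (cosDefect α (ε * s) / cosDefect α 0) := by
  have h1 : ∀ s ∈ Set.Ici (1 : ℝ), 0 ≤ cosDefect α (ε * s) / cosDefect α 0 := fun s _ =>
    div_nonneg (cosDefect_nonneg _ _) (cosDefect_nonneg _ _)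
  have h2 : ∀ s ∈ Set.Ici (1 : ℝ), cosDefect α (ε * s) / cosDefect α 0 ≤ 1 := fun s hs =>
    div_le_one_of_le₀ (cosDefect_anti hα₁ hα₂ le_rfl
      (mul_nonneg hε.le (zero_le_one.trans hs))) (cosDefect_nonneg _ _)
  have h3 : ∀ s ∈ Set.Ici (1 : ℝ), Real.exp (-δ * s) ≤ 1 := fun s hs => by
    rw [Real.exp_le_one_iff]; nlinarith [Set.mem_Ici.1 hs]
  refine ⟨?_, ?_, fun s hs => mul_nonneg (Real.exp_pos _).le (h1 s hs),
    fun s hs => mul_le_one₀ (h3 s hs) (h1 s hs) (h2 s hs), δ, hδ, ?_⟩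
  · exact (by fun_prop : Measurable fun s : ℝ => Real.exp (-δ * s)).mul
      (((measurable_cosDefect α).comp (measurable_const_mul ε)).div_const _)
  · intro s hs t ht hst
    have hs' := Set.mem_Ici.1 hs
    have : cosDefect α (ε * t) / cosDefect α 0 ≤ cosDefect α (ε * s) / cosDefect α 0 :=
      div_le_div_of_nonneg_right (cosDefect_anti hα₁ hα₂ (by positivity) (by gcongr))
        (cosDefect_nonneg _ _)
    exact mul_le_mul (Real.exp_le_exp.2 (by nlinarith)) this (h1 t ht) (Real.exp_pos _).le
  · refine Asymptotics.IsBigO.of_bound 1 ?_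
    filter_upwards [Ici_mem_atTop (1 : ℝ)] with s hs
    rw [norm_mul, Real.norm_of_nonneg (h1 s hs), one_mul]
    exact mul_le_of_le_one_right (norm_nonneg _) (h2 s hs)

/-- The (unnormalized) Poisson kernel of the half plane. -/
noncomputable def poissonKernelReal (δ l : ℝ) : ℝ := δ / (δ ^ 2 + l ^ 2)

theorem integrableOn_exp_neg_mul {δ : ℝ} (hδ : 0 < δ) :
    IntegrableOn (fun s => Real.exp (-δ * s)) (Set.Ioi 0) := by
  simpa using integrableOn_exp_mul_Ioi (a := -δ) (by linarith) 0

theorem integral_exp_mul_cos {δ : ℝ} (hδ : 0 < δ) (l : ℝ) :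
    ∫ s in Set.Ioi 0, Real.exp (-δ * s) * Real.cos (l * s) = poissonKernelReal δ l := by
  have hre : (-δ + l * Complex.I : ℂ).re < 0 := by simpa using hδ
  have h := integral_exp_mul_complex_Ioi hre 0
  have hi := integrableOn_exp_mul_complex_Ioi hre 0
  have e : ∀ s : ℝ, Real.exp (-δ * s) * Real.cos (l * s) =
      RCLike.re (Complex.exp ((-δ + l * Complex.I) * s)) := fun s => by
    rw [RCLike.re_to_complex, Complex.exp_re]; simp
  simp only [e]
  rw [integral_re hi, h]
  simp only [RCLike.re_to_complex, Complex.ofReal_zero, mul_zero, Complex.exp_zero]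
  rw [Complex.div_re]
  simp [Complex.normSq_apply, poissonKernelReal]
  rw [sq, sq]

theorem integrableOn_exp_mul_cos {δ : ℝ} (hδ : 0 < δ) (l : ℝ) :
    IntegrableOn (fun s => Real.exp (-δ * s) * Real.cos (l * s)) (Set.Ioi 0) :=
  (integrableOn_exp_neg_mul hδ).mul_bdd (c := 1)
    (by fun_prop) (Eventually.of_forall fun s => by
    rw [Real.norm_eq_abs]; exact Real.abs_cos_le_one _)

theorem poissonKernelReal_nonneg {δ : ℝ} (hδ : 0 < δ) (l : ℝ) : 0 ≤ poissonKernelReal δ l := by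
  unfold poissonKernelReal; positivity

theorem poissonKernelReal_le {δ : ℝ} (hδ : 0 < δ) (l : ℝ) : poissonKernelReal δ l ≤ δ⁻¹ := by
  unfold poissonKernelReal
  rw [div_le_iff₀ (by positivity), mul_add, sq δ, inv_mul_cancel_left₀ hδ.ne']
  have : 0 ≤ δ⁻¹ * l ^ 2 := by positivity
  linarith

theorem continuous_poissonKernelReal {δ : ℝ} (hδ : 0 < δ) : Continuous (poissonKernelReal δ) :=
  continuous_const.div (by fun_prop) fun l => by positivity

theorem integrable_resolventWeight_mul_poisson {α ε δ : ℝ} (hα : 1 / 2 < α) (hε : 0 < ε) (hδ : 0 < δ)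
    {k : ℝ → ℝ} (hk : Continuous k) :
    Integrable fun u => resolventWeight α ε u * poissonKernelReal δ (k u) :=
  (integrable_resolventWeight hα hε).mul_bdd (c := δ⁻¹)
    ((continuous_poissonKernelReal hδ).comp hk).aestronglyMeasurable
    (Eventually.of_forall fun u => by
      rw [Real.norm_of_nonneg (poissonKernelReal_nonneg hδ _)]; exact poissonKernelReal_le hδ _)

/-- The cosine transform of the defect of the weight, damped by `e^{-δs}`. -/
theorem integral_exp_mul_defect_mul_cos {α ε δ : ℝ} (hα : 1 / 2 < α) (hε : 0 < ε) (hδ : 0 < δ)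
    (l : ℝ) :
    ∫ s in Set.Ioi 0, Real.exp (-δ * s) * (∫ u, (1 - Real.cos (s * u)) * resolventWeight α ε u) *
      Real.cos (l * s) = (∫ u, resolventWeight α ε u) * poissonKernelReal δ l -
        ∫ u, resolventWeight α ε u * poissonKernelReal δ (l - u) := by
  have hw := integrable_resolventWeight hα hε
  have hprod : Integrable (fun q : ℝ × ℝ => Real.exp (-δ * q.1) * resolventWeight α ε q.2 *
      ((1 - Real.cos (q.1 * q.2)) * Real.cos (l * q.1)))
      ((volume.restrict (Set.Ioi 0)).prod volume) :=
    (Integrable.mul_prod (integrableOn_exp_neg_mul hδ) hw).mul_bdd (c := 2)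
      (by fun_prop) (Eventually.of_forall fun q => by
        rw [norm_mul, Real.norm_eq_abs, Real.norm_eq_abs]
        have h1 : |1 - Real.cos (q.1 * q.2)| ≤ 2 := by
          rw [abs_le]; constructor <;> linarith [Real.cos_le_one (q.1 * q.2), Real.neg_one_le_cos (q.1 * q.2)]
        calc _ ≤ 2 * 1 := mul_le_mul h1 (Real.abs_cos_le_one _) (abs_nonneg _) zero_le_two
          _ = 2 := mul_one 2)
  calc _ = ∫ s in Set.Ioi 0, ∫ u, Real.exp (-δ * s) * resolventWeight α ε u *
      ((1 - Real.cos (s * u)) * Real.cos (l * s)) := by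
        congr 1; ext s
        rw [mul_right_comm, ← integral_const_mul]
        congr 1; ext u; ring
    _ = ∫ u, ∫ s in Set.Ioi 0, Real.exp (-δ * s) * resolventWeight α ε u *
      ((1 - Real.cos (s * u)) * Real.cos (l * s)) := integral_integral_swap hprod
    -- Product-to-sum turns cos(su) cos(ls) into frequencies l - u and l + u, each giving a Poisson
    -- kernel; the two contributions agree because the weight is even.
    _ = ∫ u, (resolventWeight α ε u * poissonKernelReal δ l -
        (resolventWeight α ε u * poissonKernelReal δ (l - u) +
        resolventWeight α ε u * poissonKernelReal δ (l + u)) / 2) := by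
        congr 1; ext u
        have e : ∀ s, Real.exp (-δ * s) * resolventWeight α ε u *
            ((1 - Real.cos (s * u)) * Real.cos (l * s)) = resolventWeight α ε u *
            (Real.exp (-δ * s) * Real.cos (l * s)) - (resolventWeight α ε u *
            (Real.exp (-δ * s) * Real.cos ((l - u) * s)) + resolventWeight α ε u *
            (Real.exp (-δ * s) * Real.cos ((l + u) * s))) / 2 := fun s => by
          rw [sub_mul l u s, add_mul l u s, Real.cos_sub, Real.cos_add, mul_comm s u]; ring
        simp only [e]
        have i1 := (integrableOn_exp_mul_cos hδ l).const_mul (resolventWeight α ε u)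
        have i2 := (integrableOn_exp_mul_cos hδ (l - u)).const_mul (resolventWeight α ε u)
        have i3 := (integrableOn_exp_mul_cos hδ (l + u)).const_mul (resolventWeight α ε u)
        rw [integral_sub i1 (Integrable.div_const (Integrable.fun_add i2 i3) 2), integral_div, integral_add i2 i3,
          integral_const_mul, integral_const_mul, integral_const_mul, integral_exp_mul_cos hδ,
          integral_exp_mul_cos hδ, integral_exp_mul_cos hδ]
    _ = _ := by
        have j1 := integrable_resolventWeight_mul_poisson hα hε hδ (k := fun _ => l) continuous_const
        have j2 := integrable_resolventWeight_mul_poisson hα hε hδ (k := fun u => l - u) (by fun_prop)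
        have j3 := integrable_resolventWeight_mul_poisson hα hε hδ (k := fun u => l + u) (by fun_prop)
        rw [integral_sub j1 (Integrable.div_const (Integrable.fun_add j2 j3) 2), integral_div, integral_add j2 j3,
          integral_mul_const]
        have : ∫ u, resolventWeight α ε u * poissonKernelReal δ (l + u)
            = ∫ u, resolventWeight α ε u * poissonKernelReal δ (l - u) := by
          rw [← integral_neg_eq_self]
          simp only [resolventWeight_neg, sub_eq_add_neg]
        rw [this]; ring

/-- With u = l - δt the kernel becomes 1/(1 + t²), of total mass π, against a bounded continuous
function. The uniform bound is the domination for the later integral in ξ. -/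
theorem tendsto_integral_resolventWeight_mul_poisson {α ε : ℝ} (hα : 0 ≤ α) (hε : 0 < ε) (l : ℝ) :
    Tendsto (fun δ => ∫ u, resolventWeight α ε u * poissonKernelReal δ (l - u)) (𝓝[>] 0)
      (𝓝 (Real.pi * resolventWeight α ε l)) ∧ ∀ δ, 0 < δ →
      ‖∫ u, resolventWeight α ε u * poissonKernelReal δ (l - u)‖ ≤ Real.pi * (ε ^ 2) ^ (-α) := by
  have e : ∀ δ, 0 < δ → ∫ u, resolventWeight α ε u * poissonKernelReal δ (l - u)
      = ∫ t, resolventWeight α ε (l - δ * t) * (1 + t ^ 2)⁻¹ := by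
    intro δ hδ
    rw [← integral_sub_left_eq_self _ volume l]
    have := Measure.integral_comp_mul_left
      (fun u => resolventWeight α ε (l - u) * poissonKernelReal δ (l - (l - u))) δ
    rw [abs_of_pos (inv_pos.2 hδ), smul_eq_mul, eq_inv_mul_iff_mul_eq₀ hδ.ne',
      ← integral_const_mul] at this
    rw [← this]
    congr 1; ext t
    simp only [poissonKernelReal]
    have : (0 : ℝ) < 1 + t ^ 2 := by positivity
    field_simp
    ring_nf
  constructor
  · have L : Tendsto (fun δ => ∫ t, resolventWeight α ε (l - δ * t) * (1 + t ^ 2)⁻¹) (𝓝[>] 0)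
        (𝓝 (∫ t : ℝ, resolventWeight α ε l * (1 + t ^ 2)⁻¹)) := by
      have hc := continuous_resolventWeight (α := α) hε.ne'
      refine tendsto_integral_filter_of_dominated_convergence
        (fun t => (ε ^ 2) ^ (-α) * (1 + t ^ 2)⁻¹) ?_ ?_ (integrable_inv_one_add_sq.const_mul _) ?_
      · refine Eventually.of_forall fun δ => Measurable.aestronglyMeasurable ?_
        exact (hc.measurable.comp (by fun_prop)).mul (by fun_prop)
      · refine Eventually.of_forall fun δ => Eventually.of_forall fun t => ?_
        rw [norm_mul, Real.norm_of_nonneg (resolventWeight_nonneg _ _ _),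
          Real.norm_of_nonneg (by positivity : (0 : ℝ) ≤ (1 + t ^ 2)⁻¹)]
        gcongr
        exact resolventWeight_le hα hε.ne' _
      · refine Eventually.of_forall fun t => Tendsto.mul_const _ ?_
        have : Tendsto (fun δ : ℝ => l - δ * t) (𝓝[>] 0) (𝓝 l) := by
          have h : Continuous fun δ : ℝ => l - δ * t := by fun_prop
          simpa using (h.tendsto 0).mono_left nhdsWithin_le_nhds
        exact (hc.tendsto l).comp this
    rw [integral_const_mul, integral_univ_inv_one_add_sq, mul_comm] at L
    refine L.congr' ?_
    filter_upwards [self_mem_nhdsWithin] with δ hδ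
    exact (e δ hδ).symm
  · intro δ hδ
    rw [e δ hδ]
    calc _ ≤ ∫ t : ℝ, (ε ^ 2) ^ (-α) * (1 + t ^ 2)⁻¹ := by
          refine norm_integral_le_of_norm_le (integrable_inv_one_add_sq.const_mul _)
            (Eventually.of_forall fun t => ?_)
          rw [norm_mul, Real.norm_of_nonneg (resolventWeight_nonneg _ _ _),
            Real.norm_of_nonneg (by positivity : (0 : ℝ) ≤ (1 + t ^ 2)⁻¹)]
          gcongr
          exact resolventWeight_le hα hε.ne' _
      _ = _ := by rw [integral_const_mul, integral_univ_inv_one_add_sq, mul_comm]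

/-! ### Polar coordinates and concentration on the sphere -/

section Polar

variable {V : Type*} [NormedAddCommGroup V] [InnerProductSpace ℝ V] [FiniteDimensional ℝ V]
  [MeasurableSpace V] [BorelSpace V]

/-- Integration in polar coordinates. -/
theorem integral_eq_integral_Ioi_toSphere [Nontrivial V] {f : V → ℝ} (hf : Integrable f) :
    ∫ x, f x = ∫ r in Set.Ioi (0 : ℝ), r ^ (Module.finrank ℝ V - 1) *
      ∫ ω : Metric.sphere (0 : V) 1, f (r • (ω : V)) ∂(volume : Measure V).toSphere := by
  set μ : Measure V := volume
  set g : Metric.sphere (0 : V) 1 × Set.Ioi (0 : ℝ) → ℝ := fun q => f ((q.2 : ℝ) • (q.1 : V)) with hg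
  have hgx : ∀ x : ({0}ᶜ : Set V), g (homeomorphUnitSphereProd V x) = f x := fun x => by
    have : ‖(x : V)‖ ≠ 0 := norm_ne_zero_iff.2 x.2
    simp [hg, smul_smul, this]
  have hemb := (homeomorphUnitSphereProd V).measurableEmbedding
  have hmp := μ.measurePreserving_homeomorphUnitSphereProd
  have hgi : Integrable g (μ.toSphere.prod (.volumeIoiPow (Module.finrank ℝ V - 1))) := by
    rw [← hmp.integrable_comp_emb hemb]
    have : Integrable (f ∘ (Subtype.val : ({0}ᶜ : Set V) → V)) (μ.comap Subtype.val) :=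
      (integrableOn_iff_comap_subtypeVal (measurableSet_singleton _).compl).1 hf.integrableOn
    exact this.congr (Eventually.of_forall fun x => (hgx x).symm)
  calc ∫ x, f x = ∫ x : ({0}ᶜ : Set V), f x ∂(μ.comap (↑)) := by
        rw [integral_subtype_comap (measurableSet_singleton _).compl f,
          restrict_compl_singleton]
    _ = ∫ q, g q ∂μ.toSphere.prod (.volumeIoiPow (Module.finrank ℝ V - 1)) := by
        rw [← hmp.integral_comp hemb]
        simp only [hgx]
    _ = ∫ r : Set.Ioi (0 : ℝ), ∫ ω, f ((r : ℝ) • (ω : V)) ∂μ.toSphere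
        ∂.volumeIoiPow (Module.finrank ℝ V - 1) := integral_prod_symm g hgi
    _ = _ := by
        simp only [Measure.volumeIoiPow, ENNReal.ofReal]
        rw [integral_withDensity_eq_integral_smul,
          integral_subtype_comap measurableSet_Ioi fun a : ℝ =>
            Real.toNNReal (a ^ (Module.finrank ℝ V - 1)) •
              ∫ ω : Metric.sphere (0 : V) 1, f (a • (ω : V)) ∂μ.toSphere,
          setIntegral_congr_fun measurableSet_Ioi fun x hx => ?_]
        · rw [NNReal.smul_def, Real.coe_toNNReal _ (pow_nonneg (Set.mem_Ioi.1 hx).le _), smul_eq_mul]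
        · exact (measurable_subtype_coe.pow_const _).real_toNNReal

theorem continuous_sphereIntegral {h : V → ℝ} (hc : Continuous h) {C : ℝ} (hC : ∀ x, ‖h x‖ ≤ C) :
    Continuous fun r : ℝ => ∫ ω : Metric.sphere (0 : V) 1, h (r • (ω : V))
      ∂(volume : Measure V).toSphere :=
  continuous_of_dominated (bound := fun _ => C)
    (fun r => (by fun_prop : Continuous fun ω : Metric.sphere (0 : V) 1 =>
      h (r • (ω : V))).aestronglyMeasurable) (fun r => Eventually.of_forall fun ω => hC _)
    (integrable_const C) (Eventually.of_forall fun ω => by fun_prop)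

/-- The Poisson kernel in `1 - |ξ|²` concentrates on half the surface measure of the sphere. -/
theorem tendsto_integral_mul_poissonKernelReal [Nontrivial V] {h : V → ℝ} (hc : Continuous h)
    (hs : HasCompactSupport h) :
    Tendsto (fun δ => ∫ ξ, h ξ * poissonKernelReal δ (1 - ‖ξ‖ ^ 2)) (𝓝[>] 0)
      (𝓝 (Real.pi / 2 * ∫ ω : Metric.sphere (0 : V) 1, h ω ∂(volume : Measure V).toSphere)) := by
  obtain ⟨C, hC⟩ := hs.exists_bound_of_continuous hc
  set H : ℝ → ℝ := fun r => ∫ ω : Metric.sphere (0 : V) 1, h (r • (ω : V))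
      ∂(volume : Measure V).toSphere with hH
  have hHc : Continuous H := continuous_sphereIntegral hc hC
  set N := Module.finrank ℝ V - 1
  obtain ⟨R, hR1, hR⟩ : ∃ R : ℝ, 1 ≤ R ∧ ∀ x : V, R < ‖x‖ → h x = 0 := by
    obtain ⟨R, hR⟩ := hs.isCompact.isBounded.exists_norm_le
    refine ⟨max 1 R, le_max_left _ _, fun x hx => ?_⟩
    by_contra hne
    exact absurd (hR x (subset_tsupport h hne)) (not_le.2 ((le_max_right _ _).trans_lt hx))
  have hHz : ∀ r, R < r → H r = 0 := fun r hr => by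
    have : ∀ ω : Metric.sphere (0 : V) 1, h (r • (ω : V)) = 0 := fun ω => hR _ (by
      rw [norm_smul, norm_eq_of_mem_sphere, mul_one, Real.norm_eq_abs]
      exact hr.trans_le (le_abs_self r))
    simp only [hH, this, integral_zero]
  obtain ⟨B, hB⟩ : ∃ B, ∀ r, 0 < r → ‖r ^ N * H r‖ ≤ B := by
    obtain ⟨B, hB⟩ := (isCompact_Icc (a := (0 : ℝ)) (b := R)).exists_bound_of_continuousOn
      (f := fun r => r ^ N * H r) (by fun_prop)
    refine ⟨max B 0, fun r hr => ?_⟩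
    rcases le_or_gt r R with h' | h'
    · exact (hB r ⟨hr.le, h'⟩).trans (le_max_left _ _)
    · rw [hHz r h']; simp
  have hB0 : 0 ≤ B := (norm_nonneg _).trans (hB 1 one_pos)
  -- Extension by zero to r ≤ 0, so that the substitution r = 1 + δt runs over the whole line. It
  -- turns 1 - r² into -δt(2 + δt).
  set P : ℝ → ℝ := Set.indicator (Set.Ioi 0) fun r => r ^ N * H r with hP
  have hPm : Measurable P := (by fun_prop : Measurable fun r => r ^ N * H r).indicator measurableSet_Ioi
  have hPb : ∀ r, ‖P r‖ ≤ B := fun r => by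
    by_cases hr : r ∈ Set.Ioi (0 : ℝ)
    · rw [hP, Set.indicator_of_mem hr]; exact hB r hr
    · rw [hP, Set.indicator_of_notMem hr]; simpa using hB0
  have e : ∀ δ, 0 < δ → ∫ ξ, h ξ * poissonKernelReal δ (1 - ‖ξ‖ ^ 2) =
      ∫ t, P (1 + δ * t) * (1 + (t * (2 + δ * t)) ^ 2)⁻¹ := by
    intro δ hδ
    have hcont : Continuous fun ξ : V => h ξ * poissonKernelReal δ (1 - ‖ξ‖ ^ 2) :=
      hc.mul ((continuous_poissonKernelReal hδ).comp (by fun_prop))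
    rw [integral_eq_integral_Ioi_toSphere (hcont.integrable_of_hasCompactSupport hs.mul_right)]
    have e1 : ∀ r ∈ Set.Ioi (0 : ℝ), r ^ N * ∫ ω : Metric.sphere (0 : V) 1, h (r • (ω : V)) *
        poissonKernelReal δ (1 - ‖r • (ω : V)‖ ^ 2) ∂(volume : Measure V).toSphere
        = (fun r => r ^ N * H r * poissonKernelReal δ (1 - r ^ 2)) r := fun r hr => by
      have : ∀ ω : Metric.sphere (0 : V) 1, ‖r • (ω : V)‖ = r := fun ω => by
        rw [norm_smul, norm_eq_of_mem_sphere, mul_one, Real.norm_of_nonneg (le_of_lt hr)]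
      simp only [this, integral_mul_const, hH]; ring
    rw [setIntegral_congr_fun measurableSet_Ioi e1, ← integral_indicator measurableSet_Ioi]
    have e2 : ∀ r, (Set.indicator (Set.Ioi 0) fun r => r ^ N * H r * poissonKernelReal δ (1 - r ^ 2)) r
        = P r * poissonKernelReal δ (1 - r ^ 2) := fun r => by
      by_cases hr : r ∈ Set.Ioi (0 : ℝ)
      · simp only [hP, Set.indicator_of_mem hr]
      · simp only [hP, Set.indicator_of_notMem hr, zero_mul]
    simp only [e2]
    rw [← integral_add_left_eq_self _ (1 : ℝ)]
    have := Measure.integral_comp_mul_left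
      (fun r => P (1 + r) * poissonKernelReal δ (1 - (1 + r) ^ 2)) δ
    rw [abs_of_pos (inv_pos.2 hδ), smul_eq_mul, eq_inv_mul_iff_mul_eq₀ hδ.ne',
      ← integral_const_mul] at this
    rw [← this]
    congr 1; ext t
    rw [mul_left_comm]
    congr 1
    simp only [poissonKernelReal]
    have : (0 : ℝ) < 1 + (t * (2 + δ * t)) ^ 2 := by positivity
    rw [show δ ^ 2 + (1 - (1 + δ * t) ^ 2) ^ 2 = δ ^ 2 * (1 + (t * (2 + δ * t)) ^ 2) by ring]
    field_simp
  have L : Tendsto (fun δ => ∫ t, P (1 + δ * t) * (1 + (t * (2 + δ * t)) ^ 2)⁻¹) (𝓝[>] 0)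
      (𝓝 (∫ t : ℝ, H 1 * (1 + (2 * t) ^ 2)⁻¹)) := by
    refine tendsto_integral_filter_of_dominated_convergence (fun t => B * (1 + t ^ 2)⁻¹) ?_ ?_
      (integrable_inv_one_add_sq.const_mul _) ?_
    · refine Eventually.of_forall fun δ => Measurable.aestronglyMeasurable ?_
      exact (hPm.comp (by fun_prop)).mul (by fun_prop)
    · refine Eventually.of_forall fun δ => Eventually.of_forall fun t => ?_
      by_cases hr : 1 + δ * t ∈ Set.Ioi (0 : ℝ)
      · rw [norm_mul, norm_inv]
        -- Where P is nonzero, 1 + δt > 0, hence 2 + δt ≥ 1; this yields a majorant independent of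
        -- δ.
        have h2 : 1 + t ^ 2 ≤ ‖1 + (t * (2 + δ * t)) ^ 2‖ := by
          rw [Real.norm_of_nonneg (by positivity)]
          have : 1 ≤ 2 + δ * t := by have := Set.mem_Ioi.1 hr; linarith
          have : 1 ≤ (2 + δ * t) ^ 2 := by nlinarith
          nlinarith [sq_nonneg t]
        have := hPb (1 + δ * t)
        gcongr
      · have : P (1 + δ * t) = 0 := by rw [hP, Set.indicator_of_notMem hr]
        rw [this]; simp; positivity
    · refine Eventually.of_forall fun t => ?_
      have hto : Tendsto (fun δ : ℝ => 1 + δ * t) (𝓝[>] 0) (𝓝 1) := by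
        have h : Continuous fun δ : ℝ => 1 + δ * t := by fun_prop
        simpa using (h.tendsto 0).mono_left nhdsWithin_le_nhds
      refine Tendsto.mul ?_ ?_
      · have hev : ∀ᶠ r in 𝓝 (1 : ℝ), r ^ N * H r = P r := by
          filter_upwards [Ioi_mem_nhds (zero_lt_one' ℝ)] with r hr
          rw [hP, Set.indicator_of_mem hr]
        have h1 : Tendsto P (𝓝 1) (𝓝 (H 1)) := by
          have : Continuous fun r => r ^ N * H r := by fun_prop
          simpa using (this.tendsto 1).congr' hev
        exact h1.comp hto
      · have h : Continuous fun δ : ℝ => (1 + (t * (2 + δ * t)) ^ 2)⁻¹ :=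
          Continuous.inv₀ (by fun_prop) fun δ => by positivity
        have := (h.tendsto 0).mono_left (nhdsWithin_le_nhds (s := Set.Ioi 0))
        simpa [mul_comm t 2] using this
  -- The 2t is the derivative of 1 - r² at r = 1 in absolute value; it produces the half in C_α.
  have hI : ∫ t : ℝ, H 1 * (1 + (2 * t) ^ 2)⁻¹ = Real.pi / 2 *
      ∫ ω : Metric.sphere (0 : V) 1, h ω ∂(volume : Measure V).toSphere := by
    rw [integral_const_mul, Measure.integral_comp_mul_left (fun t : ℝ => (1 + t ^ 2)⁻¹),
      integral_univ_inv_one_add_sq]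
    simp only [hH, one_smul]
    norm_num; ring
  rw [hI] at L
  refine L.congr' ?_
  filter_upwards [self_mem_nhdsWithin] with δ hδ
  exact (e δ hδ).symm

theorem norm_integral_one_sub_cos_le {α ε : ℝ} (hα : 1 / 2 < α) (hε : 0 < ε) (s : ℝ) :
    ‖∫ u, (1 - Real.cos (s * u)) * resolventWeight α ε u‖ ≤ 2 * ∫ u, resolventWeight α ε u := by
  rw [← integral_const_mul]
  refine norm_integral_le_of_norm_le ((integrable_resolventWeight hα hε).const_mul 2)
    (Eventually.of_forall fun u => ?_)
  rw [norm_mul, Real.norm_of_nonneg (resolventWeight_nonneg _ _ _)]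
  have := resolventWeight_nonneg α ε u
  gcongr
  rw [Real.norm_eq_abs, abs_le]
  constructor <;> linarith [Real.cos_le_one (s * u), Real.neg_one_le_cos (s * u)]

/-- Reduction of the weighted defect to the damped oscillatory integrals. -/
theorem abs_integral_sub_sphere_le [Nontrivial V] {α ε K : ℝ} (hα : 1 / 2 < α) (hε : 0 < ε)
    {h : V → ℝ} (hc : Continuous h) (hs : HasCompactSupport h)
    (hK : ∀ δ, 0 < δ → |∫ s in Set.Ioi 0, Real.exp (-δ * s) *
      (∫ u, (1 - Real.cos (s * u)) * resolventWeight α ε u) *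
        ∫ ξ, h ξ * Real.cos ((1 - ‖ξ‖ ^ 2) * s)| ≤ K) :
    |(∫ ξ, h ξ * resolventWeight α ε (1 - ‖ξ‖ ^ 2)) - (∫ u, resolventWeight α ε u) / 2 *
      ∫ ω : Metric.sphere (0 : V) 1, h ω ∂(volume : Measure V).toSphere| ≤ K := by
  have hhi : Integrable h := hc.integrable_of_hasCompactSupport hs
  set W := ∫ u, resolventWeight α ε u with hW
  set σ := ∫ ω : Metric.sphere (0 : V) 1, h ω ∂(volume : Measure V).toSphere
  set D : ℝ → ℝ := fun s => ∫ u, (1 - Real.cos (s * u)) * resolventWeight α ε u with hD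
  have hDm : Measurable D := by
    refine (StronglyMeasurable.integral_prod_right' (f := fun q : ℝ × ℝ => (1 - Real.cos (q.1 * q.2)) *
      resolventWeight α ε q.2) ?_).measurable
    refine Measurable.stronglyMeasurable ?_
    have := (continuous_resolventWeight (α := α) hε.ne').measurable
    fun_prop
  have hpi : ∀ δ, 0 < δ → Integrable fun ξ : V => h ξ * poissonKernelReal δ (1 - ‖ξ‖ ^ 2) :=
    fun δ hδ => (hc.mul ((continuous_poissonKernelReal hδ).comp
      (by fun_prop))).integrable_of_hasCompactSupport hs.mul_right
  set Q : ℝ → ℝ → ℝ := fun δ l => ∫ u, resolventWeight α ε u * poissonKernelReal δ (l - u) with hQ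
  have hQb : ∀ l δ, 0 < δ → ‖Q δ l‖ ≤ Real.pi * (ε ^ 2) ^ (-α) := fun l =>
    (tendsto_integral_resolventWeight_mul_poisson (by linarith) hε l).2
  have hQm : ∀ δ, 0 < δ → Measurable (Q δ) := fun δ hδ => by
    refine (StronglyMeasurable.integral_prod_right' (f := fun q : ℝ × ℝ => resolventWeight α ε q.2 *
      poissonKernelReal δ (q.1 - q.2)) ?_).measurable
    refine Continuous.stronglyMeasurable ?_
    exact ((continuous_resolventWeight (α := α) hε.ne').comp continuous_snd).mul
      ((continuous_poissonKernelReal hδ).comp (by fun_prop))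
  have hQi : ∀ δ, 0 < δ → Integrable fun ξ : V => h ξ * Q δ (1 - ‖ξ‖ ^ 2) := fun δ hδ =>
    hhi.mul_bdd (c := Real.pi * (ε ^ 2) ^ (-α))
      ((hQm δ hδ).comp (by fun_prop)).aestronglyMeasurable (Eventually.of_forall fun ξ => hQb _ _ hδ)
  -- Fubini and the damped cosine transform at l = 1 - |ξ|². As δ → 0 the right side tends to π
  -- times (W/2) σ minus the weighted integral.
  have hid : ∀ δ, 0 < δ → ∫ s in Set.Ioi 0, Real.exp (-δ * s) * D s *
        ∫ ξ, h ξ * Real.cos ((1 - ‖ξ‖ ^ 2) * s) =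
      W * (∫ ξ, h ξ * poissonKernelReal δ (1 - ‖ξ‖ ^ 2)) - ∫ ξ, h ξ * Q δ (1 - ‖ξ‖ ^ 2) := by
    intro δ hδ
    have hed : IntegrableOn (fun s => Real.exp (-δ * s) * D s) (Set.Ioi 0) :=
      (integrableOn_exp_neg_mul hδ).mul_bdd (c := 2 * W) hDm.aestronglyMeasurable
        (Eventually.of_forall fun s => norm_integral_one_sub_cos_le hα hε s)
    have hprod : Integrable (fun q : ℝ × V => Real.exp (-δ * q.1) * D q.1 * h q.2 *
        Real.cos ((1 - ‖q.2‖ ^ 2) * q.1)) ((volume.restrict (Set.Ioi 0)).prod volume) :=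
      (Integrable.mul_prod hed hhi).mul_bdd (c := 1) (by fun_prop)
        (Eventually.of_forall fun q => by rw [Real.norm_eq_abs]; exact Real.abs_cos_le_one _)
    calc _ = ∫ s in Set.Ioi 0, ∫ ξ, Real.exp (-δ * s) * D s * h ξ * Real.cos ((1 - ‖ξ‖ ^ 2) * s) := by
          congr 1; ext s
          rw [← integral_const_mul]
          congr 1; ext ξ; ring
      _ = ∫ ξ, ∫ s in Set.Ioi 0, Real.exp (-δ * s) * D s * h ξ * Real.cos ((1 - ‖ξ‖ ^ 2) * s) :=
          integral_integral_swap hprod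
      _ = ∫ ξ, (W * (h ξ * poissonKernelReal δ (1 - ‖ξ‖ ^ 2)) - h ξ * Q δ (1 - ‖ξ‖ ^ 2)) := by
          congr 1; ext ξ
          have := integral_exp_mul_defect_mul_cos hα hε hδ (1 - ‖ξ‖ ^ 2)
          calc _ = h ξ * ∫ s in Set.Ioi 0, Real.exp (-δ * s) * D s * Real.cos ((1 - ‖ξ‖ ^ 2) * s) := by
                rw [← integral_const_mul]; congr 1; ext s; ring
            _ = _ := by rw [hD, this]; ring
      _ = _ := by
          rw [integral_sub ((hpi δ hδ).const_mul W) (hQi δ hδ), integral_const_mul]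
  have L1 := (tendsto_integral_mul_poissonKernelReal hc hs).const_mul W
  have L2 : Tendsto (fun δ => ∫ ξ, h ξ * Q δ (1 - ‖ξ‖ ^ 2)) (𝓝[>] 0)
      (𝓝 (∫ ξ, h ξ * (Real.pi * resolventWeight α ε (1 - ‖ξ‖ ^ 2)))) := by
    refine tendsto_integral_filter_of_dominated_convergence
      (fun ξ => ‖h ξ‖ * (Real.pi * (ε ^ 2) ^ (-α))) ?_ ?_ (hhi.norm.mul_const _) ?_
    · filter_upwards [self_mem_nhdsWithin] with δ hδ using (hQi δ hδ).aestronglyMeasurable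
    · filter_upwards [self_mem_nhdsWithin] with δ hδ
      refine Eventually.of_forall fun ξ => ?_
      rw [norm_mul]; gcongr; exact hQb _ _ hδ
    · exact Eventually.of_forall fun ξ =>
        (tendsto_integral_resolventWeight_mul_poisson (by linarith) hε _).1.const_mul _
  have hlim := (L1.sub L2).abs
  have hle := le_of_tendsto hlim (b := K) (by
    filter_upwards [self_mem_nhdsWithin] with δ hδ
    rw [← hid δ hδ]; exact hK δ hδ)
  have e : ∫ ξ, h ξ * (Real.pi * resolventWeight α ε (1 - ‖ξ‖ ^ 2))
      = Real.pi * ∫ ξ, h ξ * resolventWeight α ε (1 - ‖ξ‖ ^ 2) := by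
    rw [← integral_const_mul]; congr 1; ext ξ; ring
  rw [e] at hle
  set I := ∫ ξ, h ξ * resolventWeight α ε (1 - ‖ξ‖ ^ 2)
  have : W * (Real.pi / 2 * σ) - Real.pi * I = -(Real.pi * (I - W / 2 * σ)) := by ring
  rw [this, abs_neg, abs_mul, abs_of_pos Real.pi_pos] at hle
  -- The limit bounds π times the quantity by K; the gain of π is discarded.
  have := abs_nonneg (I - W / 2 * σ)
  nlinarith [Real.pi_gt_three]

end Polar

/-! ### Young's inequality -/

section Young

open scoped ENNReal

/-- Hölder for the measure k dμ, comparing the L¹ and L^p norms of a. -/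
theorem lintegral_mul_rpow_le {X : Type*} [MeasurableSpace X] {μ : Measure X} {a k : X → ℝ≥0∞}
    (ha : Measurable a) (hk : Measurable k) {p : ℝ} (hp : 1 ≤ p) :
    (∫⁻ y, a y * k y ∂μ) ^ p ≤ (∫⁻ y, k y ∂μ) ^ (p - 1) * ∫⁻ y, a y ^ p * k y ∂μ := by
  have hp0 : 0 < p := by linarith
  have h := eLpNorm'_le_eLpNorm'_mul_rpow_measure_univ (μ := μ.withDensity k) one_pos hp
    ha.aestronglyMeasurable
  simp only [eLpNorm', enorm_eq_self, ENNReal.rpow_one, div_one] at h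
  rw [withDensity_apply _ MeasurableSet.univ, Measure.restrict_univ,
    lintegral_withDensity_eq_lintegral_mul _ hk ha,
    lintegral_withDensity_eq_lintegral_mul _ hk (ha.pow_const p)] at h
  have h2 := ENNReal.rpow_le_rpow h hp0.le
  rw [ENNReal.mul_rpow_of_nonneg _ _ hp0.le, ← ENNReal.rpow_mul, ← ENNReal.rpow_mul,
    one_div_mul_cancel hp0.ne', ENNReal.rpow_one, sub_mul, one_mul, one_div_mul_cancel hp0.ne'] at h2
  simp only [Pi.mul_apply] at h2
  calc _ = (∫⁻ y, k y * a y ∂μ) ^ p := by simp only [mul_comm]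
    _ ≤ _ := h2
    _ = _ := by rw [mul_comm]; simp only [mul_comm (k _)]

variable {V : Type*} [NormedAddCommGroup V] [InnerProductSpace ℝ V] [FiniteDimensional ℝ V]
  [MeasurableSpace V] [BorelSpace V]

/-- Young's inequality for a convolution of nonnegative functions, with a bounded kernel. -/
theorem lintegral_rpow_le_of_le_convolution {a k u : V → ℝ≥0∞} (ha : Measurable a)
    (hk : Measurable k) (hu : Measurable u) {A S N : ℝ≥0∞} (hA : ∫⁻ y, k y = A) (hAtop : A ≠ ⊤)
    (hS : ∀ y, k y ≤ S) {p q : ℝ} (hp : 1 ≤ p) (hpq : p ≤ q) (hN : ∫⁻ y, a y ^ p = N ^ p)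
    (hle : ∀ x, u x ≤ ∫⁻ y, a y * k (x - y)) :
    ∫⁻ x, u x ^ q ≤ ((A ^ (p - 1) * S) ^ (1 / p)) ^ (q - p) * A ^ p * N ^ q := by
  have hp0 : 0 < p := by linarith
  have hpt : ∀ x, u x ^ p ≤ A ^ (p - 1) * ∫⁻ y, a y ^ p * k (x - y) := fun x => by
    refine (ENNReal.rpow_le_rpow (hle x) hp0.le).trans ?_
    have := lintegral_mul_rpow_le (μ := volume) ha
      (hk.comp (by fun_prop : Measurable fun y => x - y)) hp
    simp only [Function.comp_def] at this
    rwa [lintegral_sub_left_eq_self k x, hA] at this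
  have hsup : ∀ x, u x ≤ (A ^ (p - 1) * S) ^ (1 / p) * N := fun x => by
    have h1 : u x ^ p ≤ (A ^ (p - 1) * S) * N ^ p := by
      refine (hpt x).trans ?_
      rw [mul_assoc, ← hN, ← lintegral_const_mul _ (ha.pow_const p)]
      refine mul_le_mul_right (lintegral_mono fun y => ?_) _
      rw [mul_comm (a y ^ p)]
      gcongr
      exact hS _
    have h2 := ENNReal.rpow_le_rpow h1 (show 0 ≤ 1 / p by positivity)
    rwa [ENNReal.mul_rpow_of_nonneg _ _ (by positivity : 0 ≤ 1 / p), ← ENNReal.rpow_mul,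
      ← ENNReal.rpow_mul, mul_one_div_cancel hp0.ne', ENNReal.rpow_one, ENNReal.rpow_one] at h2
  have hLp : ∫⁻ x, u x ^ p ≤ A ^ p * N ^ p := by
    calc ∫⁻ x, u x ^ p ≤ ∫⁻ x, A ^ (p - 1) * ∫⁻ y, a y ^ p * k (x - y) :=
          lintegral_mono hpt
      _ = A ^ (p - 1) * ∫⁻ x, ∫⁻ y, a y ^ p * k (x - y) := by
          rw [lintegral_const_mul']
          exact ENNReal.rpow_ne_top_of_nonneg (by linarith) hAtop
      _ = A ^ (p - 1) * ∫⁻ y, ∫⁻ x, a y ^ p * k (x - y) := by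
          rw [lintegral_lintegral_swap]
          refine Measurable.aemeasurable ?_
          exact ((ha.comp measurable_snd).pow_const p).mul
            (hk.comp (by fun_prop : Measurable fun q : V × V => q.1 - q.2))
      _ = A ^ (p - 1) * ∫⁻ y, a y ^ p * A := by
          congr 2; ext y
          rw [lintegral_const_mul _ (show Measurable fun x => k (x - y) from
              hk.comp (by fun_prop : Measurable fun x => x - y)), lintegral_sub_right_eq_self k y, hA]
      _ = A ^ p * N ^ p := by
          rw [lintegral_mul_const _ (ha.pow_const p), hN, mul_comm (N ^ p), ← mul_assoc]
          congr 1
          nth_rewrite 2 [← ENNReal.rpow_one A]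
          rw [← ENNReal.rpow_add_of_nonneg _ _ (by linarith) zero_le_one, sub_add_cancel]
  -- The bounds L^p → L^∞ (from the bounded kernel) and L^p → L^p (from the integrable kernel)
  -- combine through u^q = u^(q-p) u^p.
  calc ∫⁻ x, u x ^ q ≤ ∫⁻ x, ((A ^ (p - 1) * S) ^ (1 / p) * N) ^ (q - p) * u x ^ p := by
        refine lintegral_mono fun x => ?_
        have : u x ^ q = u x ^ (q - p) * u x ^ p := by
          rw [← ENNReal.rpow_add_of_nonneg _ _ (by linarith) hp0.le, sub_add_cancel]
        rw [this]
        gcongr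
        exact hsup x
    _ = ((A ^ (p - 1) * S) ^ (1 / p) * N) ^ (q - p) * ∫⁻ x, u x ^ p :=
        lintegral_const_mul _ (hu.pow_const p)
    _ ≤ ((A ^ (p - 1) * S) ^ (1 / p) * N) ^ (q - p) * (A ^ p * N ^ p) := by gcongr
    _ = _ := by
        rw [ENNReal.mul_rpow_of_nonneg _ _ (by linarith : 0 ≤ q - p),
          mul_mul_mul_comm, ← ENNReal.rpow_add_of_nonneg _ _ (by linarith) hp0.le, sub_add_cancel]

/-- Young's inequality for convolution with a fixed Schwartz function. -/
theorem exists_integral_rpow_norm_convolution_le (ψ : SchwartzMap V ℂ) {p q : ℝ} (hp : 1 ≤ p)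
    (hpq : p ≤ q) : ∃ C : ℝ, 0 ≤ C ∧ ∀ φ F : SchwartzMap V ℂ,
      (∀ x, F x = ∫ y, φ y * ψ (x - y)) →
      ∫ x, ‖F x‖ ^ q ≤ C * (eLpNorm φ (ENNReal.ofReal p) volume).toReal ^ q := by
  have hp0 : 0 < p := by linarith
  have hq0 : 0 < q := by linarith
  obtain ⟨A, hA⟩ : ∃ A, ∫⁻ y, ‖ψ y‖ₑ = A := ⟨_, rfl⟩
  have hAtop : A ≠ ⊤ := hA ▸ ψ.integrable.2.ne
  obtain ⟨S, hS⟩ : ∃ S : ℝ, ∀ y, ‖ψ y‖ ≤ S := ⟨_, fun y => ψ.norm_le_seminorm ℝ y⟩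
  obtain ⟨c, hc⟩ : ∃ c, c = ((A ^ (p - 1) * ENNReal.ofReal S) ^ (1 / p)) ^ (q - p) * A ^ p := ⟨_, rfl⟩
  have hctop : c ≠ ⊤ := by
    rw [hc]
    refine ENNReal.mul_ne_top (ENNReal.rpow_ne_top_of_nonneg (by linarith)
      (ENNReal.rpow_ne_top_of_nonneg (by positivity) (ENNReal.mul_ne_top
        (ENNReal.rpow_ne_top_of_nonneg (by linarith) hAtop) ENNReal.ofReal_ne_top)))
      (ENNReal.rpow_ne_top_of_nonneg hp0.le hAtop)
  refine ⟨c.toReal, ENNReal.toReal_nonneg, fun φ F hF => ?_⟩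
  obtain ⟨N, hN⟩ : ∃ N, N = eLpNorm φ (ENNReal.ofReal p) volume := ⟨_, rfl⟩
  have hNp : ∫⁻ y, ‖φ y‖ₑ ^ p = N ^ p := by
    rw [hN, eLpNorm_eq_lintegral_rpow_enorm_toReal (by simpa using hp0) ENNReal.ofReal_ne_top,
      ENNReal.toReal_ofReal hp0.le, ← ENNReal.rpow_mul, one_div_mul_cancel hp0.ne', ENNReal.rpow_one]
  have hNtop : N ≠ ⊤ := by rw [hN]; exact (φ.memLp (ENNReal.ofReal p) volume).eLpNorm_ne_top
  have hfin : ∫⁻ x, ‖F x‖ₑ ^ q ≤ c * N ^ q := by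
    rw [hc]
    refine lintegral_rpow_le_of_le_convolution φ.continuous.enorm.measurable
      ψ.continuous.enorm.measurable F.continuous.enorm.measurable hA hAtop (fun y => ?_) hp hpq hNp
      fun x => ?_
    · rw [← ofReal_norm]
      exact ENNReal.ofReal_le_ofReal (hS _)
    · rw [hF]
      refine (enorm_integral_le_lintegral_enorm _).trans (le_of_eq ?_)
      simp only [enorm_mul]
  rw [integral_eq_lintegral_of_nonneg_ae (Eventually.of_forall fun x => Real.rpow_nonneg (norm_nonneg _) _)
    (F.continuous.norm.rpow_const fun _ => Or.inr hq0.le).aestronglyMeasurable]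
  have e : ∀ x, ENNReal.ofReal (‖F x‖ ^ q) = ‖F x‖ₑ ^ q := fun x => by
    rw [← ENNReal.ofReal_rpow_of_nonneg (norm_nonneg _) hq0.le, ofReal_norm]
  simp only [e]
  rw [← hN, ENNReal.toReal_rpow, ← ENNReal.toReal_mul]
  exact ENNReal.toReal_mono (ENNReal.mul_ne_top hctop
    (ENNReal.rpow_ne_top_of_nonneg hq0.le hNtop)) hfin

end Young

/-! ### The weighted estimate for compactly supported frequencies -/

section FourierHat

variable {n : ℕ}

theorem fourierHat_eq_fourier (f : EuclideanSpace ℝ (Fin n) → ℂ) (ξ : EuclideanSpace ℝ (Fin n)) :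
    fourierHat f ξ = 𝓕 f ((2 * Real.pi)⁻¹ • ξ) := by
  rw [fourierHat, Real.fourier_eq']
  congr 1; ext x
  rw [smul_eq_mul]
  congr 2
  rw [inner_smul_right, real_inner_comm]
  have := Real.pi_ne_zero
  push_cast
  have : (Real.pi : ℂ) ≠ 0 := by exact_mod_cast this
  field_simp

theorem continuous_fourierHat {f : EuclideanSpace ℝ (Fin n) → ℂ} (hf : Integrable f) :
    Continuous (fourierHat f) := by
  simp only [funext (fourierHat_eq_fourier f)]
  exact (continuous_fourier_of_integrable hf).comp (by fun_prop)

theorem integral_comp_two_pi_inv_smul {G : Type*} [NormedAddCommGroup G] [NormedSpace ℝ G]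
    (k : EuclideanSpace ℝ (Fin n) → G) :
    ∫ ξ, k ((2 * Real.pi)⁻¹ • ξ) = (2 * Real.pi) ^ n • ∫ v, k v := by
  have := Real.pi_pos
  rw [Measure.integral_comp_smul, finrank_euclideanSpace_fin, abs_of_pos (by positivity),
    inv_pow, inv_inv]

theorem integral_norm_sq_fourierHat {F : EuclideanSpace ℝ (Fin n) → ℂ} (h1 : Integrable F)
    (h2 : MemLp F 2) : ∫ ξ, ‖fourierHat F ξ‖ ^ 2 = (2 * Real.pi) ^ n * ∫ x, ‖F x‖ ^ 2 := by
  simp only [fourierHat_eq_fourier]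
  rw [integral_comp_two_pi_inv_smul fun v => ‖𝓕 F v‖ ^ 2, integral_norm_sq_fourier_of_integrable h1 h2,
    smul_eq_mul]

/-- With ξ = 2πv the symbol 1 - 4π²|v|² becomes 1 - |ξ|², and the squared modulus is real, so the
cosine is the real part of the propagator. This links the weight to the Schrödinger form. -/
theorem integral_norm_sq_fourierHat_mul_cos {F : EuclideanSpace ℝ (Fin n) → ℂ} (h1 : Integrable F)
    (h2 : MemLp F 2) (s : ℝ) : ∫ ξ, ‖fourierHat F ξ‖ ^ 2 * Real.cos ((1 - ‖ξ‖ ^ 2) * s) =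
      (2 * Real.pi) ^ n * (schrodingerForm s F F).re := by
  have hpi := Real.pi_pos
  have e : ∀ ξ : EuclideanSpace ℝ (Fin n), ‖fourierHat F ξ‖ ^ 2 * Real.cos ((1 - ‖ξ‖ ^ 2) * s) =
      (fun v => RCLike.re (𝓕 F v * (starRingEnd ℂ) (𝓕 F v) *
        Complex.exp (Complex.I * (1 - 4 * Real.pi ^ 2 * ‖v‖ ^ 2 : ℝ) * s)))
      ((2 * Real.pi)⁻¹ • ξ) := fun ξ => by
    have h3 : 4 * Real.pi ^ 2 * ‖(2 * Real.pi)⁻¹ • ξ‖ ^ 2 = ‖ξ‖ ^ 2 := by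
      rw [norm_smul, Real.norm_of_nonneg (by positivity)]
      field_simp; ring
    simp only [h3, Complex.mul_conj, fourierHat_eq_fourier, RCLike.re_eq_complex_re,
      Complex.re_ofReal_mul, Complex.normSq_eq_norm_sq]
    rw [show Complex.I * ((1 - ‖ξ‖ ^ 2 : ℝ) : ℂ) * s = (((1 - ‖ξ‖ ^ 2) * s : ℝ) : ℂ) * Complex.I by
      push_cast; ring, Complex.exp_ofReal_mul_I_re]
  rw [integral_congr_ae (Eventually.of_forall e), integral_comp_two_pi_inv_smul fun v =>
    RCLike.re (𝓕 F v * (starRingEnd ℂ) (𝓕 F v) *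
        Complex.exp (Complex.I * (1 - 4 * Real.pi ^ 2 * ‖v‖ ^ 2 : ℝ) * s)), smul_eq_mul, integral_re, schrodingerForm]
  · rfl
  · exact (integrable_fourier_mul_conj h1 h2 h1 h2).mul_bdd (c := 1) (by fun_prop)
      (Eventually.of_forall fun v => (norm_cexp_I_mul _ _).le)

/-- The weighted estimate for a function with compactly supported Fourier transform. -/
theorem abs_integral_fourierHat_sub_sphere_le {α : ℝ} (hα₁ : 1 / 2 < α) (hα₂ : α < 3 / 2)
    (hn : 2 ≤ n) {p θ : ℝ} (hθ : θ * (n + 1) = 4 * α) (hθ1 : θ ≤ 1) (hp : p * (1 + θ) / 2 = 1)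
    {F : EuclideanSpace ℝ (Fin n) → ℂ} (hFm : Measurable F) (h1 : Integrable F) (h2 : MemLp F 2)
    (hFp : Integrable fun x => ‖F x‖ ^ p) (hs : HasCompactSupport (fourierHat F)) {ε : ℝ}
    (hε : 0 < ε) :
    |(∫ ξ, ‖fourierHat F ξ‖ ^ 2 * resolventWeight α ε (1 - ‖ξ‖ ^ 2)) -
      (∫ u, resolventWeight α ε u) / 2 * ∫ ω, ‖fourierHat F ω‖ ^ 2 ∂(surfaceMeasure n)| ≤
      cosDefect α 0 * (2 * Real.pi) ^ n *
        ((∫ x, ‖F x‖ ^ 2) + 108 * ((n : ℝ) + 1) ^ 2 / θ * (∫ x, ‖F x‖ ^ p) ^ (2 / p)) := by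
  have hpi := Real.pi_pos
  have hθ0 : 0 < θ := by
    by_contra h
    have : θ * ((n : ℝ) + 1) ≤ 0 := mul_nonpos_of_nonpos_of_nonneg (not_lt.1 h) (by positivity)
    linarith
  have : Nontrivial (EuclideanSpace ℝ (Fin n)) := by
    have : Nonempty (Fin n) := ⟨⟨0, by omega⟩⟩
    infer_instance
  set M := cosDefect α 0 with hM
  have hM0 : 0 ≤ M := cosDefect_nonneg _ _
  have hcd : ∀ s, 0 ≤ s → cosDefect α (ε * s) ≤ M := fun s hs' =>
    cosDefect_anti hα₁ hα₂ le_rfl (by positivity)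
  refine abs_integral_sub_sphere_le hα₁ hε ((continuous_fourierHat h1).norm.pow 2)
    (hs.comp_left (g := fun z : ℂ => ‖z‖ ^ 2) (by simp)) fun δ hδ => ?_
  simp only [integral_norm_sq_fourierHat_mul_cos h1 h2]
  set D : ℝ → ℝ := fun s => ∫ u, (1 - Real.cos (s * u)) * resolventWeight α ε u with hD
  have hDs : ∀ s, 0 < s → D s = s ^ (2 * α - 1) * cosDefect α (ε * s) := fun s hs =>
    integral_one_sub_cos_mul_resolventWeight α ε hs
  have hbc := continuous_schrodingerForm h1 h2 h1 h2
  have hbn : ∀ s, ‖schrodingerForm s F F‖ ≤ ∫ x, ‖F x‖ ^ 2 := fun s => by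
    have := norm_schrodingerForm_le h1 h2 h1 h2 s
    linarith
  have hD' : ∀ s, 0 < s → 0 ≤ D s := fun s hs => by
    rw [hDs s hs]; have := cosDefect_nonneg α (ε * s); positivity
  have h_integ : IntegrableOn (fun s => Real.exp (-δ * s) * D s *
      ((2 * Real.pi) ^ n * (schrodingerForm s F F).re)) (Set.Ioi 0) := by
    have hDm : Measurable D := by
      refine (StronglyMeasurable.integral_prod_right' (f := fun q : ℝ × ℝ =>
        (1 - Real.cos (q.1 * q.2)) * resolventWeight α ε q.2) ?_).measurable
      refine Measurable.stronglyMeasurable ?_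
      have := (continuous_resolventWeight (α := α) hε.ne').measurable
      fun_prop
    refine (((integrableOn_exp_neg_mul hδ).mul_bdd hDm.aestronglyMeasurable
      (Eventually.of_forall fun s => norm_integral_one_sub_cos_le hα₁ hε s))).mul_bdd
      (c := (2 * Real.pi) ^ n * ∫ x, ‖F x‖ ^ 2)
      (continuous_const.mul (Complex.continuous_re.comp hbc)).aestronglyMeasurable
      (Eventually.of_forall fun s => ?_)
    rw [norm_mul, Real.norm_of_nonneg (by positivity)]
    gcongr
    exact (Complex.abs_re_le_norm _).trans (hbn s)
  -- Split at s = 1. For s ≤ 1, s^(2α-1) ≤ 1 because α > 1/2, and the L² bound on the form suffices;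
  -- s > 1 is the interpolated estimate.
  rw [← Set.Ioc_union_Ioi_eq_Ioi (zero_le_one' ℝ), setIntegral_union Set.Ioc_disjoint_Ioi_same
    measurableSet_Ioi (h_integ.mono_set Set.Ioc_subset_Ioi_self)
    (h_integ.mono_set (Set.Ioi_subset_Ioi zero_le_one))]
  refine (abs_add_le _ _).trans ?_
  rw [mul_add]
  refine add_le_add ?_ ?_
  · have := norm_setIntegral_le_of_norm_le_const (μ := volume) (s := Set.Ioc (0 : ℝ) 1)
      (f := fun s => Real.exp (-δ * s) * D s * ((2 * Real.pi) ^ n * (schrodingerForm s F F).re))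
      (C := M * (2 * Real.pi) ^ n * ∫ x, ‖F x‖ ^ 2) (by simp) (fun s hs => ?_)
    · simpa using this
    · rw [norm_mul, norm_mul, norm_mul, Real.norm_of_nonneg (Real.exp_pos _).le,
        Real.norm_of_nonneg (hD' s hs.1), Real.norm_of_nonneg (by positivity : 0 ≤ (2 * Real.pi) ^ n)]
      have e1 : Real.exp (-δ * s) ≤ 1 := by
        rw [Real.exp_le_one_iff]; have := mul_pos hδ hs.1; linarith
      have e2 : D s ≤ M := by
        rw [hDs s hs.1]
        have := Real.rpow_le_one hs.1.le hs.2 (by linarith : 0 ≤ 2 * α - 1)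
        have h0 := cosDefect_nonneg α (ε * s)
        have h3 := hcd s hs.1.le
        nlinarith
      have e3 : ‖(schrodingerForm s F F).re‖ ≤ ∫ x, ‖F x‖ ^ 2 :=
        (Complex.abs_re_le_norm _).trans (hbn s)
      have e4 : Real.exp (-δ * s) * D s ≤ M := by
        have := hD' s hs.1
        nlinarith [Real.exp_pos (-δ * s)]
      rw [mul_assoc M]
      have := hD' s hs.1
      gcongr
  · have ha := isAmplitude_exp_mul_cosDefect hα₁ hα₂ hε hδ
    have hI := norm_integral_schrodingerForm_interpolation ha hFm h1 h2 hθ0 hθ1 hp hFp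
    have hii := ha.integrableOn_mul_cpow_mul hbc hbn
      ((θ : ℂ) * ((Module.finrank ℝ (EuclideanSpace ℝ (Fin n)) + 1) / 2 : ℂ) - 1)
    rw [finrank_euclideanSpace_fin] at hI hii
    -- This matching of the interpolation power with the growth of D(s) dictates θ = 4α/(n + 1).
    have hz : (θ : ℂ) * (((n : ℕ) + 1) / 2 : ℂ) - 1 = ((2 * α - 1 : ℝ) : ℂ) := by
      have : (θ : ℂ) * ((n : ℂ) + 1) = 4 * α := by exact_mod_cast congrArg (fun x : ℝ => (x : ℂ)) hθ
      push_cast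
      linear_combination this / 2
    rw [hz] at hI hii
    have e : ∀ s ∈ Set.Ioi (1 : ℝ), Real.exp (-δ * s) * D s *
        ((2 * Real.pi) ^ n * (schrodingerForm s F F).re) = (fun s : ℝ => M * (2 * Real.pi) ^ n *
        RCLike.re (((Real.exp (-δ * s) * (cosDefect α (ε * s) / M) : ℝ) : ℂ) *
          ((s : ℂ) ^ ((2 * α - 1 : ℝ) : ℂ) * schrodingerForm s F F))) s := fun s hs => by
      have hs0 : (0 : ℝ) < s := zero_lt_one.trans hs
      -- Valid even if M = 0, since the numerator lies between 0 and M.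
      have e1 : cosDefect α (ε * s) = M * (cosDefect α (ε * s) / M) := by
        rw [mul_div_cancel_of_imp' fun hM' => ?_]
        exact le_antisymm ((hcd s hs0.le).trans hM'.le) (cosDefect_nonneg _ _)
      simp only
      rw [hDs s hs0, ← Complex.ofReal_cpow hs0.le, RCLike.re_eq_complex_re, Complex.re_ofReal_mul,
        Complex.re_ofReal_mul]
      nth_rewrite 1 [e1]
      ring
    rw [setIntegral_congr_fun measurableSet_Ioi e, integral_const_mul, integral_re hii, abs_mul,
      abs_of_nonneg (by positivity)]
    gcongr
    exact (RCLike.abs_re_le_norm _).trans hI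

end FourierHat

/-! ### Estimates for Schwartz functions -/

section APriori

variable {n : ℕ}

theorem isOpen_annulus (n : ℕ) : IsOpen (annulus n) :=
  isOpen_Ioo.preimage continuous_norm

theorem measurableSet_annulus (n : ℕ) : MeasurableSet (annulus n) :=
  (isOpen_annulus n).measurableSet

/-- Smooth frequency cutoff, realised by convolution with a Schwartz function. -/
theorem exists_frequency_cutoff (n : ℕ) : ∃ ψ : SchwartzMap (EuclideanSpace ℝ (Fin n)) ℂ,
    ∀ φ : SchwartzMap (EuclideanSpace ℝ (Fin n)) ℂ, ∃ F : SchwartzMap (EuclideanSpace ℝ (Fin n)) ℂ,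
      (∀ x, F x = ∫ y, φ y * ψ (x - y)) ∧
      (∀ ξ, ‖ξ‖ ≤ 3 / 2 → fourierHat F ξ = fourierHat φ ξ) ∧
      HasCompactSupport (fourierHat F) := by
  have hpi := Real.pi_pos
  -- In the variable ξ = 2πv the bump is 1 for |ξ| ≤ 3/2, covering both the annulus and the sphere,
  -- and it vanishes for |ξ| ≥ 2.
  let b : ContDiffBump (0 : EuclideanSpace ℝ (Fin n)) :=
    ⟨(2 * Real.pi)⁻¹ * (3 / 2), (2 * Real.pi)⁻¹ * 2, by positivity, by gcongr; norm_num⟩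
  have hbs : HasCompactSupport fun x => (b x : ℂ) :=
    b.hasCompactSupport.comp_left (g := fun t : ℝ => (t : ℂ)) rfl
  let B : SchwartzMap (EuclideanSpace ℝ (Fin n)) ℂ :=
    hbs.toSchwartzMap (Complex.ofRealCLM.contDiff.comp b.contDiff)
  have hB : ∀ x, B x = (b x : ℂ) := fun x => rfl
  refine ⟨𝓕⁻ B, fun φ => ⟨SchwartzMap.convolution (ContinuousLinearMap.mul ℂ ℂ) φ (𝓕⁻ B), ?_⟩⟩
  have hF : ∀ ξ, fourierHat (SchwartzMap.convolution (ContinuousLinearMap.mul ℂ ℂ) φ (𝓕⁻ B)) ξ =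
      fourierHat φ ξ * (b ((2 * Real.pi)⁻¹ • ξ) : ℂ) := fun ξ => by
    rw [fourierHat_eq_fourier, fourierHat_eq_fourier, ← SchwartzMap.fourier_coe,
      SchwartzMap.fourier_convolution, ← SchwartzMap.fourier_coe, ← hB]
    simp
  refine ⟨fun x => ?_, fun ξ hξ => ?_, ?_⟩
  · rw [SchwartzMap.convolution_apply]
    rfl
  · rw [hF, b.one_of_mem_closedBall, Complex.ofReal_one, mul_one]
    rw [mem_closedBall_zero_iff, norm_smul, Real.norm_of_nonneg (by positivity)]
    exact mul_le_mul_of_nonneg_left hξ (by positivity)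
  · have : HasCompactSupport fun ξ : EuclideanSpace ℝ (Fin n) => (b ((2 * Real.pi)⁻¹ • ξ) : ℂ) :=
      hbs.comp_homeomorph (Homeomorph.smulOfNeZero (2 * Real.pi)⁻¹ (by positivity))
    rw [funext hF]
    exact this.mul_left

theorem div_rpow_eq_mul_resolventWeight (α ε a u : ℝ) :
    a / (u ^ 2 + ε ^ 2) ^ α = a * resolventWeight α ε u := by
  rw [resolventWeight, add_comm, Real.rpow_neg (by positivity), div_eq_mul_inv]

/-- Away from the annulus the weight is bounded uniformly in `ε`. -/
theorem resolventWeight_le_of_notMem_annulus {α : ℝ} (hα : 0 ≤ α) (ε : ℝ)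
    {ξ : EuclideanSpace ℝ (Fin n)} (hξ : ξ ∉ annulus n) :
    resolventWeight α ε (1 - ‖ξ‖ ^ 2) ≤ (9 / 16) ^ (-α) := by
  refine Real.rpow_le_rpow_of_nonpos (by norm_num) ?_ (by linarith)
  -- 9/16 = (1 - 1/4)² comes from the inner radius; the outer radius gives the larger value (9/4 -
  -- 1)².
  have h : 9 / 16 ≤ (1 - ‖ξ‖ ^ 2) ^ 2 := by
    have h0 := norm_nonneg ξ
    rcases le_or_gt ‖ξ‖ (1 / 2) with h | h
    · have : 3 / 4 ≤ 1 - ‖ξ‖ ^ 2 := by nlinarith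
      nlinarith
    · have h2 : 3 / 2 ≤ ‖ξ‖ := not_lt.1 fun h' => hξ ⟨h, h'⟩
      have : 3 / 4 ≤ ‖ξ‖ ^ 2 - 1 := by nlinarith
      nlinarith
  nlinarith [sq_nonneg ε]

/-- The a priori estimates for Schwartz functions. -/
theorem exists_apriori_estimates {α : ℝ} (hα₁ : 1 / 2 < α) (hα₂ : α < 3 / 2)
    (hn : 2 ≤ n) {p : ℝ} (hp1 : 1 ≤ p) (hp : p ≤ (2 * (n : ℝ) + 2) / ((n : ℝ) + 1 + 4 * α)) :
    ∃ C K : ℝ, 0 ≤ C ∧ 0 ≤ K ∧ ∀ φ : SchwartzMap (EuclideanSpace ℝ (Fin n)) ℂ,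
      ∫ ξ in annulus n, ‖fourierHat φ ξ‖ ^ 2 ≤
        C * (eLpNorm φ (ENNReal.ofReal p) volume).toReal ^ 2 ∧
      ∀ ε : ℝ, 0 < ε → |(∫ ξ in annulus n, ‖fourierHat φ ξ‖ ^ 2 * resolventWeight α ε (1 - ‖ξ‖ ^ 2)) -
        (∫ u, resolventWeight α ε u) / 2 * ∫ ω, ‖fourierHat φ ω‖ ^ 2 ∂(surfaceMeasure n)| ≤
          K * (eLpNorm φ (ENNReal.ofReal p) volume).toReal ^ 2 := by
  have hpi := Real.pi_pos
  obtain ⟨ψ, hψ⟩ := exists_frequency_cutoff n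
  set p₀ : ℝ := (2 * (n : ℝ) + 2) / ((n : ℝ) + 1 + 4 * α) with hp₀
  set θ : ℝ := 4 * α / ((n : ℝ) + 1) with hθ
  have hden : (0 : ℝ) < (n : ℝ) + 1 + 4 * α := by positivity
  have hp₀2 : p₀ ≤ 2 := by rw [hp₀, div_le_iff₀ hden]; linarith
  have hp₀1 : 1 ≤ p₀ := hp1.trans hp
  have hp₀0 : 0 < p₀ := by linarith
  -- The inequality θ ≤ 1 is the same as p₀ ≥ 1, so it follows from 1 ≤ p ≤ p₀; for larger α the
  -- range of p is empty.
  have hθ1 : θ ≤ 1 := by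
    rw [hp₀, le_div_iff₀ hden] at hp₀1
    rw [hθ, div_le_one (by positivity)]
    linarith
  have hpθ : p₀ * (1 + θ) / 2 = 1 := by
    rw [hp₀, hθ]; field_simp
  -- Young is used twice, from L^p into L² and into L^(p₀): the former serves s ≤ 1 and the region
  -- off the annulus, the latter s > 1.
  obtain ⟨C₂, hC₂, h2⟩ := exists_integral_rpow_norm_convolution_le ψ hp1 (hp.trans hp₀2)
  obtain ⟨C₀, hC₀, h0⟩ := exists_integral_rpow_norm_convolution_le ψ hp1 hp
  set C : ℝ := (2 * Real.pi) ^ n * C₂ with hC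
  have hC0 : 0 ≤ C := by positivity
  have hM := cosDefect_nonneg α 0
  set K₁ : ℝ := cosDefect α 0 * (2 * Real.pi) ^ n *
    (C₂ + 108 * ((n : ℝ) + 1) ^ 2 / θ * C₀ ^ (2 / p₀)) with hK₁
  have hθ0 : 0 < θ := by positivity
  refine ⟨C, K₁ + (9 / 16) ^ (-α) * C, hC0, by positivity, fun φ => ?_⟩
  obtain ⟨F, hF, hFφ, hFs⟩ := hψ φ
  set N := (eLpNorm φ (ENNReal.ofReal p) volume).toReal with hN
  have hN0 : 0 ≤ N := ENNReal.toReal_nonneg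
  have hF2 : ∫ x, ‖F x‖ ^ 2 ≤ C₂ * N ^ 2 := by simpa using h2 φ F hF
  have hFp : ∫ x, ‖F x‖ ^ p₀ ≤ C₀ * N ^ p₀ := h0 φ F hF
  have hFi : Integrable F := F.integrable
  have hFm2 : MemLp F 2 := F.memLp 2 volume
  have hc : Continuous fun ξ => ‖fourierHat F ξ‖ ^ 2 := (continuous_fourierHat hFi).norm.pow 2
  have hcs : HasCompactSupport fun ξ => ‖fourierHat F ξ‖ ^ 2 :=
    hFs.comp_left (g := fun z : ℂ => ‖z‖ ^ 2) (by simp)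
  have hhi : Integrable fun ξ => ‖fourierHat F ξ‖ ^ 2 := hc.integrable_of_hasCompactSupport hcs
  have htot : ∫ ξ, ‖fourierHat F ξ‖ ^ 2 ≤ C * N ^ 2 := by
    rw [integral_norm_sq_fourierHat hFi hFm2, hC, mul_assoc]
    gcongr
  have hann : ∀ ξ ∈ annulus n, fourierHat F ξ = fourierHat φ ξ := fun ξ hξ => hFφ ξ hξ.2.le
  constructor
  · rw [setIntegral_congr_fun (measurableSet_annulus n)
      (fun ξ hξ => by simp only [hann ξ hξ] : Set.EqOn (fun ξ => ‖fourierHat φ ξ‖ ^ 2)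
        (fun ξ => ‖fourierHat F ξ‖ ^ 2) (annulus n))]
    exact (setIntegral_le_integral hhi (Eventually.of_forall fun ξ => by positivity)).trans htot
  · intro ε hε
    have hw : Integrable fun ξ => ‖fourierHat F ξ‖ ^ 2 * resolventWeight α ε (1 - ‖ξ‖ ^ 2) :=
      (hc.mul ((continuous_resolventWeight hε.ne').comp (by fun_prop))).integrable_of_hasCompactSupport
        hcs.mul_right
    have hsph : ∫ ω, ‖fourierHat φ ω‖ ^ 2 ∂(surfaceMeasure n) =
        ∫ ω, ‖fourierHat F ω‖ ^ 2 ∂(surfaceMeasure n) := by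
      congr 1; ext ω
      rw [hFφ ω (by rw [norm_eq_of_mem_sphere]; norm_num)]
    rw [setIntegral_congr_fun (measurableSet_annulus n)
      (fun ξ hξ => by simp only [hann ξ hξ] : Set.EqOn
        (fun ξ => ‖fourierHat φ ξ‖ ^ 2 * resolventWeight α ε (1 - ‖ξ‖ ^ 2))
        (fun ξ => ‖fourierHat F ξ‖ ^ 2 * resolventWeight α ε (1 - ‖ξ‖ ^ 2)) (annulus n)), hsph]
    have hFpi : Integrable fun x => ‖F x‖ ^ p₀ := by
      have := (F.memLp (ENNReal.ofReal p₀) volume).integrable_norm_rpow (by simpa using hp₀0)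
        ENNReal.ofReal_ne_top
      rwa [ENNReal.toReal_ofReal hp₀0.le] at this
    have hmain := abs_integral_fourierHat_sub_sphere_le hα₁ hα₂ hn (θ := θ)
      (by rw [hθ]; field_simp) hθ1 hpθ F.continuous.measurable hFi hFm2 hFpi hFs hε
    have hmain' : cosDefect α 0 * (2 * Real.pi) ^ n * ((∫ x, ‖F x‖ ^ 2) +
        108 * ((n : ℝ) + 1) ^ 2 / θ * (∫ x, ‖F x‖ ^ p₀) ^ (2 / p₀)) ≤ K₁ * N ^ 2 := by
      have e1 : (∫ x, ‖F x‖ ^ p₀) ^ (2 / p₀) ≤ C₀ ^ (2 / p₀) * N ^ 2 := by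
        calc (∫ x, ‖F x‖ ^ p₀) ^ (2 / p₀) ≤ (C₀ * N ^ p₀) ^ (2 / p₀) :=
              Real.rpow_le_rpow (integral_nonneg fun x => by positivity) hFp (by positivity)
          _ = C₀ ^ (2 / p₀) * N ^ 2 := by
              rw [Real.mul_rpow hC₀ (by positivity), ← Real.rpow_mul hN0,
                mul_div_cancel₀ _ hp₀0.ne', Real.rpow_two]
      rw [hK₁, mul_assoc _ (_ + _) (N ^ 2), add_mul, mul_assoc _ (C₀ ^ _)]
      gcongr
    -- The estimate for F is over the whole space; off the annulus the weight is bounded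
    -- independently of ε, so Plancherel permits removing that part.
    have hcompl : |∫ ξ in (annulus n)ᶜ, ‖fourierHat F ξ‖ ^ 2 * resolventWeight α ε (1 - ‖ξ‖ ^ 2)| ≤
        (9 / 16) ^ (-α) * C * N ^ 2 := by
      have h9 : (0 : ℝ) ≤ (9 / 16) ^ (-α) := by positivity
      rw [abs_of_nonneg (integral_nonneg fun ξ => mul_nonneg (by positivity)
        (resolventWeight_nonneg _ _ _))]
      calc _ ≤ ∫ ξ in (annulus n)ᶜ, ‖fourierHat F ξ‖ ^ 2 * (9 / 16) ^ (-α) := by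
            refine setIntegral_mono_on hw.integrableOn (hhi.mul_const _).integrableOn
              (measurableSet_annulus n).compl fun ξ hξ => ?_
            gcongr
            exact resolventWeight_le_of_notMem_annulus (by linarith) ε hξ
        _ ≤ ∫ ξ, ‖fourierHat F ξ‖ ^ 2 * (9 / 16) ^ (-α) :=
            setIntegral_le_integral (hhi.mul_const _) (Eventually.of_forall fun ξ => by positivity)
        _ ≤ _ := by
            rw [integral_mul_const, mul_comm, mul_assoc]
            gcongr
    have hsplit := integral_add_compl (measurableSet_annulus n) hw
    have := abs_le.1 (hmain.trans hmain')
    have := abs_le.1 hcompl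
    rw [← hsplit] at *
    rw [abs_le]
    constructor <;> linarith

/-- The restriction estimate for Schwartz functions. -/
theorem exists_restriction_estimate {α : ℝ} (hα₁ : 1 / 2 < α) (hα₂ : α < 3 / 2)
    (hn : 2 ≤ n) {p : ℝ} (hp1 : 1 ≤ p) (hp : p ≤ (2 * (n : ℝ) + 2) / ((n : ℝ) + 1 + 4 * α)) :
    ∃ C : ℝ, 0 ≤ C ∧ ∀ φ : SchwartzMap (EuclideanSpace ℝ (Fin n)) ℂ,
      ∫ ω, ‖fourierHat φ ω‖ ^ 2 ∂(surfaceMeasure n) ≤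
        C * (eLpNorm φ (ENNReal.ofReal p) volume).toReal ^ 2 := by
  obtain ⟨C, K, hC, hK, h⟩ := exists_apriori_estimates hα₁ hα₂ hn hp1 hp
  set W := (∫ u, resolventWeight α 1 u) / 2 with hW
  have hW0 : 0 < W := by
    refine half_pos ?_
    refine (integral_pos_iff_support_of_nonneg (fun u => resolventWeight_nonneg _ _ _)
      (integrable_resolventWeight hα₁ one_pos)).2 ?_
    have : Function.support (resolventWeight α 1) = Set.univ := by
      ext u; simp only [Function.mem_support, Set.mem_univ, iff_true]
      exact (Real.rpow_pos_of_pos (by positivity) _).ne'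
    rw [this]; simp
  refine ⟨W⁻¹ * (C + K), by positivity, fun φ => ?_⟩
  obtain ⟨h1, h2⟩ := h φ
  -- At ε = 1 the weight is at most 1, so the annulus integral is already controlled, and the
  -- difference estimate then controls the positive multiple W of the sphere norm.
  have h3 := abs_le.1 (h2 1 one_pos)
  have h4 : ∫ ξ in annulus n, ‖fourierHat φ ξ‖ ^ 2 * resolventWeight α 1 (1 - ‖ξ‖ ^ 2) ≤
      ∫ ξ in annulus n, ‖fourierHat φ ξ‖ ^ 2 := by
    have hi : IntegrableOn (fun ξ => ‖fourierHat φ ξ‖ ^ 2) (annulus n) := by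
      refine (((continuous_fourierHat φ.integrable).norm.pow 2).continuousOn.integrableOn_compact
        (isCompact_closedBall (0 : EuclideanSpace ℝ (Fin n)) (3 / 2))).mono_set fun ξ hξ => ?_
      rw [mem_closedBall_zero_iff]; exact hξ.2.le
    have hle : ∀ u, resolventWeight α 1 u ≤ 1 := fun u => by
      simpa using resolventWeight_le (by linarith) one_ne_zero u
    refine setIntegral_mono_on (hi.mul_bdd (c := 1) ?_ ?_) hi (measurableSet_annulus n) fun ξ _ => ?_
    · exact ((continuous_resolventWeight one_ne_zero).comp (by fun_prop)).aestronglyMeasurable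
    · refine Eventually.of_forall fun ξ => ?_
      rw [Real.norm_of_nonneg (resolventWeight_nonneg _ _ _)]
      exact hle _
    · exact mul_le_of_le_one_right (by positivity) (hle _)
  rw [mul_assoc, inv_mul_eq_div, le_div_iff₀ hW0, mul_comm, add_mul]
  rw [← hW] at h3
  linarith [h3.1]

end APriori

/-! ### Limits in L² -/

section LpLimits

open scoped ENNReal

variable {X : Type*} [MeasurableSpace X] {μ : Measure X}

theorem integral_norm_sq_eq_eLpNorm {w : X → ℂ} (hw : MemLp w 2 μ) :
    ∫ x, ‖w x‖ ^ 2 ∂μ = (eLpNorm w 2 μ).toReal ^ 2 := by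
  rw [hw.eLpNorm_eq_integral_rpow_norm (by norm_num) (by norm_num),
    ENNReal.toReal_ofReal (by positivity), ← Real.rpow_natCast, ← Real.rpow_mul (by positivity)]
  norm_num

theorem tendsto_integral_norm_sq {u : ℕ → X → ℂ} {v : X → ℂ} (hu : ∀ k, MemLp (u k) 2 μ)
    (hv : MemLp v 2 μ) (h : Tendsto (fun k => eLpNorm (u k - v) 2 μ) atTop (𝓝 0)) :
    Tendsto (fun k => ∫ x, ‖u k x‖ ^ 2 ∂μ) atTop (𝓝 (∫ x, ‖v x‖ ^ 2 ∂μ)) := by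
  have e : ∀ w : X → ℂ, ∀ hw : MemLp w 2 μ, ∫ x, ‖w x‖ ^ 2 ∂μ = ‖hw.toLp w‖ ^ 2 := fun w hw => by
    rw [integral_norm_sq_eq_eLpNorm hw, Lp.norm_toLp]
  rw [e v hv]
  simp only [fun k => e (u k) (hu k)]
  exact ((Lp.tendsto_Lp_iff_tendsto_eLpNorm'' u hu v hv).2 h).norm.pow 2

/-- The weight is absorbed as √w into the functions; multiplication by the bounded √w preserves L²
convergence. -/
theorem tendsto_integral_norm_sq_mul {u : ℕ → X → ℂ} {v : X → ℂ} (hu : ∀ k, MemLp (u k) 2 μ)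
    (hv : MemLp v 2 μ) (h : Tendsto (fun k => eLpNorm (u k - v) 2 μ) atTop (𝓝 0)) {w : X → ℝ}
    (hw : Measurable w) (hw0 : ∀ x, 0 ≤ w x) {B : ℝ} (hB : ∀ x, w x ≤ B) :
    Tendsto (fun k => ∫ x, ‖u k x‖ ^ 2 * w x ∂μ) atTop (𝓝 (∫ x, ‖v x‖ ^ 2 * w x ∂μ)) := by
  set c : X → ℂ := fun x => (Real.sqrt (w x) : ℂ) with hc
  have hcm : Measurable c := Complex.measurable_ofReal.comp hw.sqrt
  have hcn : ∀ x, ‖c x‖ ≤ Real.sqrt B := fun x => by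
    rw [hc, Complex.norm_real, Real.norm_of_nonneg (Real.sqrt_nonneg _)]
    exact Real.sqrt_le_sqrt (hB x)
  have hle : ∀ r : X → ℂ, ∀ x, ‖c x * r x‖ ≤ Real.sqrt B * ‖r x‖ := fun r x => by
    rw [norm_mul]; gcongr; exact hcn x
  have hmem : ∀ r : X → ℂ, MemLp r 2 μ → MemLp (fun x => c x * r x) 2 μ := fun r hr =>
    hr.of_le_mul (hcm.aestronglyMeasurable.mul hr.1) (Eventually.of_forall (hle r))
  have e : ∀ r : X → ℂ, (fun x => ‖r x‖ ^ 2 * w x) = fun x => ‖c x * r x‖ ^ 2 := fun r => by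
    ext x
    rw [norm_mul, mul_pow, hc, Complex.norm_real, Real.norm_eq_abs, sq_abs, Real.sq_sqrt (hw0 x),
      mul_comm]
  simp only [e]
  refine tendsto_integral_norm_sq (fun k => hmem _ (hu k)) (hmem v hv) ?_
  have hlim : Tendsto (fun k => ENNReal.ofReal (Real.sqrt B) * eLpNorm (u k - v) 2 μ) atTop (𝓝 0) := by
    simpa using ENNReal.Tendsto.const_mul h (Or.inr ENNReal.ofReal_ne_top)
  refine tendsto_of_tendsto_of_tendsto_of_le_of_le tendsto_const_nhds hlim (fun k => zero_le)
    fun k => ?_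
  refine eLpNorm_le_mul_eLpNorm_of_ae_le_mul (Eventually.of_forall fun x => ?_) 2
  have := hle (u k - v) x
  simpa [mul_sub] using this

theorem tendsto_integral_mul_of_tendsto_eLpNorm {p q : ℝ≥0∞} [p.HolderConjugate q]
    {u : ℕ → X → ℂ} {v η : X → ℂ} (hu : ∀ k, MemLp (u k) p μ)
    (hv : MemLp v p μ) (hη : MemLp η q μ) (h : Tendsto (fun k => eLpNorm (u k - v) p μ) atTop (𝓝 0)) :
    Tendsto (fun k => ∫ x, u k x * η x ∂μ) atTop (𝓝 (∫ x, v x * η x ∂μ)) := by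
  refine tendsto_integral_of_L1' _ (hv.1.mul hη.1)
    (Eventually.of_forall fun k => (hu k).integrable_mul hη) ?_
  have hlim : Tendsto (fun k => eLpNorm (u k - v) p μ * eLpNorm η q μ) atTop (𝓝 0) := by
    simpa using ENNReal.Tendsto.mul_const h (Or.inr hη.eLpNorm_ne_top)
  refine tendsto_of_tendsto_of_tendsto_of_le_of_le tendsto_const_nhds hlim (fun k => zero_le)
    fun k => ?_
  have := eLpNorm_smul_le_mul_eLpNorm (p := p) (q := q) (r := 1) hη.1 ((hu k).1.sub hv.1)
  refine le_trans (le_of_eq ?_) this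
  congr 1; ext x; simp [sub_mul]

/-- A sequence controlled by an `L^p`-convergent sequence converges in `L²`. -/
theorem exists_tendsto_eLpNorm_of_le {Y : Type*} [MeasurableSpace Y] {ν : Measure Y} {p c : ℝ≥0∞}
    (hp : 1 ≤ p) (hc : c ≠ ⊤)
    {u : ℕ → X → ℂ} (hu : ∀ k, MemLp (u k) 2 μ) {φ : ℕ → Y → ℂ} (hφ : ∀ k, MemLp (φ k) p ν)
    {f : Y → ℂ} (hf : MemLp f p ν) (hφf : Tendsto (fun k => eLpNorm (φ k - f) p ν) atTop (𝓝 0))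
    (hle : ∀ j k, eLpNorm (u j - u k) 2 μ ≤ c * eLpNorm (φ j - φ k) p ν) :
    ∃ v, MemLp v 2 μ ∧ Tendsto (fun k => eLpNorm (u k - v) 2 μ) atTop (𝓝 0) := by
  have hlim : Tendsto (fun k => c * eLpNorm (φ k - f) p ν) atTop (𝓝 0) := by
    simpa using ENNReal.Tendsto.const_mul hφf (Or.inr hc)
  have hcau : CauchySeq fun k => (hu k).toLp (u k) := by
    rw [EMetric.cauchySeq_iff]
    intro ε hε
    obtain ⟨N, hN⟩ := eventually_atTop.1 (hlim.eventually_lt_const (ENNReal.half_pos hε.ne'))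
    refine ⟨N, fun j hj k hk => ?_⟩
    rw [Lp.edist_toLp_toLp]
    calc eLpNorm (u j - u k) 2 μ ≤ c * eLpNorm (φ j - φ k) p ν := hle j k
      _ ≤ c * (eLpNorm (φ j - f) p ν + eLpNorm (φ k - f) p ν) := by
          gcongr
          have : φ j - φ k = (φ j - f) - (φ k - f) := by abel
          rw [this]
          exact eLpNorm_sub_le ((hφ j).1.sub hf.1) ((hφ k).1.sub hf.1) hp
      _ < ε / 2 + ε / 2 := by
          rw [mul_add]
          exact ENNReal.add_lt_add (hN j hj) (hN k hk)
      _ = ε := ENNReal.add_halves ε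
  obtain ⟨L, hL⟩ := cauchySeq_tendsto_of_complete hcau
  refine ⟨L, Lp.memLp L, ?_⟩
  rw [← Lp.tendsto_Lp_iff_tendsto_eLpNorm'' u hu L (Lp.memLp L), Lp.toLp_coeFn]
  exact hL

end LpLimits

/-! ### Fourier transforms of L^p functions as functions -/

section FourierRepresentation

variable {n : ℕ}

theorem fourier_comp_two_pi_smul (φ : EuclideanSpace ℝ (Fin n) → ℂ) (x : EuclideanSpace ℝ (Fin n)) :
    𝓕 (fun v => φ ((2 * Real.pi) • v)) x = ((2 * Real.pi : ℝ) ^ n)⁻¹ • fourierHat φ x := by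
  have hpi := Real.pi_pos
  rw [Real.fourier_eq', fourierHat]
  have := Measure.integral_comp_smul (volume : Measure (EuclideanSpace ℝ (Fin n)))
    (fun y => Complex.exp (-(Complex.I * ((inner ℝ x y : ℝ) : ℂ))) * φ y) (2 * Real.pi)
  rw [finrank_euclideanSpace_fin, abs_of_pos (by positivity)] at this
  rw [← this]
  congr 1; ext v
  rw [smul_eq_mul, inner_smul_right, real_inner_comm]
  congr 2
  push_cast; ring

/-- Passage from the Fourier transform with `2π` in the exponent to the one without. -/
theorem isFourierTransform_of_fourier {f G : EuclideanSpace ℝ (Fin n) → ℂ}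
    (h : ∀ Φ : SchwartzMap (EuclideanSpace ℝ (Fin n)) ℂ, Integrable (fun v => G v * Φ v) ∧
      ∫ v, G v * Φ v = ∫ x, f x * 𝓕 (Φ : EuclideanSpace ℝ (Fin n) → ℂ) x) :
    IsFourierTransform f fun ξ => G ((2 * Real.pi)⁻¹ • ξ) := by
  intro φ
  have hpi : (2 * Real.pi) ≠ 0 := by positivity
  let Φ : SchwartzMap (EuclideanSpace ℝ (Fin n)) ℂ := SchwartzMap.compCLMOfContinuousLinearEquiv ℂ
    (LinearEquiv.smulOfNeZero ℝ (EuclideanSpace ℝ (Fin n)) (2 * Real.pi) hpi).toContinuousLinearEquiv φ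
  have hΦ : (Φ : EuclideanSpace ℝ (Fin n) → ℂ) = fun v => φ ((2 * Real.pi) • v) := rfl
  have e : (fun ξ => G ((2 * Real.pi)⁻¹ • ξ) * φ ξ) = fun ξ =>
      (fun v => G v * Φ v) ((2 * Real.pi)⁻¹ • ξ) := by
    ext ξ; simp only [hΦ, smul_inv_smul₀ hpi]
  rw [e]
  refine ⟨(h Φ).1.comp_smul (inv_ne_zero hpi), ?_⟩
  rw [integral_comp_two_pi_inv_smul fun v => G v * Φ v, (h Φ).2, hΦ, ← integral_smul]
  congr 1; ext x
  rw [fourier_comp_two_pi_smul, mul_smul_comm, smul_smul, mul_inv_cancel₀ (by positivity), one_smul]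

theorem integrable_fourier_mul_schwartz {f : EuclideanSpace ℝ (Fin n) → ℂ} (hf : Integrable f)
    (Φ : SchwartzMap (EuclideanSpace ℝ (Fin n)) ℂ) : Integrable fun v => 𝓕 f v * Φ v :=
  Φ.integrable.bdd_mul (c := ∫ x, ‖f x‖) (continuous_fourier_of_integrable hf).aestronglyMeasurable
    (Eventually.of_forall fun v => norm_fourier_le_integral_norm f v)

theorem isFourierTransform_fourierHat {f : EuclideanSpace ℝ (Fin n) → ℂ} (hf : Integrable f) :
    IsFourierTransform f (fourierHat f) := by
  rw [funext (fourierHat_eq_fourier f)]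
  exact isFourierTransform_of_fourier fun Φ => ⟨integrable_fourier_mul_schwartz hf Φ,
    integral_fourier_mul_eq_of_integrable hf Φ.integrable⟩

theorem integrable_and_integral_fourier_toLp_mul {f : EuclideanSpace ℝ (Fin n) → ℂ}
    (hf : MemLp f 2) (Φ : SchwartzMap (EuclideanSpace ℝ (Fin n)) ℂ) :
    Integrable (fun v => (𝓕 (hf.toLp f) : Lp ℂ 2 (volume : Measure (EuclideanSpace ℝ (Fin n)))) v *
      Φ v) ∧ ∫ v, (𝓕 (hf.toLp f) : Lp ℂ 2 (volume : Measure (EuclideanSpace ℝ (Fin n)))) v * Φ v =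
        ∫ x, f x * 𝓕 (Φ : EuclideanSpace ℝ (Fin n) → ℂ) x := by
  refine ⟨(Lp.memLp _).integrable_mul (Φ.memLp 2 volume), ?_⟩
  have e1 := DFunLike.congr_fun (Lp.fourier_toTemperedDistribution_eq (hf.toLp f)) Φ
  simp only [TemperedDistribution.fourier_apply, Lp.toTemperedDistribution_apply,
    smul_eq_mul] at e1
  simp only [mul_comm _ (Φ _)]
  rw [← e1]
  refine integral_congr_ae ?_
  filter_upwards [hf.coeFn_toLp] with x hx
  rw [hx, mul_comm]; rfl

theorem IsFourierTransform.congr_ae {f f' g : EuclideanSpace ℝ (Fin n) → ℂ} (h : f =ᵐ[volume] f')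
    (hg : IsFourierTransform f g) : IsFourierTransform f' g := fun φ =>
  ⟨(hg φ).1, (hg φ).2.trans (integral_congr_ae (by filter_upwards [h] with x hx; rw [hx]))⟩

theorem exists_schwartz_eq_fourierHat (η : SchwartzMap (EuclideanSpace ℝ (Fin n)) ℂ) :
    ∃ H : SchwartzMap (EuclideanSpace ℝ (Fin n)) ℂ, (H : EuclideanSpace ℝ (Fin n) → ℂ) =
      fourierHat η :=
  ⟨SchwartzMap.compCLMOfContinuousLinearEquiv ℂ (LinearEquiv.smulOfNeZero ℝ
    (EuclideanSpace ℝ (Fin n)) (2 * Real.pi)⁻¹ (by positivity)).toContinuousLinearEquiv (𝓕 η),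
    funext fun ξ => (fourierHat_eq_fourier η ξ).symm⟩

/-- Every `f ∈ L^p` with `1 ≤ p ≤ 2` has a Fourier transform represented by a function. -/
theorem exists_isFourierTransform {p : ℝ} (hp1 : 1 ≤ p) (hp2 : p ≤ 2)
    {f : EuclideanSpace ℝ (Fin n) → ℂ} (hf : MemLp f (ENNReal.ofReal p)) :
    ∃ g, IsFourierTransform f g := by
  have hp0 : 0 < p := by linarith
  suffices H : ∀ f : EuclideanSpace ℝ (Fin n) → ℂ, Measurable f → MemLp f (ENNReal.ofReal p) →
      ∃ g, IsFourierTransform f g by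
    obtain ⟨g, hg⟩ := H (hf.1.mk f) hf.1.stronglyMeasurable_mk.measurable
      ((memLp_congr_ae hf.1.ae_eq_mk).1 hf)
    exact ⟨g, hg.congr_ae hf.1.ae_eq_mk.symm⟩
  clear hf f
  intro f hm hf
  have hfp : Integrable fun x => ‖f x‖ ^ p := by
    have := hf.integrable_norm_rpow (by simpa using hp0) ENNReal.ofReal_ne_top
    rwa [ENNReal.toReal_ofReal hp0.le] at this
  -- Since 1 ≤ p ≤ 2, the part of f above height 1 is in L¹ and the rest is in L²; each has a
  -- transform that is a function.
  set A : Set (EuclideanSpace ℝ (Fin n)) := {x | 1 < ‖f x‖} with hA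
  have hAm : MeasurableSet A := measurableSet_lt measurable_const hm.norm
  have h1 : Integrable (A.indicator f) := by
    refine hfp.mono' (hm.indicator hAm).aestronglyMeasurable (Eventually.of_forall fun x => ?_)
    by_cases hx : x ∈ A
    · rw [Set.indicator_of_mem hx]
      simpa using Real.rpow_le_rpow_of_exponent_le (le_of_lt hx) hp1
    · rw [Set.indicator_of_notMem hx, norm_zero]; positivity
  have h2 : MemLp (Aᶜ.indicator f) 2 := by
    rw [memLp_two_iff_integrable_sq_norm (hm.indicator hAm.compl).aestronglyMeasurable]
    refine hfp.mono' ((hm.indicator hAm.compl).norm.pow_const 2).aestronglyMeasurable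
      (Eventually.of_forall fun x => ?_)
    rw [Real.norm_of_nonneg (by positivity)]
    by_cases hx : x ∈ A
    · rw [Set.indicator_of_notMem (by simpa using hx), norm_zero, zero_pow two_ne_zero]; positivity
    · rw [Set.indicator_of_mem (by exact hx), ← Real.rpow_two]
      rcases (norm_nonneg (f x)).eq_or_lt with h0 | h0
      · rw [← h0, Real.zero_rpow two_ne_zero]; positivity
      · exact Real.rpow_le_rpow_of_exponent_ge h0 (not_lt.1 hx) hp2
  refine ⟨_, isFourierTransform_of_fourier (G := fun v => 𝓕 (A.indicator f) v +
    (𝓕 (h2.toLp _) : Lp ℂ 2 (volume : Measure (EuclideanSpace ℝ (Fin n)))) v) fun Φ => ?_⟩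
  obtain ⟨i2, e2⟩ := integrable_and_integral_fourier_toLp_mul h2 Φ
  have i1 := integrable_fourier_mul_schwartz h1 Φ
  have e1 := integral_fourier_mul_eq_of_integrable h1 Φ.integrable
  simp only [add_mul]
  refine ⟨i1.add i2, ?_⟩
  have hΦ2 : MemLp (𝓕 (Φ : EuclideanSpace ℝ (Fin n) → ℂ)) 2 := (𝓕 Φ).memLp 2 volume
  rw [integral_add i1 i2, e1, e2, ← integral_add]
  · congr 1; ext x
    rw [← add_mul, ← Set.indicator_self_add_compl A f, Pi.add_apply]
    simp
  · exact h1.mul_bdd (c := ∫ x, ‖Φ x‖)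
      (continuous_fourier_of_integrable Φ.integrable).aestronglyMeasurable
      (Eventually.of_forall fun v => norm_fourier_le_integral_norm _ v)
  · exact h2.integrable_mul hΦ2

end FourierRepresentation

/-! ### Extension by density -/

section Extension

open scoped ENNReal

variable {n : ℕ}

instance isFiniteMeasure_surfaceMeasure (n : ℕ) : IsFiniteMeasure (surfaceMeasure n) := by
  unfold surfaceMeasure; infer_instance

theorem volume_annulus_lt_top (n : ℕ) : volume (annulus n) < ⊤ :=
  (measure_mono fun _ hξ => mem_closedBall_zero_iff.2 (le_of_lt hξ.2)).trans_lt
    (measure_closedBall_lt_top (x := (0 : EuclideanSpace ℝ (Fin n))) (r := 3 / 2))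

theorem memLp_fourierHat_annulus {f : EuclideanSpace ℝ (Fin n) → ℂ} (hf : Integrable f) :
    MemLp (fourierHat f) 2 (volume.restrict (annulus n)) := by
  have hc := continuous_fourierHat hf
  have hann : IsFiniteMeasure (volume.restrict (annulus n)) :=
    ⟨by simpa using volume_annulus_lt_top n⟩
  obtain ⟨C, hC⟩ := (isCompact_closedBall (0 : EuclideanSpace ℝ (Fin n))
    (3 / 2)).exists_bound_of_continuousOn hc.continuousOn
  refine MemLp.of_bound hc.aestronglyMeasurable C ?_
  filter_upwards [ae_restrict_mem (measurableSet_annulus n)] with ξ hξ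
  exact hC ξ (mem_closedBall_zero_iff.2 (le_of_lt hξ.2))

theorem memLp_fourierHat_sphere {f : EuclideanSpace ℝ (Fin n) → ℂ} (hf : Integrable f) :
    MemLp (fun ω : Metric.sphere (0 : EuclideanSpace ℝ (Fin n)) 1 => fourierHat f ω) 2
      (surfaceMeasure n) := by
  have hc : Continuous fun ω : Metric.sphere (0 : EuclideanSpace ℝ (Fin n)) 1 => fourierHat f ω :=
    (continuous_fourierHat hf).comp continuous_subtype_val
  obtain ⟨C, hC⟩ := (isCompact_univ (X := Metric.sphere (0 : EuclideanSpace ℝ (Fin n))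
    1)).exists_bound_of_continuousOn hc.continuousOn
  exact MemLp.of_bound hc.aestronglyMeasurable C (Eventually.of_forall fun ω => hC ω trivial)

theorem fourierHat_sub (φ ψ : SchwartzMap (EuclideanSpace ℝ (Fin n)) ℂ)
    (ξ : EuclideanSpace ℝ (Fin n)) :
    fourierHat (φ - ψ : SchwartzMap (EuclideanSpace ℝ (Fin n)) ℂ) ξ =
      fourierHat φ ξ - fourierHat ψ ξ := by
  simp only [fourierHat_eq_fourier, ← SchwartzMap.fourier_coe]
  have : 𝓕 (φ - ψ) = 𝓕 φ - 𝓕 ψ := map_sub (SchwartzMap.fourierTransformCLM ℂ) φ ψ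
  rw [this]; rfl

theorem eLpNorm_le_of_integral_norm_sq_le {X : Type*} [MeasurableSpace X] {μ : Measure X} {u : X → ℂ}
    (hu : MemLp u 2 μ) {C : ℝ} {N : ℝ≥0∞} (hN : N ≠ ⊤)
    (h : ∫ x, ‖u x‖ ^ 2 ∂μ ≤ C * N.toReal ^ 2) :
    eLpNorm u 2 μ ≤ ENNReal.ofReal (Real.sqrt C) * N := by
  rw [integral_norm_sq_eq_eLpNorm hu] at h
  rw [← ENNReal.ofReal_toReal hu.eLpNorm_ne_top, ← ENNReal.ofReal_toReal hN,
    ← ENNReal.ofReal_mul (Real.sqrt_nonneg C)]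
  refine ENNReal.ofReal_le_ofReal ?_
  have := Real.sqrt_le_sqrt h
  rwa [Real.sqrt_sq ENNReal.toReal_nonneg, Real.sqrt_mul' _ (by positivity),
    Real.sqrt_sq ENNReal.toReal_nonneg] at this

/-- Schwartz functions are dense in `L^p`. -/
theorem exists_schwartz_tendsto_eLpNorm {p : ℝ≥0∞} (hp : p ≠ ⊤) (hp1 : 1 ≤ p)
    {f : EuclideanSpace ℝ (Fin n) → ℂ} (hf : MemLp f p) :
    ∃ φ : ℕ → SchwartzMap (EuclideanSpace ℝ (Fin n)) ℂ,
      Tendsto (fun k => eLpNorm (⇑(φ k) - f) p volume) atTop (𝓝 0) := by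
  have h : ∀ k : ℕ, ∃ φ : SchwartzMap (EuclideanSpace ℝ (Fin n)) ℂ,
      eLpNorm (⇑φ - f) p volume ≤ ENNReal.ofReal (1 / ((k : ℝ) + 1)) := fun k => by
    obtain ⟨g, h1, h2, h3⟩ := MemLp.exist_eLpNorm_sub_le hp hp1 hf
      (show (0 : ℝ) < 1 / ((k : ℝ) + 1) by positivity)
    refine ⟨h1.toSchwartzMap h2, ?_⟩
    rw [eLpNorm_sub_comm]
    exact h3
  choose φ hφ using h
  refine ⟨φ, tendsto_of_tendsto_of_tendsto_of_le_of_le tendsto_const_nhds ?_ (fun k => zero_le) hφ⟩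
  simpa using ENNReal.tendsto_ofReal tendsto_one_div_add_atTop_nhds_zero_nat

/-- On the annulus, the Fourier transform of `f` is the limit of those of Schwartz approximants. -/
theorem IsFourierTransform.ae_eq_of_tendsto {p : ℝ≥0∞} (hp1 : 1 ≤ p)
    {f g v : EuclideanSpace ℝ (Fin n) → ℂ} (hf : MemLp f p) (hg : IsFourierTransform f g)
    {φ : ℕ → SchwartzMap (EuclideanSpace ℝ (Fin n)) ℂ}
    (hφ : Tendsto (fun k => eLpNorm (⇑(φ k) - f) p volume) atTop (𝓝 0))
    (hv : MemLp v 2 (volume.restrict (annulus n)))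
    (hφv : Tendsto (fun k => eLpNorm (fourierHat (φ k) - v) 2 (volume.restrict (annulus n)))
      atTop (𝓝 0)) : g =ᵐ[volume.restrict (annulus n)] v := by
  have hann : IsFiniteMeasure (volume.restrict (annulus n)) :=
    ⟨by simpa using volume_annulus_lt_top n⟩
  have hpc : p.HolderConjugate p.conjExponent := ENNReal.HolderConjugate.conjExponent hp1
  have hvi : IntegrableOn v (annulus n) := hv.integrable one_le_two
  -- Pairing g with a test function equal to 1 on the annulus gives integrability there.
  have hgi : IntegrableOn g (annulus n) := by
    let b : ContDiffBump (0 : EuclideanSpace ℝ (Fin n)) := ⟨3 / 2, 2, by norm_num, by norm_num⟩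
    have hbs : HasCompactSupport fun x => (b x : ℂ) :=
      b.hasCompactSupport.comp_left (g := fun t : ℝ => (t : ℂ)) rfl
    have := (hg (hbs.toSchwartzMap (Complex.ofRealCLM.contDiff.comp b.contDiff))).1
    refine (this.integrableOn (s := annulus n)).congr_fun (fun ξ hξ => ?_) (measurableSet_annulus n)
    have h1 : b ξ = 1 := b.one_of_mem_closedBall (mem_closedBall_zero_iff.2 (le_of_lt hξ.2))
    change g ξ * ((b ξ : ℝ) : ℂ) = g ξ
    rw [h1, Complex.ofReal_one, mul_one]
  have hz := (isOpen_annulus n).ae_eq_zero_of_integral_contDiff_smul_eq_zero (μ := volume)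
    (f := fun ξ => g ξ - v ξ) (hgi.sub hvi).locallyIntegrableOn fun η hη hηc hηs => ?_
  · rw [EventuallyEq, ae_restrict_iff' (measurableSet_annulus n)]
    filter_upwards [hz] with ξ hξ hm using sub_eq_zero.1 (hξ hm)
  have hηc' : HasCompactSupport fun x => (η x : ℂ) := hηc.comp_left (g := fun t : ℝ => (t : ℂ)) rfl
  let θ : SchwartzMap (EuclideanSpace ℝ (Fin n)) ℂ :=
    hηc'.toSchwartzMap (Complex.ofRealCLM.contDiff.comp hη)
  have hθ : ∀ x, θ x = (η x : ℂ) := fun x => rfl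
  have hθz : ∀ x, x ∉ annulus n → θ x = 0 := fun x hx => by
    rw [hθ, image_eq_zero_of_notMem_tsupport fun h => hx (hηs h), Complex.ofReal_zero]
  have hres : ∀ r : EuclideanSpace ℝ (Fin n) → ℂ, ∫ ξ in annulus n, r ξ * θ ξ = ∫ ξ, r ξ * θ ξ :=
    fun r => setIntegral_eq_integral_of_forall_compl_eq_zero fun x hx => by rw [hθz x hx, mul_zero]
  -- The transform of the test function is Schwartz, hence in the dual exponent of p, also when that
  -- is ∞. Both sides of the duality thus pass to the limit along φ.
  obtain ⟨H, hH⟩ := exists_schwartz_eq_fourierHat θ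
  have L1 : Tendsto (fun k => ∫ x, φ k x * H x) atTop (𝓝 (∫ x, f x * H x)) :=
    tendsto_integral_mul_of_tendsto_eLpNorm (p := p) (q := p.conjExponent)
      (fun k => (φ k).memLp p volume) hf (H.memLp _ volume) hφ
  have L2 : Tendsto (fun k => ∫ ξ in annulus n, fourierHat (φ k) ξ * θ ξ) atTop
      (𝓝 (∫ ξ in annulus n, v ξ * θ ξ)) :=
    tendsto_integral_mul_of_tendsto_eLpNorm (p := 2) (q := 2)
      (fun k => memLp_fourierHat_annulus (φ k).integrable) hv
      ((θ.memLp 2 volume).restrict _) hφv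
  have e : ∀ k, ∫ ξ in annulus n, fourierHat (φ k) ξ * θ ξ = ∫ x, φ k x * H x := fun k => by
    rw [hres, (isFourierTransform_fourierHat (φ k).integrable θ).2, hH]
  simp only [e] at L2
  have huniq := tendsto_nhds_unique L1 L2
  have hgθ : ∫ ξ, g ξ * θ ξ = ∫ x, f x * H x := by rw [(hg θ).2, hH]
  have hηb : ∃ C, ∀ x, ‖θ x‖ ≤ C := ⟨_, fun x => θ.norm_le_seminorm ℝ x⟩
  obtain ⟨C, hC⟩ := hηb
  have hgθi : IntegrableOn (fun ξ => g ξ * θ ξ) (annulus n) := (hg θ).1.integrableOn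
  have hvθi : IntegrableOn (fun ξ => v ξ * θ ξ) (annulus n) :=
    hvi.mul_bdd (c := C) θ.continuous.aestronglyMeasurable (Eventually.of_forall hC)
  calc ∫ ξ, η ξ • (g ξ - v ξ) = ∫ ξ, (g ξ - v ξ) * θ ξ := by
        congr 1; ext ξ; rw [hθ, Complex.real_smul, mul_comm]
    _ = ∫ ξ in annulus n, (g ξ - v ξ) * θ ξ := (hres fun ξ => g ξ - v ξ).symm
    _ = (∫ ξ in annulus n, g ξ * θ ξ) - ∫ ξ in annulus n, v ξ * θ ξ := by
        simp only [sub_mul]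
        exact integral_sub hgθi hvθi
    _ = 0 := by rw [hres g, hgθ, huniq, sub_self]

end Extension

/-! ### The main theorem -/

theorem mainTheorem2 (α : ℝ) (hα₁ : 1 / 2 < α) (hα₂ : α < 3 / 2) :
    ∃ Cα : ℝ, ∀ n : ℕ, 2 ≤ n → ∀ p : ℝ, 1 ≤ p →
      p ≤ (2 * (n : ℝ) + 2) / ((n : ℝ) + 1 + 4 * α) →
      ∃ K : ℝ, ∀ f : EuclideanSpace ℝ (Fin n) → ℂ, MemLp f (ENNReal.ofReal p) volume →
        (∃ g, IsFourierTransform f g) ∧ (∃ h, IsSphereRestriction p f h) ∧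
        ∀ g h, IsFourierTransform f g → IsSphereRestriction p f h → ∀ ε : ℝ, 0 < ε →
          IntegrableOn (fun ξ => ‖g ξ‖ ^ 2 / ((1 - ‖ξ‖ ^ 2) ^ 2 + ε ^ 2) ^ α) (annulus n) volume ∧
          |(∫ ξ in annulus n, ‖g ξ‖ ^ 2 / ((1 - ‖ξ‖ ^ 2) ^ 2 + ε ^ 2) ^ α) -
              Cα / ε ^ (2 * α - 1) * ∫ ω, ‖h ω‖ ^ 2 ∂(surfaceMeasure n)| ≤
            K * (eLpNorm f (ENNReal.ofReal p) volume).toReal ^ 2 := by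
  refine ⟨(∫ u : ℝ, (1 + u ^ 2) ^ (-α)) / 2, fun n hn p hp1 hp => ?_⟩
  obtain ⟨C, K, hC, hK, hap⟩ := exists_apriori_estimates hα₁ hα₂ hn hp1 hp
  obtain ⟨R, hR, hres⟩ := exists_restriction_estimate hα₁ hα₂ hn hp1 hp
  have hP1 : 1 ≤ ENNReal.ofReal p := by simpa using hp1
  have hPtop : ENNReal.ofReal p ≠ ⊤ := ENNReal.ofReal_ne_top
  have hp2 : p ≤ 2 := hp.trans (by rw [div_le_iff₀ (by positivity)]; linarith)
  refine ⟨K, fun f hf => ⟨exists_isFourierTransform hp1 hp2 hf, ?_, ?_⟩⟩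
  · obtain ⟨φ, hφ⟩ := exists_schwartz_tendsto_eLpNorm hPtop hP1 hf
    obtain ⟨h, hh, hφh⟩ := exists_tendsto_eLpNorm_of_le (μ := surfaceMeasure n) hP1
      (c := ENNReal.ofReal (Real.sqrt R)) ENNReal.ofReal_ne_top
      (fun k => memLp_fourierHat_sphere (φ k).integrable)
      (fun k => (φ k).memLp (ENNReal.ofReal p) volume) hf hφ fun j k => by
        have := eLpNorm_le_of_integral_norm_sq_le
          (memLp_fourierHat_sphere (φ j - φ k).integrable)
          ((φ j - φ k).memLp (ENNReal.ofReal p) volume).eLpNorm_ne_top (hres (φ j - φ k))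
        simp only [fourierHat_sub] at this
        exact this
    exact ⟨h, hh, φ, hφ, hφh⟩
  · intro g h hg hh ε hε
    obtain ⟨hh2, φ, hφ, hφh⟩ := hh
    -- The approximants are those that come with the given h, so the annulus and sphere limits are
    -- taken along one sequence. No separate uniqueness of h is required.
    obtain ⟨v, hv, hφv⟩ := exists_tendsto_eLpNorm_of_le (μ := volume.restrict (annulus n)) hP1
      (c := ENNReal.ofReal (Real.sqrt C)) ENNReal.ofReal_ne_top
      (fun k => memLp_fourierHat_annulus (φ k).integrable)
      (fun k => (φ k).memLp (ENNReal.ofReal p) volume) hf hφ fun j k => by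
        have := eLpNorm_le_of_integral_norm_sq_le
          (memLp_fourierHat_annulus (φ j - φ k).integrable)
          ((φ j - φ k).memLp (ENNReal.ofReal p) volume).eLpNorm_ne_top (hap (φ j - φ k)).1
        rw [funext (fourierHat_sub (φ j) (φ k))] at this
        exact this
    have hgv : g =ᵐ[volume.restrict (annulus n)] v := hg.ae_eq_of_tendsto hP1 hf hφ hv hφv
    have hwc : Continuous fun ξ : EuclideanSpace ℝ (Fin n) => resolventWeight α ε (1 - ‖ξ‖ ^ 2) :=
      (continuous_resolventWeight hε.ne').comp (by fun_prop)
    have hw0 : ∀ ξ : EuclideanSpace ℝ (Fin n), 0 ≤ resolventWeight α ε (1 - ‖ξ‖ ^ 2) :=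
      fun ξ => resolventWeight_nonneg _ _ _
    have hwB : ∀ ξ : EuclideanSpace ℝ (Fin n), resolventWeight α ε (1 - ‖ξ‖ ^ 2) ≤ (ε ^ 2) ^ (-α) :=
      fun ξ => resolventWeight_le (by linarith) hε.ne' _
    have hgv' : (fun ξ => ‖g ξ‖ ^ 2 * resolventWeight α ε (1 - ‖ξ‖ ^ 2))
        =ᵐ[volume.restrict (annulus n)] fun ξ => ‖v ξ‖ ^ 2 * resolventWeight α ε (1 - ‖ξ‖ ^ 2) := by
      filter_upwards [hgv] with ξ hξ
      rw [hξ]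
    simp only [div_rpow_eq_mul_resolventWeight]
    refine ⟨?_, ?_⟩
    · refine (integrable_congr hgv').2 ?_
      refine ((memLp_two_iff_integrable_sq_norm hv.1).1 hv).mul_bdd (c := (ε ^ 2) ^ (-α))
        hwc.aestronglyMeasurable (Eventually.of_forall fun ξ => ?_)
      rw [Real.norm_of_nonneg (hw0 ξ)]
      exact hwB ξ
    · rw [integral_congr_ae hgv', div_right_comm, ← integral_resolventWeight hε]
      have L1 := tendsto_integral_norm_sq_mul
        (fun k => memLp_fourierHat_annulus (φ k).integrable) hv hφv hwc.measurable hw0 hwB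
      have L2 := tendsto_integral_norm_sq
        (fun k => memLp_fourierHat_sphere (φ k).integrable) hh2 hφh
      have L3 : Tendsto (fun k => (eLpNorm (φ k) (ENNReal.ofReal p) volume).toReal) atTop
          (𝓝 (eLpNorm f (ENNReal.ofReal p) volume).toReal) := by
        have : Fact (1 ≤ ENNReal.ofReal p) := ⟨hP1⟩
        have := ((Lp.tendsto_Lp_iff_tendsto_eLpNorm'' (fun k => (φ k : EuclideanSpace ℝ (Fin n) → ℂ))
          (fun k => (φ k).memLp (ENNReal.ofReal p) volume) f hf).2 hφ).norm
        simpa only [Lp.norm_toLp] using this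
      -- For fixed ε the weight is bounded, so every term converges; K does not depend on ε or k.
      exact le_of_tendsto_of_tendsto (L1.sub (L2.const_mul _)).abs ((L3.pow 2).const_mul K)
        (Eventually.of_forall fun k => (hap (φ k)).2 ε hε)
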